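/- **Proposition 3.3.** Let $M\subset\mathbb R^n$ be an embedded $C^2$-submanifold with the induced Riemannian metric, and let $U\subset\mathbb R^n$ be an open neighbourhood of $M$ on which the closest-point projection $P\colon U\to M$, $P(y)=\operatorname{argmin}_{r\in M}\|r-y\|$, is well defined (the minimizer exists and is unique) and of class $C^2$. Let $\kappa\in[0,\infty]$ be the largest principal curvature of $M$, i.e. the supremum of $\langle A_p(X,X),\nu\rangle$ over all $p\in M$, unit tangent vectors $X\in T_pM$ and unit normal vectors $\nu\in T_pM^\perp$, where $A$ is the second fundamental form. Let $\Omega\subset\mathbb R^s$ be bounded and open, and let $q>\max\{2,s\}$. Let $C_P$ be the Poincaré constant of $\Omega$ for the exponent $\frac{2q}{q-2}$, i.e. the smallest constant such that $\|\varphi\|_{L^{2q/(q-2)}(\Omega)}\le C_P\,\|d\varphi\|_{L^2(\Omega)}$ for all $\varphi\in C_c^\infty(\Omega)$. Let $u\in W^{1,q}(\Omega,M)$, and assume that for some $\delta>0$ the ball of radius $\delta$ around $u(x)$ is contained in $U$ for almost every $x\in\Omega$ (this holds whenever $U$ contains a $\delta$-neighbourhood of $M$, or whenever $u(\Omega)$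 has compact closure in $M$). Put $$H=\{v\in H^1(\Omega,\mathbb R^n) : v(x)\in M \text{ for a.e. } x\in\Omega,\ v-u\in H^1_0(\Omega,\mathbb R^n)\},\qquad \mathcal J(v)=\tfrac12\int_\Omega |dv|^2\,dx,$$ and let $u$ be a critical point of $\mathcal J$ in $H$, i.e. $\frac{d}{dt}\big|_{t=0}\mathcal J(u_t)=0$ for every family $(u_t)_{t\in\mathbb R}$ in $H$ with $u_0=u$ that is differentiable at $t=0$ with respect to the $H^1$-norm. Here $|dv|$ is the Euclidean (Frobenius) norm of the weak derivative, and $|w|_{H^1}=\|dw\|_{L^2(\Omega)}$ denotes the $H^1$-seminorm. If $$\|du\|_{L^q(\Omega)}<(\kappa C_P)^{-1}$$ (with $0^{-1}=\infty$ and $\infty^{-1}=0$), then $\mathcal J$ is $H^1$-elliptic around $u$ in the extrinsic sense: $u\in H$, and there exist $\lambda,\Lambda,\epsilon>0$ such that for all $v\in H$ with $\|v-u\|_{L^\infty(\Omega)}\le\epsilon$ $$\lambda\,|v-u|_{H^1}^2\le \mathcal J(v)-\mathcal J(u)\le\Lambda\,|v-u|_{H^1}^2 .$$ -/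

import Mathlib

open MeasureTheory Set Filter Topology
open scoped ENNReal ContDiff

noncomputable section

namespace HarmonicMaps

/-- Euclidean space `ℝ^k` with its Euclidean norm. -/
abbrev E (k : ℕ) : Type := EuclideanSpace ℝ (Fin k)

/-! ### Submanifolds of Euclidean space, closest-point projection, principal curvatures -/

/-- `M ⊆ ℝⁿ` is an embedded `C²`-submanifold of dimension `d`: around each of its points there is a
`C²`-diffeomorphism between open subsets of `ℝⁿ` that maps `M` to the coordinate plane
`{y | y_i = 0 for i ≥ d}`. The Riemannian metric on `M` is the induced one. -/
def IsC2Submanifold {n : ℕ} (d : ℕ) (M : Set (E n)) : Prop :=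
  d ≤ n ∧ ∀ p ∈ M, ∃ Φ : OpenPartialHomeomorph (E n) (E n),
    p ∈ Φ.source ∧ ContDiffOn ℝ 2 Φ Φ.source ∧ ContDiffOn ℝ 2 Φ.symm Φ.target ∧
      ∀ x ∈ Φ.source, x ∈ M ↔ ∀ i : Fin n, d ≤ (i : ℕ) → Φ x i = 0

/-- `P : U → M` is the closest-point projection: for `y ∈ U`, the point `P y` is the unique
minimizer of `r ↦ |r - y|` over `r ∈ M`. -/
def IsClosestPointProjection {n : ℕ} (M U : Set (E n)) (P : E n → E n) : Prop :=
  ∀ y ∈ U, P y ∈ M ∧ ∀ r ∈ M, r ≠ P y → ‖P y - y‖ < ‖r - y‖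

/-- `γ` is (near `t = 0`) a `C²`-curve in `M` through `p`. -/
def IsC2CurveThrough {n : ℕ} (M : Set (E n)) (p : E n) (γ : ℝ → E n) : Prop :=
  ContDiffAt ℝ 2 γ 0 ∧ (∀ᶠ t in 𝓝 (0 : ℝ), γ t ∈ M) ∧ γ 0 = p

/-- `ν` is orthogonal to the tangent space `T_p M`, the set of all velocities at `p` of curves
in `M`. -/
def IsNormalVector {n : ℕ} (M : Set (E n)) (p ν : E n) : Prop :=
  ∀ γ : ℝ → E n, IsC2CurveThrough M p γ → inner ℝ (deriv γ 0) ν = 0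

/-- The largest principal curvature `κ` of `M`. The largest principal curvature at a point `p`
with respect to a unit normal `ν` is the maximum of the normal curvatures
`⟨A(X, X), ν⟩ = ⟨γ''(0), ν⟩`, where `X = γ'(0)` runs through the unit tangent vectors at `p` and `A`
is the second fundamental form. The supremum is over all points and all unit normals; since with `ν`
also `-ν` is a unit normal, it is the supremum of the absolute values of the principal
curvatures. -/
def maxPrincipalCurvature {n : ℕ} (M : Set (E n)) : ℝ≥0∞ :=
  sSup {k : ℝ≥0∞ | ∃ p ∈ M, ∃ ν : E n, ∃ γ : ℝ → E n,
    IsNormalVector M p ν ∧ ‖ν‖ = 1 ∧ IsC2CurveThrough M p γ ∧ ‖deriv γ 0‖ = 1 ∧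
      k = ENNReal.ofReal (inner ℝ (deriv (deriv γ) 0) ν)}

/-! ### Sobolev spaces -/

/-- `φ` belongs to `C_c^∞(Ω, F)`. -/
def IsTestFunction {s : ℕ} {F : Type*} [NormedAddCommGroup F] [NormedSpace ℝ F]
    (Ω : Set (E s)) (φ : E s → F) : Prop :=
  ContDiff ℝ ∞ φ ∧ HasCompactSupport φ ∧ tsupport φ ⊆ Ω

/-- `G` is a weak derivative of `u` on `Ω`. -/
def HasWeakDeriv {s n : ℕ} (Ω : Set (E s)) (u : E s → E n) (G : E s → E s →L[ℝ] E n) : Prop :=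
  LocallyIntegrableOn u Ω ∧ LocallyIntegrableOn G Ω ∧
    ∀ φ : E s → ℝ, IsTestFunction Ω φ → ∀ e : E s,
      ∫ x in Ω, (fderiv ℝ φ x e) • u x = -∫ x in Ω, φ x • G x e

open Classical in
/-- The weak derivative `du` of `u` on `Ω` (unique almost everywhere on `Ω`; zero if there is
none). -/
def weakDeriv {s n : ℕ} (Ω : Set (E s)) (u : E s → E n) : E s → E s →L[ℝ] E n :=
  if h : ∃ G, HasWeakDeriv Ω u G then h.choose else 0

/-- `u ∈ W^{1,p}(Ω, ℝⁿ)`. -/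
def MemW1 {s n : ℕ} (p : ℝ≥0∞) (Ω : Set (E s)) (u : E s → E n) : Prop :=
  (∃ G, HasWeakDeriv Ω u G) ∧
    MemLp u p (volume.restrict Ω) ∧ MemLp (weakDeriv Ω u) p (volume.restrict Ω)

/-- `u ∈ W^{1,p}(Ω, M)`. -/
def MemW1Into {s n : ℕ} (p : ℝ≥0∞) (Ω : Set (E s)) (M : Set (E n)) (u : E s → E n) : Prop :=
  MemW1 p Ω u ∧ ∀ᵐ x ∂volume.restrict Ω, u x ∈ M

/-- `w ∈ H¹₀(Ω, ℝⁿ)`, the closure of `C_c^∞(Ω, ℝⁿ)` in `H¹(Ω, ℝⁿ)`. -/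
def MemH10 {s n : ℕ} (Ω : Set (E s)) (w : E s → E n) : Prop :=
  MemW1 2 Ω w ∧ ∃ φ : ℕ → E s → E n, (∀ k, IsTestFunction Ω (φ k)) ∧
    Tendsto (fun k => eLpNorm (w - φ k) 2 (volume.restrict Ω)) atTop (𝓝 0) ∧
    Tendsto (fun k => eLpNorm (weakDeriv Ω w - fderiv ℝ (φ k)) 2 (volume.restrict Ω)) atTop (𝓝 0)

/-- The set of all `v ∈ H¹(Ω, M)` with `v = φ` on `∂Ω` (that is, `v - φ ∈ H¹₀(Ω, ℝⁿ)`). -/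
def H1Boundary {s n : ℕ} (Ω : Set (E s)) (M : Set (E n)) (φ : E s → E n) : Set (E s → E n) :=
  {v | MemW1Into 2 Ω M v ∧ MemH10 Ω (v - φ)}

/-- The Euclidean (Frobenius) norm of a linear map `ℝˢ → ℝⁿ`. -/
def frobNorm {s n : ℕ} (T : E s →L[ℝ] E n) : ℝ :=
  Real.sqrt (∑ i : Fin s, ‖T (EuclideanSpace.single i 1)‖ ^ 2)

/-- `‖du‖_{L^q(Ω)}`. -/
def derivLpNorm {s n : ℕ} (q : ℝ) (Ω : Set (E s)) (u : E s → E n) : ℝ≥0∞ :=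
  eLpNorm (fun x => frobNorm (weakDeriv Ω u x)) (ENNReal.ofReal q) (volume.restrict Ω)

/-- The squared `H¹`-seminorm `|w|²_{H¹} = ∫_Ω |dw|²`. -/
def h1SeminormSq {s n : ℕ} (Ω : Set (E s)) (w : E s → E n) : ℝ :=
  ∫ x in Ω, frobNorm (weakDeriv Ω w x) ^ 2

/-- The Poincaré constant of `Ω` for the exponent `r`: the smallest `C` such that
`‖φ‖_{L^r(Ω)} ≤ C ‖dφ‖_{L²(Ω)}` for all `φ ∈ C_c^∞(Ω)` (equivalently, for all `φ ∈ H¹₀(Ω)`). -/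
def poincareConstant {s : ℕ} (r : ℝ) (Ω : Set (E s)) : ℝ≥0∞ :=
  sInf {C : ℝ≥0∞ | ∀ φ : E s → ℝ, IsTestFunction Ω φ →
    eLpNorm φ (ENNReal.ofReal r) (volume.restrict Ω) ≤
      C * eLpNorm (fderiv ℝ φ) 2 (volume.restrict Ω)}

/-! ### The harmonic energy, critical points, ellipticity -/

/-- The harmonic (Dirichlet) energy `J(v) = ½ ∫_Ω |dv|²`. -/
def harmonicEnergy {s n : ℕ} (Ω : Set (E s)) (v : E s → E n) : ℝ :=
  (1 / 2) * h1SeminormSq Ω v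

/-- `c` is a variation of `u` in `H`: a one-parameter family in `H` with `c 0 = u` that is
differentiable at `t = 0` with respect to the `H¹(Ω, ℝⁿ)`-norm. -/
def IsVariation {s n : ℕ} (Ω : Set (E s)) (H : Set (E s → E n)) (u : E s → E n)
    (c : ℝ → E s → E n) : Prop :=
  c 0 = u ∧ (∀ t, c t ∈ H) ∧ ∃ ξ : E s → E n, MemW1 2 Ω ξ ∧
    Tendsto (fun t : ℝ => eLpNorm (t⁻¹ • (c t - u) - ξ) 2 (volume.restrict Ω)
        + eLpNorm (weakDeriv Ω (t⁻¹ • (c t - u) - ξ)) 2 (volume.restrict Ω))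
      (𝓝[≠] 0) (𝓝 0)

/-- `u` is a critical point of `J` in `H`: the first variation of `J` at `u` vanishes. -/
def IsCriticalPoint {s n : ℕ} (Ω : Set (E s)) (H : Set (E s → E n)) (J : (E s → E n) → ℝ)
    (u : E s → E n) : Prop :=
  ∀ c : ℝ → E s → E n, IsVariation Ω H u c → HasDerivAt (fun t => J (c t)) 0 0

/-- The functional `J` on `H` is `H¹`-elliptic around `u ∈ H`; the condition
`∀ᵐ x, ‖v x - u x‖ ≤ ε` says that `v` lies in the closed `L^∞`-ball of radius `ε` around `u`. -/
def IsH1Elliptic {s n : ℕ} (Ω : Set (E s)) (H : Set (E s → E n)) (J : (E s → E n) → ℝ)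
    (u : E s → E n) : Prop :=
  u ∈ H ∧ ∃ lam Lam ε : ℝ, 0 < lam ∧ 0 < Lam ∧ 0 < ε ∧
    ∀ v ∈ H, (∀ᵐ x ∂volume.restrict Ω, ‖v x - u x‖ ≤ ε) →
      lam * h1SeminormSq Ω (v - u) ≤ J v - J u ∧ J v - J u ≤ Lam * h1SeminormSq Ω (v - u)

end HarmonicMaps

end

/-! Write `w = v - u`. The energy is half the square of a Hilbert norm, so `J(v) - J(u) = ½|w|² +
∫⟨du, dw⟩` (`harmonicEnergy_sub_eq`). Both ellipticity bounds follow once the cross term is at most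
`½τ²|w|²` in absolute value for a fixed `τ < 1`.

Criticality rewrites the cross term. Varying `u` through the maps `P(u + t η(u) φ)` gives the
harmonic map equation `∫⟨du, dφ⟩ = -∫⟨A, φ⟩` with `A = ∑ᵢ D²P(u)(∂ᵢu, ∂ᵢu)`
(`integral_frobInner_fderiv_eq`), and density extends it to `w ∈ H¹₀`
(`integral_frobInner_weakDeriv_eq`). Let `k` be a real upper bound for the principal curvatures. Two
geometric facts make the right-hand side quadratic in `w`. First, `A` is normal to `M`, so `|⟨A, w⟩|
≤ k|du|²|w^⊥|` (`norm_inner_secondFormTrace_le`). Second, `w(x)` is a secant of `M` of length at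
most `ε`, so its normal part is of second order: `|w^⊥| ≤ (k/2)|w|²/(1 - kε)²`
(`norm_normal_part_le`). Hence the cross term is at most `½(1 - kε)⁻² ∫ k²|du|²|w|²`. Hölder with
the exponents `q` and `2q/(q-2)`, followed by Poincaré, bounds the `L²`-norm of `k|du||w|` by
`Θ‖dw‖`, where the smallness condition permits `Θ < 1` (`exists_contraction_of_small`). For small
`ε` also `τ = Θ/(1 - kε) < 1`.

The geometry is read off from `P` alone. At `p ∈ M` the derivative `DP(p)` is the orthogonal
projection onto the tangent space. For tangent `Y` the operator `D²P(p)(Y, ·)` is symmetric,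
interchanges tangent and normal vectors, and its norm is at most `k|Y|` (`norm_second_le`).

The analytic work is to show that the variations are admissible. This needs a chain rule for Sobolev
maps, proved by mollification (`HasWeakDeriv.comp`), and cutoffs in the target with bounded
gradients, since `M` may be noncompact and `P` is controlled only on `U`. -/

noncomputable section

namespace HarmonicMaps

/-! ### Closest-point projection, second fundamental form and secants -/

section Geometry

variable {n : ℕ} {M U : Set (E n)} {P : E n → E n}

lemma IsClosestPointProjection.eq_self (hP : IsClosestPointProjection M U P) (hMU : M ⊆ U)
    {p : E n} (hp : p ∈ M) : P p = p := by
  by_contra h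
  have h1 := (hP p (hMU hp)).2 p hp (Ne.symm h)
  simp only [sub_self, norm_zero] at h1
  exact absurd h1 (not_lt.2 (norm_nonneg _))

lemma contDiffAt_proj (hU : IsOpen U) (hPC2 : ContDiffOn ℝ 2 P U) {y : E n} (hy : y ∈ U) :
    ContDiffAt ℝ 2 P y :=
  hPC2.contDiffAt (hU.mem_nhds hy)

lemma hasFDerivAt_proj (hU : IsOpen U) (hPC2 : ContDiffOn ℝ 2 P U) {y : E n} (hy : y ∈ U) :
    HasFDerivAt P (fderiv ℝ P y) y :=
  ((contDiffAt_proj hU hPC2 hy).differentiableAt (by norm_num)).hasFDerivAt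

lemma hasFDerivAt_fderiv_proj (hU : IsOpen U) (hPC2 : ContDiffOn ℝ 2 P U) {y : E n}
    (hy : y ∈ U) : HasFDerivAt (fderiv ℝ P) (fderiv ℝ (fderiv ℝ P) y) y :=
  (((contDiffAt_proj hU hPC2 hy).fderiv_right (m := 1) (by norm_num)).differentiableAt
    (by norm_num)).hasFDerivAt

lemma hasDerivAt_line {y X : E n} {t : ℝ} : HasDerivAt (fun t : ℝ => y + t • X) X t := by
  simpa using ((hasDerivAt_id t).smul_const X).const_add y

lemma hasDerivAt_proj_line (hU : IsOpen U) (hPC2 : ContDiffOn ℝ 2 P U) {y X : E n} {t : ℝ}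
    (hy : y + t • X ∈ U) :
    HasDerivAt (fun t : ℝ => P (y + t • X)) (fderiv ℝ P (y + t • X) X) t :=
  (hasFDerivAt_proj hU hPC2 hy).comp_hasDerivAt t hasDerivAt_line

lemma eventually_line_mem (hU : IsOpen U) {y : E n} (X : E n) (hy : y ∈ U) :
    ∀ᶠ t in 𝓝 (0 : ℝ), y + t • X ∈ U := by
  have : ContinuousAt (fun t : ℝ => y + t • X) 0 := (hasDerivAt_line).continuousAt
  exact this.eventually_mem (by simpa using hU.mem_nhds hy)

lemma isC2CurveThrough_proj_line (hU : IsOpen U)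
    (hP : IsClosestPointProjection M U P) (hPC2 : ContDiffOn ℝ 2 P U) {y : E n} (X : E n)
    (hy : y ∈ U) : IsC2CurveThrough M (P y) (fun t : ℝ => P (y + t • X)) := by
  refine ⟨?_, ?_, by simp⟩
  · refine ContDiffAt.comp (0 : ℝ) (g := P) (f := fun t : ℝ => y + t • X)
      (by simpa using contDiffAt_proj hU hPC2 hy) (by fun_prop)
  · filter_upwards [eventually_line_mem hU X hy] with t ht using (hP _ ht).1

/-- First-order condition for the minimizer: the curve `t ↦ P (P y + t • X)` stays in `M` and passes
through `P y`, where the distance to `y` is minimal. -/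
lemma inner_sub_proj_fderiv (hU : IsOpen U) (hMU : M ⊆ U)
    (hP : IsClosestPointProjection M U P) (hPC2 : ContDiffOn ℝ 2 P U) {y : E n} (X : E n)
    (hy : y ∈ U) : inner ℝ (y - P y) (fderiv ℝ P (P y) X) = 0 := by
  have hPy : P y ∈ U := hMU (hP y hy).1
  have h1 : HasDerivAt (fun t : ℝ => P (P y + t • X) - y) (fderiv ℝ P (P y) X) 0 := by
    have := (hasDerivAt_proj_line hU hPC2 (y := P y) (X := X) (t := 0) (by simpa using hPy))
    simpa using this.sub_const y
  have h2 := h1.norm_sq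
  have h3 : IsLocalMin (fun t : ℝ => ‖P (P y + t • X) - y‖ ^ 2) 0 := by
    filter_upwards [eventually_line_mem hU X hPy] with t ht
    have : P (P y + (0 : ℝ) • X) = P y := by
      simpa using hP.eq_self hMU (hP y hy).1
    rw [this]
    have h4 : ‖P y - y‖ ≤ ‖P (P y + t • X) - y‖ := by
      by_cases h : P (P y + t • X) = P y
      · rw [h]
      · exact ((hP y hy).2 _ (hP _ ht).1 h).le
    gcongr
  have h5 := h3.hasDerivAt_eq_zero h2
  have : P (P y + (0 : ℝ) • X) = P y := by
    simpa using hP.eq_self hMU (hP y hy).1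
  rw [this] at h5
  have : inner ℝ (P y - y) (fderiv ℝ P (P y) X) = 0 := by linarith
  rw [← neg_sub, inner_neg_left, this, neg_zero]

/-- Differentiate `P ∘ P = P`. -/
lemma fderiv_proj_fderiv_proj (hU : IsOpen U) (hMU : M ⊆ U)
    (hP : IsClosestPointProjection M U P) (hPC2 : ContDiffOn ℝ 2 P U) {y : E n} (X : E n)
    (hy : y ∈ U) : fderiv ℝ P (P y) (fderiv ℝ P y X) = fderiv ℝ P y X := by
  have h1 := (hasFDerivAt_proj hU hPC2 (hMU (hP y hy).1)).comp y (hasFDerivAt_proj hU hPC2 hy)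
  have h2 : P ∘ P =ᶠ[𝓝 y] P := by
    filter_upwards [hU.mem_nhds hy] with z hz using hP.eq_self hMU (hP z hz).1
  have h3 := (h1.congr_of_eventuallyEq h2.symm).unique (hasFDerivAt_proj hU hPC2 hy)
  exact DFunLike.congr_fun h3 X

/-- The derivative of the orthogonality relation `⟨y - P y, DP(P y) X⟩ = 0` in `y`. -/
lemma inner_sub_fderiv_add (hU : IsOpen U) (hMU : M ⊆ U)
    (hP : IsClosestPointProjection M U P) (hPC2 : ContDiffOn ℝ 2 P U) {y : E n} (V X : E n)
    (hy : y ∈ U) :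
    inner ℝ (y - P y) (fderiv ℝ (fderiv ℝ P) (P y) (fderiv ℝ P y V) X) +
      inner ℝ (V - fderiv ℝ P y V) (fderiv ℝ P (P y) X) = 0 := by
  have hy' : y + (0 : ℝ) • V ∈ U := by simpa using hy
  have h1 : HasDerivAt (fun t : ℝ => (y + t • V) - P (y + t • V)) (V - fderiv ℝ P y V) 0 := by
    have := (hasDerivAt_line (y := y) (X := V) (t := 0)).sub (hasDerivAt_proj_line hU hPC2 hy')
    rw [zero_smul, add_zero] at this
    exact this
  have h2 : HasDerivAt (fun t : ℝ => fderiv ℝ P (P (y + t • V)))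
      (fderiv ℝ (fderiv ℝ P) (P y) (fderiv ℝ P y V)) 0 := by
    have hh := hasFDerivAt_fderiv_proj hU hPC2 (hMU (hP _ hy').1)
    have := hh.comp_hasDerivAt 0 (hasDerivAt_proj_line hU hPC2 hy')
    simpa [Function.comp_def] using this
  have h3 := h1.inner ℝ (h2.clm_apply (hasDerivAt_const (0 : ℝ) X))
  have h4 : (fun t : ℝ => inner ℝ ((y + t • V) - P (y + t • V))
      (fderiv ℝ P (P (y + t • V)) X)) =ᶠ[𝓝 0] fun _ => (0 : ℝ) := by
    filter_upwards [eventually_line_mem hU V hy] with t ht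
    exact inner_sub_proj_fderiv hU hMU hP hPC2 X ht
  have h5 := (h3.congr_of_eventuallyEq h4.symm).unique (hasDerivAt_const _ _)
  simpa using h5

/-- On `M` the factor `p - P p` vanishes, so only the second term of `inner_sub_fderiv_add`
survives. Together with idempotence this makes `DP(p)` an orthogonal projection. -/
lemma inner_sub_fderiv_of_mem (hU : IsOpen U) (hMU : M ⊆ U)
    (hP : IsClosestPointProjection M U P) (hPC2 : ContDiffOn ℝ 2 P U) {p : E n} (Z X : E n)
    (hp : p ∈ M) : inner ℝ (Z - fderiv ℝ P p Z) (fderiv ℝ P p X) = 0 := by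
  have := inner_sub_fderiv_add hU hMU hP hPC2 Z X (hMU hp)
  rw [hP.eq_self hMU hp] at this
  simpa using this

lemma fderiv_proj_idem (hU : IsOpen U) (hMU : M ⊆ U)
    (hP : IsClosestPointProjection M U P) (hPC2 : ContDiffOn ℝ 2 P U) {p : E n} (X : E n)
    (hp : p ∈ M) : fderiv ℝ P p (fderiv ℝ P p X) = fderiv ℝ P p X := by
  have := fderiv_proj_fderiv_proj hU hMU hP hPC2 X (hMU hp)
  rwa [hP.eq_self hMU hp] at this

lemma inner_fderiv_fderiv (hU : IsOpen U) (hMU : M ⊆ U)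
    (hP : IsClosestPointProjection M U P) (hPC2 : ContDiffOn ℝ 2 P U) {p : E n} (a b : E n)
    (hp : p ∈ M) : inner ℝ (fderiv ℝ P p a) (fderiv ℝ P p b) = inner ℝ (fderiv ℝ P p a) b := by
  have := inner_sub_fderiv_of_mem hU hMU hP hPC2 b a hp
  rw [inner_sub_left, sub_eq_zero] at this
  rw [real_inner_comm, ← this, real_inner_comm]

lemma inner_fderiv_symm (hU : IsOpen U) (hMU : M ⊆ U)
    (hP : IsClosestPointProjection M U P) (hPC2 : ContDiffOn ℝ 2 P U) {p : E n} (a b : E n)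
    (hp : p ∈ M) : inner ℝ (fderiv ℝ P p a) b = inner ℝ a (fderiv ℝ P p b) := by
  rw [← inner_fderiv_fderiv hU hMU hP hPC2 a b hp, real_inner_comm,
    inner_fderiv_fderiv hU hMU hP hPC2 b a hp, real_inner_comm]

/-- Differentiate `P ∘ γ = γ`. This links velocities of curves, by which normal vectors are defined,
to the range of `DP(p)`. -/
lemma fderiv_proj_deriv_curve (hU : IsOpen U) (hMU : M ⊆ U)
    (hP : IsClosestPointProjection M U P) (hPC2 : ContDiffOn ℝ 2 P U) {p : E n} {γ : ℝ → E n}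
    (hγ : IsC2CurveThrough M p γ) : fderiv ℝ P p (deriv γ 0) = deriv γ 0 := by
  obtain ⟨h1, h2, rfl⟩ := hγ
  have hd := (h1.differentiableAt (by norm_num)).hasDerivAt
  have h3 := (hasFDerivAt_proj hU hPC2 (hMU h2.self_of_nhds)).comp_hasDerivAt 0 hd
  have h4 : P ∘ γ =ᶠ[𝓝 0] γ := by
    filter_upwards [h2] with t ht using hP.eq_self hMU ht
  exact (h3.congr_of_eventuallyEq h4.symm).unique hd

lemma isNormalVector_of_fderiv_eq_zero (hU : IsOpen U) (hMU : M ⊆ U)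
    (hP : IsClosestPointProjection M U P) (hPC2 : ContDiffOn ℝ 2 P U) {p ν : E n}
    (hp : p ∈ M) (hν : fderiv ℝ P p ν = 0) : IsNormalVector M p ν := by
  intro γ hγ
  rw [← fderiv_proj_deriv_curve hU hMU hP hPC2 hγ, inner_fderiv_symm hU hMU hP hPC2 _ _ hp, hν,
    inner_zero_right]

/-- Second-order information at a point of `M`. -/
lemma inner_second_le_of_unit (hU : IsOpen U) (hMU : M ⊆ U)
    (hP : IsClosestPointProjection M U P) (hPC2 : ContDiffOn ℝ 2 P U) {k : ℝ} (hk0 : 0 ≤ k)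
    (hk : maxPrincipalCurvature M ≤ ENNReal.ofReal k) {p X ν : E n} (hp : p ∈ M)
    (hX : fderiv ℝ P p X = X) (hν : fderiv ℝ P p ν = 0) (hX1 : ‖X‖ = 1) (hν1 : ‖ν‖ = 1) :
    inner ℝ (fderiv ℝ (fderiv ℝ P) p X X) ν ≤ k := by
  have hpU := hMU hp
  -- Projecting the line through `p` in direction `X` gives a curve admissible in the curvature
  -- supremum, with velocity `X` and acceleration `D²P(p)(X, X)`.
  set γ : ℝ → E n := fun t => P (p + t • X) with hγ
  have hcurve : IsC2CurveThrough M p γ := by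
    have := isC2CurveThrough_proj_line hU hP hPC2 X hpU
    rwa [hP.eq_self hMU hp] at this
  have hd : deriv γ =ᶠ[𝓝 0] fun t => fderiv ℝ P (p + t • X) X := by
    filter_upwards [eventually_line_mem hU X hpU] with t ht
    exact (hasDerivAt_proj_line hU hPC2 ht).deriv
  have hd0 : deriv γ 0 = X := by
    rw [hd.self_of_nhds]; simpa using hX
  have hdd : deriv (deriv γ) 0 = fderiv ℝ (fderiv ℝ P) p X X := by
    rw [hd.deriv_eq]
    have h0 : p + (0 : ℝ) • X ∈ U := by simpa using hpU
    have := (hasFDerivAt_fderiv_proj hU hPC2 h0).comp_hasDerivAt (0 : ℝ) hasDerivAt_line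
    have := (this.clm_apply (hasDerivAt_const (0 : ℝ) X)).deriv
    simpa [Function.comp_def] using this
  have hk' := hk
  rw [maxPrincipalCurvature] at hk'
  have : ENNReal.ofReal (inner ℝ (deriv (deriv γ) 0) ν) ≤ ENNReal.ofReal k := by
    refine le_trans (le_sSup ?_) hk'
    exact ⟨p, hp, ν, γ, isNormalVector_of_fderiv_eq_zero hU hMU hP hPC2 hp hν,
      hν1, hcurve, by rw [hd0, hX1], rfl⟩
  rw [hdd] at this
  exact (ENNReal.ofReal_le_ofReal_iff hk0).1 this

lemma inner_second_self_le (hU : IsOpen U) (hMU : M ⊆ U)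
    (hP : IsClosestPointProjection M U P) (hPC2 : ContDiffOn ℝ 2 P U) {k : ℝ} (hk0 : 0 ≤ k)
    (hk : maxPrincipalCurvature M ≤ ENNReal.ofReal k) {p X ν : E n} (hp : p ∈ M)
    (hX : fderiv ℝ P p X = X) (hν : fderiv ℝ P p ν = 0) :
    inner ℝ (fderiv ℝ (fderiv ℝ P) p X X) ν ≤ k * ‖X‖ ^ 2 * ‖ν‖ := by
  rcases eq_or_ne X 0 with rfl | hX0
  · simp
  rcases eq_or_ne ν 0 with rfl | hν0
  · simp
  have hX0' : ‖X‖ ≠ 0 := norm_ne_zero_iff.2 hX0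
  have hν0' : ‖ν‖ ≠ 0 := norm_ne_zero_iff.2 hν0
  have h := inner_second_le_of_unit hU hMU hP hPC2 hk0 hk (X := ‖X‖⁻¹ • X) (ν := ‖ν‖⁻¹ • ν) hp
    (by rw [map_smul, hX]) (by rw [map_smul, hν, smul_zero])
    (by rw [norm_smul, norm_inv, norm_norm, inv_mul_cancel₀ hX0'])
    (by rw [norm_smul, norm_inv, norm_norm, inv_mul_cancel₀ hν0'])
  simp only [map_smul, _root_.smul_apply, inner_smul_left, inner_smul_right,
    map_inv₀, RCLike.conj_to_real] at h
  have h2 : ‖X‖ ^ 2 * ‖ν‖ * (‖ν‖⁻¹ * (‖X‖⁻¹ * (‖X‖⁻¹ *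
      inner ℝ (fderiv ℝ (fderiv ℝ P) p X X) ν))) =
      inner ℝ (fderiv ℝ (fderiv ℝ P) p X X) ν := by
    field_simp
  rw [← h2]
  calc _ ≤ ‖X‖ ^ 2 * ‖ν‖ * k := by gcongr
    _ = _ := by ring

lemma second_symm (hU : IsOpen U) (hPC2 : ContDiffOn ℝ 2 P U) {p : E n} (hp : p ∈ U) (X Y : E n) :
    fderiv ℝ (fderiv ℝ P) p X Y = fderiv ℝ (fderiv ℝ P) p Y X :=
  (contDiffAt_proj hU hPC2 hp).isSymmSndFDerivAt (by simp) X Y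

/-- The second fundamental form, polarized. -/
lemma inner_second_le (hU : IsOpen U) (hMU : M ⊆ U)
    (hP : IsClosestPointProjection M U P) (hPC2 : ContDiffOn ℝ 2 P U) {k : ℝ} (hk0 : 0 ≤ k)
    (hk : maxPrincipalCurvature M ≤ ENNReal.ofReal k) {p X Y ν : E n} (hp : p ∈ M)
    (hX : fderiv ℝ P p X = X) (hY : fderiv ℝ P p Y = Y) (hν : fderiv ℝ P p ν = 0) :
    inner ℝ (fderiv ℝ (fderiv ℝ P) p X Y) ν ≤ k * ‖X‖ * ‖Y‖ * ‖ν‖ := by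
  -- Polarization: the one-sided quadratic bound is used for `X + Y` with `ν` and for `X - Y` with
  -- `-ν`, and the parallelogram law adds up the norms.
  have key : ∀ X Y : E n, fderiv ℝ P p X = X → fderiv ℝ P p Y = Y →
      4 * inner ℝ (fderiv ℝ (fderiv ℝ P) p X Y) ν ≤ 2 * k * (‖X‖ ^ 2 + ‖Y‖ ^ 2) * ‖ν‖ := by
    intro X Y hX hY
    have h1 := inner_second_self_le hU hMU hP hPC2 hk0 hk hp (X := X + Y) (ν := ν)
      (by rw [map_add, hX, hY]) hν
    have h2 := inner_second_self_le hU hMU hP hPC2 hk0 hk hp (X := X - Y) (ν := -ν)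
      (by rw [map_sub, hX, hY]) (by rw [map_neg, hν, neg_zero])
    have h3 := parallelogram_law_with_norm ℝ X Y
    have h4 := second_symm hU hPC2 (hMU hp) X Y
    simp only [map_add, map_sub, _root_.add_apply, _root_.sub_apply,
      inner_add_left, inner_sub_left, inner_neg_right, norm_neg, ← h4] at h1 h2
    have h5 : k * ‖X + Y‖ ^ 2 * ‖ν‖ + k * ‖X - Y‖ ^ 2 * ‖ν‖
        = 2 * k * (‖X‖ ^ 2 + ‖Y‖ ^ 2) * ‖ν‖ := by
      have : ‖X + Y‖ ^ 2 + ‖X - Y‖ ^ 2 = 2 * (‖X‖ ^ 2 + ‖Y‖ ^ 2) := by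
        simpa only [sq] using h3
      linear_combination k * ‖ν‖ * this
    linarith
  rcases eq_or_ne X 0 with rfl | hX0
  · simp
  rcases eq_or_ne Y 0 with rfl | hY0
  · simp
  have hX0' : ‖X‖ ≠ 0 := norm_ne_zero_iff.2 hX0
  have hY0' : ‖Y‖ ≠ 0 := norm_ne_zero_iff.2 hY0
  -- For unit vectors the sum of squares in `key` is `2`; rescaling then produces the product `‖X‖ *
  -- ‖Y‖` without loss.
  have h := key (‖X‖⁻¹ • X) (‖Y‖⁻¹ • Y) (by rw [map_smul, hX]) (by rw [map_smul, hY])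
  rw [norm_smul, norm_smul, norm_inv, norm_inv, norm_norm, norm_norm, inv_mul_cancel₀ hX0',
    inv_mul_cancel₀ hY0'] at h
  simp only [map_smul, _root_.smul_apply, inner_smul_left,
    map_inv₀, RCLike.conj_to_real] at h
  have h2 : ‖X‖ * ‖Y‖ * (‖Y‖⁻¹ * (‖X‖⁻¹ *
      inner ℝ (fderiv ℝ (fderiv ℝ P) p X Y) ν)) =
      inner ℝ (fderiv ℝ (fderiv ℝ P) p X Y) ν := by
    field_simp
  rw [← h2]
  calc _ ≤ ‖X‖ * ‖Y‖ * (k * ‖ν‖) :=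
        mul_le_mul_of_nonneg_left (by linarith) (by positivity)
    _ = _ := by ring

/-- Evaluating `DP` at `P (p + t • Y)` keeps the base point on `M`. Identities for `DP` that hold
only on `M` can therefore be differentiated in tangent directions. -/
lemma hasDerivAt_fderiv_along (hU : IsOpen U) (hMU : M ⊆ U)
    (hP : IsClosestPointProjection M U P) (hPC2 : ContDiffOn ℝ 2 P U) {p Y : E n} (hp : p ∈ M)
    (hY : fderiv ℝ P p Y = Y) (a : E n) :
    HasDerivAt (fun t : ℝ => fderiv ℝ P (P (p + t • Y)) a) (fderiv ℝ (fderiv ℝ P) p Y a) 0 := by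
  have h0 : p + (0 : ℝ) • Y ∈ U := by simpa using hMU hp
  have hh := hasFDerivAt_fderiv_proj hU hPC2 (hMU (hP _ h0).1)
  have := hh.comp_hasDerivAt 0 (hasDerivAt_proj_line hU hPC2 h0)
  have := this.clm_apply (hasDerivAt_const (0 : ℝ) a)
  simpa [Function.comp_def, hP.eq_self hMU hp, hY] using this

/-- Differentiate the self-adjointness of `DP` along `M`. -/
lemma inner_second_comm (hU : IsOpen U) (hMU : M ⊆ U)
    (hP : IsClosestPointProjection M U P) (hPC2 : ContDiffOn ℝ 2 P U) {p Y : E n} (hp : p ∈ M)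
    (hY : fderiv ℝ P p Y = Y) (a b : E n) :
    inner ℝ (fderiv ℝ (fderiv ℝ P) p Y a) b = inner ℝ a (fderiv ℝ (fderiv ℝ P) p Y b) := by
  have ha := hasDerivAt_fderiv_along hU hMU hP hPC2 hp hY a
  have hb := hasDerivAt_fderiv_along hU hMU hP hPC2 hp hY b
  have h1 := ha.inner ℝ (hasDerivAt_const (0 : ℝ) b)
  have h2 := (hasDerivAt_const (0 : ℝ) a).inner ℝ hb
  have h4 : (fun t : ℝ => inner ℝ (fderiv ℝ P (P (p + t • Y)) a) b) =ᶠ[𝓝 0]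
      fun t : ℝ => inner ℝ a (fderiv ℝ P (P (p + t • Y)) b) := by
    filter_upwards [eventually_line_mem hU Y (hMU hp)] with t ht
    exact inner_fderiv_symm hU hMU hP hPC2 a b (hP _ ht).1
  have h5 := (h1.congr_of_eventuallyEq h4.symm).unique h2
  simpa using h5

/-- Differentiate `⟨DP a, DP b⟩ = ⟨DP a, b⟩` along `M`. -/
lemma inner_second_split (hU : IsOpen U) (hMU : M ⊆ U)
    (hP : IsClosestPointProjection M U P) (hPC2 : ContDiffOn ℝ 2 P U) {p Y : E n} (hp : p ∈ M)
    (hY : fderiv ℝ P p Y = Y) (a b : E n) :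
    inner ℝ (fderiv ℝ (fderiv ℝ P) p Y a) b =
      inner ℝ (fderiv ℝ P p a) (fderiv ℝ (fderiv ℝ P) p Y b) +
      inner ℝ (fderiv ℝ (fderiv ℝ P) p Y a) (fderiv ℝ P p b) := by
  have ha := hasDerivAt_fderiv_along hU hMU hP hPC2 hp hY a
  have hb := hasDerivAt_fderiv_along hU hMU hP hPC2 hp hY b
  have h1 := ha.inner ℝ (hasDerivAt_const (0 : ℝ) b)
  have h2 := ha.inner ℝ hb
  have h4 : (fun t : ℝ => inner ℝ (fderiv ℝ P (P (p + t • Y)) a) b) =ᶠ[𝓝 0]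
      fun t : ℝ => inner ℝ (fderiv ℝ P (P (p + t • Y)) a) (fderiv ℝ P (P (p + t • Y)) b) := by
    filter_upwards [eventually_line_mem hU Y (hMU hp)] with t ht
    exact (inner_fderiv_fderiv hU hMU hP hPC2 a b (hP _ ht).1).symm
  have h5 := (h1.congr_of_eventuallyEq h4.symm).unique h2
  simpa [hP.eq_self hMU hp] using h5

lemma norm_sq_eq_add (hU : IsOpen U) (hMU : M ⊆ U)
    (hP : IsClosestPointProjection M U P) (hPC2 : ContDiffOn ℝ 2 P U) {p : E n} (hp : p ∈ M)
    (a : E n) : ‖a‖ ^ 2 = ‖fderiv ℝ P p a‖ ^ 2 + ‖a - fderiv ℝ P p a‖ ^ 2 := by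
  have h := inner_sub_fderiv_of_mem hU hMU hP hPC2 a a hp
  have h2 := norm_add_sq_real (a - fderiv ℝ P p a) (fderiv ℝ P p a)
  rw [h, sub_add_cancel] at h2
  linarith

lemma fderiv_sub_fderiv (hU : IsOpen U) (hMU : M ⊆ U)
    (hP : IsClosestPointProjection M U P) (hPC2 : ContDiffOn ℝ 2 P U) {p : E n} (hp : p ∈ M)
    (a : E n) : fderiv ℝ P p (a - fderiv ℝ P p a) = 0 := by
  rw [map_sub, fderiv_proj_idem hU hMU hP hPC2 a hp, sub_self]

/-- For tangent `a` and `b` both terms of `inner_second_split` equal the left-hand side, so `x = x +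
x`. Thus `D²P(p)(Y, ·)` sends tangent vectors to normal ones. -/
lemma inner_second_tangent (hU : IsOpen U) (hMU : M ⊆ U)
    (hP : IsClosestPointProjection M U P) (hPC2 : ContDiffOn ℝ 2 P U) {p Y : E n} (hp : p ∈ M)
    (hY : fderiv ℝ P p Y = Y) {a b : E n} (ha : fderiv ℝ P p a = a) (hb : fderiv ℝ P p b = b) :
    inner ℝ (fderiv ℝ (fderiv ℝ P) p Y a) b = 0 := by
  have := inner_second_split hU hMU hP hPC2 hp hY a b
  rw [ha, hb, ← inner_second_comm hU hMU hP hPC2 hp hY a b] at this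
  linarith

lemma inner_second_normal (hU : IsOpen U) (hMU : M ⊆ U)
    (hP : IsClosestPointProjection M U P) (hPC2 : ContDiffOn ℝ 2 P U) {p Y : E n} (hp : p ∈ M)
    (hY : fderiv ℝ P p Y = Y) {a b : E n} (ha : fderiv ℝ P p a = 0) (hb : fderiv ℝ P p b = 0) :
    inner ℝ (fderiv ℝ (fderiv ℝ P) p Y a) b = 0 := by
  have := inner_second_split hU hMU hP hPC2 hp hY a b
  rwa [ha, hb, inner_zero_left, inner_zero_right, add_zero] at this

/-- In the splitting into tangent and normal vectors, the symmetric operator `D²P(p)(Y, ·)` has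
vanishing diagonal blocks, and its off-diagonal block is the second fundamental form. The operator
norm is that of one block, so the constant stays `k`. -/
lemma norm_second_le (hU : IsOpen U) (hMU : M ⊆ U)
    (hP : IsClosestPointProjection M U P) (hPC2 : ContDiffOn ℝ 2 P U) {k : ℝ} (hk0 : 0 ≤ k)
    (hk : maxPrincipalCurvature M ≤ ENNReal.ofReal k) {p Y : E n} (hp : p ∈ M)
    (hY : fderiv ℝ P p Y = Y) (a : E n) :
    ‖fderiv ℝ (fderiv ℝ P) p Y a‖ ≤ k * ‖Y‖ * ‖a‖ := by
  have main : ∀ b : E n, inner ℝ (fderiv ℝ (fderiv ℝ P) p Y a) b ≤ k * ‖Y‖ * ‖a‖ * ‖b‖ := by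
    intro b
    set B := fderiv ℝ (fderiv ℝ P) p Y
    set aT := fderiv ℝ P p a with haT
    set bT := fderiv ℝ P p b with hbT
    have iT : ∀ x, fderiv ℝ P p (fderiv ℝ P p x) = fderiv ℝ P p x :=
      fun x => fderiv_proj_idem hU hMU hP hPC2 x hp
    have iN : ∀ x, fderiv ℝ P p (x - fderiv ℝ P p x) = 0 :=
      fun x => fderiv_sub_fderiv hU hMU hP hPC2 hp x
    have h1 : inner ℝ (B a) b = inner ℝ (B aT) (b - bT) + inner ℝ (B bT) (a - aT) := by
      have e1 := inner_second_tangent hU hMU hP hPC2 hp hY (iT a) (iT b)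
      have e2 := inner_second_normal hU hMU hP hPC2 hp hY (iN a) (iN b)
      have e3 := inner_second_comm hU hMU hP hPC2 hp hY (fderiv ℝ P p b) (a - fderiv ℝ P p a)
      rw [real_inner_comm] at e3
      rw [show inner ℝ (B bT) (a - aT) = inner ℝ (B (a - aT)) bT by
        rw [real_inner_comm]; exact e3.trans (real_inner_comm _ _)]
      change inner ℝ (B aT) bT = 0 at e1
      change inner ℝ (B (a - aT)) (b - bT) = 0 at e2
      simp only [map_sub, inner_sub_left, inner_sub_right] at e1 e2 ⊢
      linarith
    have h2 := inner_second_le hU hMU hP hPC2 hk0 hk hp hY (iT a) (iN b)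
    have h3 := inner_second_le hU hMU hP hPC2 hk0 hk hp hY (iT b) (iN a)
    have na := norm_sq_eq_add hU hMU hP hPC2 hp a
    have nb := norm_sq_eq_add hU hMU hP hPC2 hp b
    rw [h1]
    -- Cauchy–Schwarz in the plane, with the two components of `b` interchanged.
    have cs : ‖aT‖ * ‖b - bT‖ + ‖bT‖ * ‖a - aT‖ ≤ ‖a‖ * ‖b‖ := by
      apply abs_le_of_sq_le_sq' _ (by positivity) |>.2
      rw [mul_pow, na, nb]
      nlinarith [sq_nonneg (‖aT‖ * ‖bT‖ - ‖a - aT‖ * ‖b - bT‖)]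
    calc _ ≤ k * ‖Y‖ * ‖aT‖ * ‖b - bT‖ + k * ‖Y‖ * ‖bT‖ * ‖a - aT‖ := add_le_add h2 h3
      _ = k * ‖Y‖ * (‖aT‖ * ‖b - bT‖ + ‖bT‖ * ‖a - aT‖) := by ring
      _ ≤ k * ‖Y‖ * (‖a‖ * ‖b‖) := by gcongr
      _ = _ := by ring
  have h := main (fderiv ℝ (fderiv ℝ P) p Y a)
  rw [real_inner_self_eq_norm_sq, sq] at h
  by_cases h0 : ‖fderiv ℝ (fderiv ℝ P) p Y a‖ = 0
  · rw [h0]; positivity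
  · exact le_of_mul_le_mul_right h (lt_of_le_of_ne (norm_nonneg _) (Ne.symm h0))

/-- The projection is almost nonexpansive near `M`. -/
lemma norm_fderiv_proj_le (hU : IsOpen U) (hMU : M ⊆ U)
    (hP : IsClosestPointProjection M U P) (hPC2 : ContDiffOn ℝ 2 P U) {k : ℝ} (hk0 : 0 ≤ k)
    (hk : maxPrincipalCurvature M ≤ ENNReal.ofReal k) {y : E n} (hy : y ∈ U) (V : E n) :
    (1 - k * ‖y - P y‖) * ‖fderiv ℝ P y V‖ ≤ ‖V‖ := by
  have hr := (hP y hy).1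
  set Y := fderiv ℝ P y V with hY
  have hYt : fderiv ℝ P (P y) Y = Y := fderiv_proj_fderiv_proj hU hMU hP hPC2 V hy
  -- Testing with `Y = DP(y) V` itself gives `|Y|² = ⟨V, Y⟩ + ⟨y - P y, D²P(P y)(Y, Y)⟩`. The last
  -- term is at most `k |y - P y| |Y|²`, because `y - P y` is normal at `P y`.
  have h1 := inner_sub_fderiv_add hU hMU hP hPC2 V Y hy
  rw [← hY, hYt, inner_sub_left V Y Y, real_inner_self_eq_norm_sq] at h1
  have hN : fderiv ℝ P (P y) (y - P y) = 0 := by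
    have := inner_sub_proj_fderiv hU hMU hP hPC2 (y - P y) hy
    rw [← inner_fderiv_symm hU hMU hP hPC2 _ _ hr,
      ← inner_fderiv_fderiv hU hMU hP hPC2 _ _ hr] at this
    exact inner_self_eq_zero.1 this
  have h2 := inner_second_self_le hU hMU hP hPC2 hk0 hk hr hYt hN
  rw [real_inner_comm] at h2
  have h3 := real_inner_le_norm V Y
  by_cases h0 : ‖Y‖ = 0
  · rw [h0]; simp
  · refine le_of_mul_le_mul_right ?_ (lt_of_le_of_ne (norm_nonneg Y) (Ne.symm h0))
    nlinarith

/-- The normal component of a short secant of `M` is at most half the curvature bound times the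
squared length, up to a factor that tends to `1` with the length of the secant. -/
lemma norm_normal_part_le (hU : IsOpen U) (hMU : M ⊆ U)
    (hP : IsClosestPointProjection M U P) (hPC2 : ContDiffOn ℝ 2 P U) {k : ℝ} (hk0 : 0 ≤ k)
    (hk : maxPrincipalCurvature M ≤ ENNReal.ofReal k) {p w : E n} {δ ε : ℝ} (hp : p ∈ M)
    (hpw : p + w ∈ M) (hball : Metric.ball p δ ⊆ U) (hw : ‖w‖ ≤ ε) (hε : ε < δ)
    (hkε : k * ε < 1) :
    ‖w - fderiv ℝ P p w‖ ≤ k / 2 * (‖w‖ / (1 - k * ε)) ^ 2 := by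
  set L := ‖w‖ / (1 - k * ε) with hL
  have hpos : 0 < 1 - k * ε := by linarith
  have hL0 : 0 ≤ L := by positivity
  have hmem : ∀ t ∈ Icc (0 : ℝ) 1, p + t • w ∈ U := by
    intro t ht
    apply hball
    rw [mem_ball_iff_norm, add_sub_cancel_left, norm_smul, Real.norm_of_nonneg ht.1]
    nlinarith [norm_nonneg w, ht.1, ht.2]
  -- Speed of the projected segment: `p` competes in the minimization, so the point `p + t • w` is
  -- at distance at most `‖w‖ ≤ ε` from `M`.
  have hγ' : ∀ t ∈ Icc (0 : ℝ) 1, ‖fderiv ℝ P (p + t • w) w‖ ≤ L := by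
    intro t ht
    have h1 := norm_fderiv_proj_le hU hMU hP hPC2 hk0 hk (hmem t ht) w
    have h2 : ‖p + t • w - P (p + t • w)‖ ≤ ε := by
      have h3 : ‖P (p + t • w) - (p + t • w)‖ ≤ ‖p - (p + t • w)‖ := by
        by_cases h : p = P (p + t • w)
        · rw [← h]
        · exact ((hP _ (hmem t ht)).2 p hp h).le
      rw [norm_sub_rev]
      refine h3.trans ?_
      rw [sub_add_cancel_left, norm_neg, norm_smul, Real.norm_of_nonneg ht.1]
      nlinarith [norm_nonneg w, ht.1, ht.2]
    rw [hL, le_div_iff₀ hpos, mul_comm]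
    refine le_trans ?_ h1
    gcongr
  set ν := w - fderiv ℝ P p w with hν
  set γ : ℝ → E n := fun t => P (p + t • w) with hγ
  have hdγ : ∀ t ∈ Icc (0 : ℝ) 1, HasDerivAt γ (fderiv ℝ P (p + t • w) w) t :=
    fun t ht => hasDerivAt_proj_line hU hPC2 (hmem t ht)
  have hγM : ∀ t ∈ Icc (0 : ℝ) 1, γ t ∈ M := fun t ht => (hP _ (hmem t ht)).1
  have hγ0 : γ 0 = p := by simp [hγ, hP.eq_self hMU hp]
  have hγ1 : γ 1 = p + w := by simp [hγ, hP.eq_self hMU hpw]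
  have htan : ∀ t ∈ Icc (0 : ℝ) 1, fderiv ℝ P (γ t) (fderiv ℝ P (p + t • w) w) =
      fderiv ℝ P (p + t • w) w :=
    fun t ht => fderiv_proj_fderiv_proj hU hMU hP hPC2 w (hmem t ht)
  have hdg : ∀ t ∈ Icc (0 : ℝ) 1, HasDerivAt (fun t => fderiv ℝ P (γ t) ν)
      (fderiv ℝ (fderiv ℝ P) (γ t) (fderiv ℝ P (p + t • w) w) ν) t := by
    intro t ht
    have hh := hasFDerivAt_fderiv_proj hU hPC2 (hMU (hγM t ht))
    have := (hh.comp_hasDerivAt t (hdγ t ht)).clm_apply (hasDerivAt_const t ν)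
    simpa [Function.comp_def] using this
  -- The fixed vector `ν` is normal at `γ 0 = p`. Along `γ` its tangential part grows at most
  -- linearly, at the rate given by `norm_second_le`.
  have hg : ∀ t ∈ Icc (0 : ℝ) 1, ‖fderiv ℝ P (γ t) ν‖ ≤ k * L * ‖ν‖ * t := by
    intro t ht
    have := norm_image_sub_le_of_norm_deriv_le_segment' (C := k * L * ‖ν‖)
      (fun t ht => (hdg t ht).hasDerivWithinAt) (fun t ht => by
        have ht' := Ico_subset_Icc_self ht
        refine (norm_second_le hU hMU hP hPC2 hk0 hk (hγM t ht') (htan t ht') ν).trans ?_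
        have := hγ' t ht'
        gcongr) t ht
    rwa [hγ0, hν, fderiv_sub_fderiv hU hMU hP hPC2 hp, sub_zero, sub_zero] at this
  have hf : ∀ t ∈ Icc (0 : ℝ) 1, HasDerivAt (fun t => inner ℝ (γ t - p) ν)
      (inner ℝ (fderiv ℝ P (p + t • w) w) ν) t := by
    intro t ht
    have := ((hdγ t ht).sub_const p).inner ℝ (hasDerivAt_const t ν)
    simpa using this
  have hB : ∀ t : ℝ, HasDerivAt (fun t : ℝ => k * L * L * ‖ν‖ * (t ^ 2 / 2))
      (k * L * L * ‖ν‖ * t) t := by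
    intro t
    have := ((hasDerivAt_pow 2 t).div_const 2).const_mul (k * L * L * ‖ν‖)
    exact this.congr_deriv (by push_cast; ring)
  -- The derivative of `⟨γ t - p, ν⟩` pairs the tangent vector `γ' t` only with the tangential part
  -- of `ν`, hence is at most `L * (k * L * ‖ν‖ * t)`. Integrating `t` gives the factor `1/2`; at `t
  -- = 1` the left side is `⟨w, ν⟩ = ‖ν‖²`.
  have key := image_le_of_deriv_right_le_deriv_boundary
    (fun t ht => (hf t ht).continuousAt.continuousWithinAt)
    (fun t ht => (hf t (Ico_subset_Icc_self ht)).hasDerivWithinAt)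
    (B := fun t : ℝ => k * L * L * ‖ν‖ * (t ^ 2 / 2)) (B' := fun t => k * L * L * ‖ν‖ * t)
    (by simp [hγ0]) (fun t _ => (hB t).continuousAt.continuousWithinAt)
    (fun t _ => (hB t).hasDerivWithinAt)
    (fun t ht => by
      have ht' := Ico_subset_Icc_self ht
      rw [← htan t ht', inner_fderiv_symm hU hMU hP hPC2 _ _ (hγM t ht')]
      refine (real_inner_le_norm _ _).trans ?_
      calc _ ≤ L * (k * L * ‖ν‖ * t) := by
            gcongr
            · exact hγ' t ht'
            · exact hg t ht'
        _ = _ := by ring) (right_mem_Icc.2 zero_le_one)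
  simp only [hγ1, add_sub_cancel_left] at key
  have hwν : inner ℝ w ν = ‖ν‖ ^ 2 := by
    have h1 := inner_sub_fderiv_of_mem hU hMU hP hPC2 w w hp
    rw [← hν, real_inner_comm] at h1
    have h2 : inner ℝ (w - fderiv ℝ P p w) ν = inner ℝ w ν := by
      rw [inner_sub_left, h1, sub_zero]
    rw [← h2, ← hν, real_inner_self_eq_norm_sq]
  rw [hwν] at key
  by_cases h0 : ‖ν‖ = 0
  · rw [h0]; positivity
  · refine le_of_mul_le_mul_right ?_ (lt_of_le_of_ne (norm_nonneg ν) (Ne.symm h0))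
    nlinarith

end Geometry

/-! ### Calculus of weak derivatives -/

section WeakDerivative

variable {s n : ℕ} {Ω : Set (E s)}

lemma IsTestFunction.eq_zero {F : Type*} [NormedAddCommGroup F] [NormedSpace ℝ F] {φ : E s → F}
    (hφ : IsTestFunction Ω φ) {x : E s} (hx : x ∉ Ω) : φ x = 0 :=
  image_eq_zero_of_notMem_tsupport fun h => hx (hφ.2.2 h)

lemma IsTestFunction.fderiv_eq_zero {F : Type*} [NormedAddCommGroup F] [NormedSpace ℝ F]
    {φ : E s → F} (hφ : IsTestFunction Ω φ) {x : E s} (hx : x ∉ Ω) : fderiv ℝ φ x = 0 :=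
  image_eq_zero_of_notMem_tsupport fun h => hx (hφ.2.2 (tsupport_fderiv_subset ℝ h))

lemma IsTestFunction.fderiv_apply {F : Type*} [NormedAddCommGroup F] [NormedSpace ℝ F]
    {φ : E s → F} (hφ : IsTestFunction Ω φ) (e : E s) :
    IsTestFunction Ω (fun x => fderiv ℝ φ x e) :=
  ⟨(hφ.1.fderiv_right (m := ∞) (by simp)).clm_apply contDiff_const, hφ.2.1.fderiv_apply ℝ e,
    (tsupport_fderiv_apply_subset ℝ e).trans hφ.2.2⟩

lemma LocallyIntegrableOn.integrable_testFunction_smul {V : Type*} [NormedAddCommGroup V]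
    [NormedSpace ℝ V] {g : E s → V} (hg : LocallyIntegrableOn g Ω) {φ : E s → ℝ}
    (hφ : IsTestFunction Ω φ) : Integrable (fun x => φ x • g x) := by
  have h1 : IntegrableOn g (tsupport φ) := hg.integrableOn_compact_subset hφ.2.2 hφ.2.1
  have h2 : IntegrableOn (fun x => φ x • g x) (tsupport φ) :=
    h1.continuousOn_smul hφ.1.continuous.continuousOn hφ.2.1
  rw [← integrableOn_univ]
  exact h2.of_forall_sdiff_eq_zero MeasurableSet.univ fun x hx => by
    rw [image_eq_zero_of_notMem_tsupport hx.2, zero_smul]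

lemma setIntegral_testFunction_smul {V : Type*} [NormedAddCommGroup V]
    [NormedSpace ℝ V] (g : E s → V) {φ : E s → ℝ} (hφ : IsTestFunction Ω φ) :
    ∫ x in Ω, φ x • g x = ∫ x, φ x • g x :=
  setIntegral_eq_integral_of_forall_compl_eq_zero fun x hx => by rw [hφ.eq_zero hx, zero_smul]

lemma HasWeakDeriv.integral_eq {u : E s → E n} {G : E s → E s →L[ℝ] E n}
    (h : HasWeakDeriv Ω u G) {φ : E s → ℝ} (hφ : IsTestFunction Ω φ) (e : E s) :
    ∫ x, (fderiv ℝ φ x e) • u x = -∫ x, φ x • G x e := by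
  have := h.2.2 φ hφ e
  rwa [setIntegral_testFunction_smul u (hφ.fderiv_apply e),
    setIntegral_testFunction_smul (fun x => G x e) hφ] at this

lemma locallyIntegrableOn_apply {G : E s → E s →L[ℝ] E n} (h : LocallyIntegrableOn G Ω) (e : E s) :
    LocallyIntegrableOn (fun x => G x e) Ω := fun x hx =>
  let ⟨t, ht, h⟩ := h x hx
  ⟨t, ht, (ContinuousLinearMap.apply ℝ (E n) e).integrable_comp h⟩

lemma hasWeakDeriv_of_integral {u : E s → E n} {G : E s → E s →L[ℝ] E n}
    (hu : LocallyIntegrableOn u Ω) (hG : LocallyIntegrableOn G Ω)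
    (h : ∀ φ : E s → ℝ, IsTestFunction Ω φ → ∀ e : E s,
      ∫ x, (fderiv ℝ φ x e) • u x = -∫ x, φ x • G x e) : HasWeakDeriv Ω u G :=
  ⟨hu, hG, fun φ hφ e => by
    rw [setIntegral_testFunction_smul u (hφ.fderiv_apply e),
      setIntegral_testFunction_smul (fun x => G x e) hφ, h φ hφ e]⟩

/-- The fundamental lemma of the calculus of variations, applied to `G - G'` with values in the
space of linear maps. -/
lemma HasWeakDeriv.ae_unique (hΩ : IsOpen Ω) {u : E s → E n} {G G' : E s → E s →L[ℝ] E n}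
    (h : HasWeakDeriv Ω u G) (h' : HasWeakDeriv Ω u G') : G =ᵐ[volume.restrict Ω] G' := by
  have key := hΩ.ae_eq_zero_of_integral_contDiff_smul_eq_zero (μ := volume) (f := G - G')
    (h.2.1.sub h'.2.1) (fun φ h1 h2 h3 => by
      have hφ : IsTestFunction Ω φ := ⟨h1, h2, h3⟩
      have i1 := LocallyIntegrableOn.integrable_testFunction_smul h.2.1 hφ
      have i2 := LocallyIntegrableOn.integrable_testFunction_smul h'.2.1 hφ
      ext1 e
      simp only [Pi.sub_apply, smul_sub]
      rw [integral_sub i1 i2, _root_.sub_apply, ContinuousLinearMap.integral_apply i1,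
        ContinuousLinearMap.integral_apply i2]
      have e1 := h.integral_eq hφ e
      have e2 := h'.integral_eq hφ e
      rw [e1] at e2
      simp only [_root_.smul_apply, _root_.zero_apply]
      rw [neg_inj] at e2
      rw [e2, sub_self])
  rw [EventuallyEq, ae_restrict_iff' hΩ.measurableSet]
  filter_upwards [key] with x hx hxΩ
  exact sub_eq_zero.1 (hx hxΩ)

/-- The arbitrary choice inside `weakDeriv` is harmless: any explicitly computed weak derivative may
replace it almost everywhere. -/
lemma HasWeakDeriv.weakDeriv_ae_eq (hΩ : IsOpen Ω) {u : E s → E n} {G : E s → E s →L[ℝ] E n}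
    (h : HasWeakDeriv Ω u G) : weakDeriv Ω u =ᵐ[volume.restrict Ω] G := by
  have hex : ∃ G, HasWeakDeriv Ω u G := ⟨G, h⟩
  have : HasWeakDeriv Ω u (weakDeriv Ω u) := by
    rw [weakDeriv, dif_pos hex]; exact hex.choose_spec
  exact this.ae_unique hΩ h

lemma MemW1.hasWeakDeriv {p : ℝ≥0∞} {u : E s → E n} (h : MemW1 p Ω u) :
    HasWeakDeriv Ω u (weakDeriv Ω u) := by
  rw [weakDeriv, dif_pos h.1]; exact h.1.choose_spec

lemma HasWeakDeriv.memW1 (hΩ : IsOpen Ω) {p : ℝ≥0∞} {u : E s → E n} {G : E s → E s →L[ℝ] E n}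
    (h : HasWeakDeriv Ω u G) (hu : MemLp u p (volume.restrict Ω))
    (hG : MemLp G p (volume.restrict Ω)) : MemW1 p Ω u :=
  ⟨⟨G, h⟩, hu, hG.ae_eq (h.weakDeriv_ae_eq hΩ).symm⟩

lemma locallyIntegrableOn_fun_add {V : Type*} [NormedAddCommGroup V] {f g : E s → V}
    (hf : LocallyIntegrableOn f Ω) (hg : LocallyIntegrableOn g Ω) :
    LocallyIntegrableOn (fun x => f x + g x) Ω :=
  hf.add hg

lemma locallyIntegrableOn_fun_zero {V : Type*} [NormedAddCommGroup V] :
    LocallyIntegrableOn (0 : E s → V) Ω :=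
  (locallyIntegrable_zero (ε'' := V)).locallyIntegrableOn _

lemma integrable_of_integrableOn_of_eq_zero {V : Type*} [NormedAddCommGroup V] {f : E s → V}
    {K : Set (E s)} (hf : IntegrableOn f K) (h : ∀ x ∉ K, f x = 0) : Integrable f :=
  (integrableOn_iff_integrable_of_support_subset fun x hx => by
    by_contra hx'
    exact hx (h x hx')).1 hf

lemma HasWeakDeriv.add {u v : E s → E n} {G H : E s → E s →L[ℝ] E n}
    (hu : HasWeakDeriv Ω u G) (hv : HasWeakDeriv Ω v H) : HasWeakDeriv Ω (u + v) (G + H) := by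
  refine hasWeakDeriv_of_integral (locallyIntegrableOn_fun_add hu.1 hv.1)
    (locallyIntegrableOn_fun_add hu.2.1 hv.2.1) fun φ hφ e => ?_
  simp only [Pi.add_apply, smul_add, _root_.add_apply]
  rw [integral_add (LocallyIntegrableOn.integrable_testFunction_smul hu.1 (hφ.fderiv_apply e))
    (LocallyIntegrableOn.integrable_testFunction_smul hv.1 (hφ.fderiv_apply e)),
    integral_add (LocallyIntegrableOn.integrable_testFunction_smul
      (locallyIntegrableOn_apply hu.2.1 e) hφ)
    (LocallyIntegrableOn.integrable_testFunction_smul (locallyIntegrableOn_apply hv.2.1 e) hφ),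
    hu.integral_eq hφ, hv.integral_eq hφ, neg_add]

lemma HasWeakDeriv.const_smul {u : E s → E n} {G : E s → E s →L[ℝ] E n}
    (hu : HasWeakDeriv Ω u G) (c : ℝ) : HasWeakDeriv Ω (c • u) (c • G) := by
  refine hasWeakDeriv_of_integral (hu.1.smul c) (hu.2.1.smul c) fun φ hφ e => ?_
  simp only [Pi.smul_apply, _root_.smul_apply, smul_comm _ c]
  rw [integral_smul, integral_smul, hu.integral_eq hφ, smul_neg]

lemma HasWeakDeriv.sub {u v : E s → E n} {G H : E s → E s →L[ℝ] E n}
    (hu : HasWeakDeriv Ω u G) (hv : HasWeakDeriv Ω v H) : HasWeakDeriv Ω (u - v) (G - H) := by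
  have := hu.add (hv.const_smul (-1))
  have h1 : u + (-1 : ℝ) • v = u - v := by
    funext x; simp [sub_eq_add_neg]
  have h2 : G + (-1 : ℝ) • H = G - H := by
    funext x; ext1 e; simp [sub_eq_add_neg]
  rwa [h1, h2] at this

lemma hasWeakDeriv_zero : HasWeakDeriv Ω (0 : E s → E n) 0 :=
  ⟨locallyIntegrableOn_fun_zero, locallyIntegrableOn_fun_zero, by simp⟩

/-- Multiplication by a test function extends a weak derivative to the whole space. -/
lemma HasWeakDeriv.testFunction_smul {u : E s → E n} {G : E s → E s →L[ℝ] E n}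
    (hu : HasWeakDeriv Ω u G) {θ : E s → ℝ} (hθ : IsTestFunction Ω θ) :
    HasWeakDeriv univ (fun x => θ x • u x)
      (fun x => θ x • G x + (fderiv ℝ θ x).smulRight (u x)) := by
  have i1 := LocallyIntegrableOn.integrable_testFunction_smul hu.1 hθ
  have i2 := LocallyIntegrableOn.integrable_testFunction_smul hu.2.1 hθ
  have i3 : Integrable (fun x => (fderiv ℝ θ x).smulRight (u x)) := by
    have h1 : IntegrableOn u (tsupport θ) := hu.1.integrableOn_compact_subset hθ.2.2 hθ.2.1
    obtain ⟨C, hC⟩ := (hθ.2.1.fderiv ℝ).exists_bound_of_continuous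
      (hθ.1.continuous_fderiv (by simp))
    have h2 : IntegrableOn (fun x => (fderiv ℝ θ x).smulRight (u x)) (tsupport θ) := by
      refine Integrable.mono' (h1.norm.const_mul C) ?_ ?_
      · exact ((ContinuousLinearMap.smulRightL ℝ (E s) (E n)).continuous₂).comp_aestronglyMeasurable
          ((hθ.1.continuous_fderiv (by simp)).aestronglyMeasurable.prodMk h1.aestronglyMeasurable)
      · filter_upwards with x
        rw [ContinuousLinearMap.norm_smulRight_apply]
        gcongr
        exact hC x
    refine integrable_of_integrableOn_of_eq_zero h2 fun x hx => ?_
    have h0 : fderiv ℝ θ x = 0 :=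
      image_eq_zero_of_notMem_tsupport fun h => hx (tsupport_fderiv_subset ℝ h)
    simp only [h0]
    ext; simp
  refine hasWeakDeriv_of_integral (i1.locallyIntegrable.locallyIntegrableOn _)
    ((i2.add i3).locallyIntegrable.locallyIntegrableOn _) fun φ hφ e => ?_
  -- Leibniz rule by duality: `φ` need not be supported in `Ω`, but `θ φ` is, so `u` is tested with
  -- the product.
  have hθφ : IsTestFunction Ω (fun x => θ x * φ x) :=
    ⟨hθ.1.mul hφ.1, hθ.2.1.mul_right, (tsupport_mul_subset_left).trans hθ.2.2⟩
  have key := hu.integral_eq hθφ e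
  have hd : ∀ x, fderiv ℝ (fun x => θ x * φ x) x e =
      θ x * fderiv ℝ φ x e + φ x * fderiv ℝ θ x e := by
    intro x
    rw [fderiv_fun_mul (hθ.1.differentiable (by simp) x) (hφ.1.differentiable (by simp) x)]
    simp
  have hθφ' : IsTestFunction Ω (fun x => θ x * fderiv ℝ φ x e) :=
    ⟨hθ.1.mul (hφ.fderiv_apply e).1, hθ.2.1.mul_right, (tsupport_mul_subset_left).trans hθ.2.2⟩
  have hθφ'' : IsTestFunction Ω (fun x => φ x * fderiv ℝ θ x e) :=
    ⟨hφ.1.mul (hθ.fderiv_apply e).1, hφ.2.1.mul_right,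
      (tsupport_mul_subset_right).trans (hθ.fderiv_apply e).2.2⟩
  simp only [hd, add_smul] at key
  rw [integral_add (LocallyIntegrableOn.integrable_testFunction_smul hu.1 hθφ')
    (LocallyIntegrableOn.integrable_testFunction_smul hu.1 hθφ'')] at key
  simp only [_root_.add_apply, _root_.smul_apply, ContinuousLinearMap.smulRight_apply, smul_add,
    smul_smul]
  have j1 := LocallyIntegrableOn.integrable_testFunction_smul
    (locallyIntegrableOn_apply hu.2.1 e) hθφ
  have j2 := LocallyIntegrableOn.integrable_testFunction_smul hu.1 hθφ''
  rw [integral_add (by simpa only [mul_comm] using j1) j2]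
  simp only [mul_comm (fderiv ℝ φ _ e) (θ _), mul_comm (φ _) (θ _)]
  rw [neg_add, ← key]
  abel

end WeakDerivative

/-! ### Mollification and convergence in `L²` -/

section Mollification

open scoped Convolution

variable {s n : ℕ}

/-- The standard sequence of bump functions shrinking to the origin. -/
def stdBump (s : ℕ) (k : ℕ) : ContDiffBump (0 : E s) where
  rIn := 1 / ((k : ℝ) + 1)
  rOut := 2 / ((k : ℝ) + 1)
  rIn_pos := by positivity
  rIn_lt_rOut := by gcongr; norm_num

lemma eLpNorm_two_sq {α V : Type*} [NormedAddCommGroup V] [MeasurableSpace α] {μ : Measure α}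
    (f : α → V) : eLpNorm f 2 μ ^ 2 = ∫⁻ x, ‖f x‖ₑ ^ 2 ∂μ := by
  have := eLpNorm_nnreal_pow_eq_lintegral (μ := μ) (f := f) (p := 2) (by norm_num)
  simpa using this

lemma tendsto_eLpNorm_two_of_lintegral {α ι V : Type*} [NormedAddCommGroup V] [MeasurableSpace α]
    {μ : Measure α} {l : Filter ι} {f : ι → α → V}
    (h : Tendsto (fun k => ∫⁻ x, ‖f k x‖ₑ ^ 2 ∂μ) l (𝓝 0)) :
    Tendsto (fun k => eLpNorm (f k) 2 μ) l (𝓝 0) := by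
  have h2 := (ENNReal.continuous_rpow_const (y := (1 / 2 : ℝ))).tendsto 0 |>.comp h
  rw [ENNReal.zero_rpow_of_pos (by norm_num)] at h2
  refine h2.congr fun k => ?_
  rw [Function.comp_apply, ← eLpNorm_two_sq, ← ENNReal.rpow_natCast, ← ENNReal.rpow_mul]
  norm_num

variable {V : Type*} [NormedAddCommGroup V] [NormedSpace ℝ V]

/-- Mollification at scale `2 / (k + 1)`. -/
def mollify (k : ℕ) (w : E s → V) : E s → V :=
  (stdBump s k).normed volume ⋆[ContinuousLinearMap.lsmul ℝ ℝ, volume] w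

lemma tendsto_stdBump_rOut : Tendsto (fun k => (stdBump s k).rOut) atTop (𝓝 0) := by
  have : Tendsto (fun k : ℕ => 2 * (1 / ((k : ℝ) + 1))) atTop (𝓝 (2 * 0)) :=
    tendsto_one_div_add_atTop_nhds_zero_nat.const_mul 2
  simpa [stdBump, div_eq_mul_inv] using this

/-- Lebesgue differentiation; it applies because the outer and inner radii of the bumps keep the
fixed ratio `2`. -/
lemma ae_tendsto_mollify [CompleteSpace V] {w : E s → V} (hw : LocallyIntegrable w) :
    ∀ᵐ x, Tendsto (fun k => mollify k w x) atTop (𝓝 (w x)) :=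
  ContDiffBump.ae_convolution_tendsto_right_of_locallyIntegrable (K := 2) tendsto_stdBump_rOut
    (Eventually.of_forall fun k => by simp [stdBump, div_eq_mul_inv]) hw

lemma contDiff_mollify [CompleteSpace V] {w : E s → V} (hw : LocallyIntegrable w) (k : ℕ) :
    ContDiff ℝ ∞ (mollify k w) :=
  (stdBump s k).hasCompactSupport_normed.contDiff_convolution_left _
    (stdBump s k).contDiff_normed hw

lemma support_mollify_subset {w : E s → V} (k : ℕ) :
    Function.support (mollify k w) ⊆ Metric.cthickening (2 / ((k : ℝ) + 1)) (tsupport w) := by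
  refine (support_convolution_subset _).trans ?_
  rintro _ ⟨a, ha, b, hb, rfl⟩
  rw [ContDiffBump.support_normed_eq, mem_ball_zero_iff] at ha
  refine Metric.mem_cthickening_of_dist_le _ b _ _ (subset_tsupport _ hb) ?_
  rw [dist_eq_norm, add_sub_cancel_right]
  exact ha.le

lemma mollify_apply (k : ℕ) (w : E s → V) (x : E s) :
    mollify k w x = ∫ t, (stdBump s k).normed volume t • w (x - t) := rfl

lemma mollify_apply_swap (k : ℕ) (w : E s → V) (x : E s) :
    mollify k w x = ∫ t, (stdBump s k).normed volume (x - t) • w t := by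
  rw [mollify, convolution_eq_swap]; rfl

lemma integrable_bump_smul_comp_sub {w : E s → V} (hw : LocallyIntegrable w) (k : ℕ) (x : E s) :
    Integrable (fun t => (stdBump s k).normed volume t • w (x - t)) :=
  (stdBump s k).hasCompactSupport_normed.convolutionExists_left
    (ContinuousLinearMap.lsmul ℝ ℝ) (stdBump s k).continuous_normed hw x

/-- Jensen's inequality for mollification. -/
lemma norm_mollify_sq_le {w : E s → V} (hw : MemLp w 2) (k : ℕ) (x : E s) :
    ‖mollify k w x‖ ^ 2 ≤ mollify k (fun y => ‖w y‖ ^ 2) x := by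
  have hwl : LocallyIntegrable w := hw.locallyIntegrable (by norm_num)
  have hw2 : Integrable (fun y => ‖w y‖ ^ 2) := hw.integrable_norm_pow (by norm_num)
  set ρ := (stdBump s k).normed volume with hρ
  have hρ0 : ∀ t, 0 ≤ ρ t := (stdBump s k).nonneg_normed
  have i1 := integrable_bump_smul_comp_sub hwl k x
  have i2 := integrable_bump_smul_comp_sub hw2.locallyIntegrable k x
  have i3 : Integrable (fun t => ρ t * ‖w (x - t)‖) := by
    refine i1.norm.congr (Eventually.of_forall fun t => ?_)
    simp [norm_smul, abs_of_nonneg (hρ0 t), ← hρ]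
  have i0 : Integrable ρ := (stdBump s k).integrable_normed
  have hone : ∫ t, ρ t = 1 := (stdBump s k).integral_normed
  set m := ∫ t, ρ t * ‖w (x - t)‖ with hm
  have h1 : ‖mollify k w x‖ ≤ m := by
    rw [mollify_apply]
    refine (norm_integral_le_integral_norm _).trans_eq ?_
    refine integral_congr_ae (Eventually.of_forall fun t => ?_)
    simp [norm_smul, abs_of_nonneg (hρ0 t), ← hρ]
  -- Jensen for the square is the nonnegativity of the variance of `‖w (x - ·)‖` under the
  -- probability density `ρ`.
  have h2 : 0 ≤ ∫ t, ρ t * (‖w (x - t)‖ - m) ^ 2 :=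
    integral_nonneg fun t => mul_nonneg (hρ0 t) (sq_nonneg _)
  have h3 : ∫ t, ρ t * (‖w (x - t)‖ - m) ^ 2 =
      mollify k (fun y => ‖w y‖ ^ 2) x - m ^ 2 := by
    have : ∀ t, ρ t * (‖w (x - t)‖ - m) ^ 2 =
        ρ t • ‖w (x - t)‖ ^ 2 - 2 * m * (ρ t * ‖w (x - t)‖) + m ^ 2 * ρ t := by
      intro t; simp only [smul_eq_mul]; ring
    simp only [this]
    have e1 : ∫ t, (ρ t • ‖w (x - t)‖ ^ 2 - 2 * m * (ρ t * ‖w (x - t)‖) + m ^ 2 * ρ t) =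
        (∫ t, (ρ t • ‖w (x - t)‖ ^ 2 - 2 * m * (ρ t * ‖w (x - t)‖))) + ∫ t, m ^ 2 * ρ t :=
      integral_add (i2.sub (i3.const_mul _)) (i0.const_mul _)
    have e2 : ∫ t, (ρ t • ‖w (x - t)‖ ^ 2 - 2 * m * (ρ t * ‖w (x - t)‖)) =
        (∫ t, ρ t • ‖w (x - t)‖ ^ 2) - ∫ t, 2 * m * (ρ t * ‖w (x - t)‖) :=
      integral_sub i2 (i3.const_mul _)
    rw [e1, e2, integral_const_mul, integral_const_mul, hone, ← hm, mollify_apply]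
    ring
  have h4 : ‖mollify k w x‖ ^ 2 ≤ m ^ 2 := by gcongr
  linarith

lemma integral_mollify {f : E s → ℝ} (hf : Integrable f) (k : ℕ) :
    ∫ x, mollify k f x = ∫ x, f x := by
  rw [mollify, integral_convolution _ (stdBump s k).integrable_normed hf,
    (stdBump s k).integral_normed]
  simp

lemma integrable_mollify {f : E s → ℝ} (hf : Integrable f) (k : ℕ) :
    Integrable (mollify k f) :=
  Integrable.integrable_convolution _ (stdBump s k).integrable_normed hf

/-- Generalized dominated convergence: by Jensen, `‖w - mollify k w‖²` is dominated by `b k`, whose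
integral `I` does not depend on `k`. Fatou's lemma for `b k - a k` then forces the integrals of `a
k` to zero. -/
lemma tendsto_mollify_sub [CompleteSpace V] {w : E s → V} (hw : MemLp w 2) :
    Tendsto (fun k => eLpNorm (w - mollify k w) 2 volume) atTop (𝓝 0) := by
  have hwl : LocallyIntegrable w := hw.locallyIntegrable (by norm_num)
  have hw2 : Integrable (fun y => ‖w y‖ ^ 2) := hw.integrable_norm_pow (by norm_num)
  refine tendsto_eLpNorm_two_of_lintegral ?_
  set a : ℕ → E s → ℝ := fun k x => ‖(w - mollify k w) x‖ ^ 2 with ha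
  set b : ℕ → E s → ℝ := fun k x => 2 * mollify k (fun y => ‖w y‖ ^ 2) x + 2 * ‖w x‖ ^ 2 with hb
  have hab : ∀ k x, a k x ≤ b k x := by
    intro k x
    have h1 := norm_mollify_sq_le hw k x
    have h2 : ‖(w - mollify k w) x‖ ≤ ‖w x‖ + ‖mollify k w x‖ := norm_sub_le _ _
    have h3 : ‖(w - mollify k w) x‖ ^ 2 ≤ (‖w x‖ + ‖mollify k w x‖) ^ 2 := by gcongr
    simp only [ha, hb]
    nlinarith [sq_nonneg (‖w x‖ - ‖mollify k w x‖)]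
  have ha0 : ∀ k x, 0 ≤ a k x := fun k x => sq_nonneg _
  have hbi : ∀ k, Integrable (b k) := fun k =>
    ((integrable_mollify hw2 k).const_mul 2).add (hw2.const_mul 2)
  have hmeas : ∀ k, AEStronglyMeasurable (a k) volume := fun k =>
    ((hw.aestronglyMeasurable.sub
      (contDiff_mollify hwl k).continuous.aestronglyMeasurable).norm.pow 2)
  have hai : ∀ k, Integrable (a k) := fun k =>
    (hbi k).mono' (hmeas k) (Eventually.of_forall fun x => by
      rw [Real.norm_of_nonneg (ha0 k x)]; exact hab k x)
  set I := ∫ x, 4 * ‖w x‖ ^ 2 with hI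
  have hbI : ∀ k, ∫ x, b k x = I := by
    intro k
    simp only [hb]
    rw [integral_add ((integrable_mollify hw2 k).const_mul 2) (hw2.const_mul 2),
      integral_const_mul, integral_const_mul, integral_mollify hw2, hI, integral_const_mul]
    ring
  set A : ℕ → ℝ≥0∞ := fun k => ∫⁻ x, ENNReal.ofReal (a k x) with hA
  set C : ℕ → ℝ≥0∞ := fun k => ∫⁻ x, ENNReal.ofReal (b k x - a k x) with hC
  have hAC : ∀ k, A k + C k = ENNReal.ofReal I := by
    intro k
    rw [hA, hC, ← hbI k, ofReal_integral_eq_lintegral_ofReal (hbi k)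
      (Eventually.of_forall fun x => (ha0 k x).trans (hab k x)), ← lintegral_add_left']
    · refine lintegral_congr fun x => ?_
      rw [← ENNReal.ofReal_add (ha0 k x) (sub_nonneg.2 (hab k x)), add_sub_cancel]
    · exact (hmeas k).aemeasurable.ennreal_ofReal
  -- Almost everywhere `a k → 0` and `b k → 4 ‖w‖²`, so the pointwise limit of `b k - a k` already
  -- has integral `I`.
  have hfat : ENNReal.ofReal I ≤ liminf C atTop := by
    have h1 : ENNReal.ofReal I = ∫⁻ x, liminf (fun k => ENNReal.ofReal (b k x - a k x)) atTop := by
      rw [hI, ofReal_integral_eq_lintegral_ofReal (hw2.const_mul 4)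
        (Eventually.of_forall fun x => by positivity)]
      refine lintegral_congr_ae ?_
      filter_upwards [ae_tendsto_mollify hwl, ae_tendsto_mollify hw2.locallyIntegrable] with x h1 h2
      have h3 : Tendsto (fun k => b k x - a k x) atTop (𝓝 (4 * ‖w x‖ ^ 2)) := by
        have h4 := ((h2.const_mul 2).add_const (2 * ‖w x‖ ^ 2)).sub
          (((tendsto_const_nhds (x := w x)).sub h1).norm.pow 2)
        have h5 : 2 * ‖w x‖ ^ 2 + 2 * ‖w x‖ ^ 2 - ‖w x - w x‖ ^ 2 = 4 * ‖w x‖ ^ 2 := by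
          simp; ring
        rw [h5] at h4
        exact h4
      exact ((ENNReal.continuous_ofReal.tendsto _).comp h3).liminf_eq.symm
    rw [h1]
    exact lintegral_liminf_le' fun k => ((hbi k).sub (hai k)).aemeasurable.ennreal_ofReal
  have hCI : Tendsto C atTop (𝓝 (ENNReal.ofReal I)) :=
    tendsto_of_le_liminf_of_limsup_le hfat
      (limsup_le_of_le (by isBoundedDefault) (Eventually.of_forall fun k => by
        rw [← hAC k]; exact le_add_self))
  have hAk : ∀ k, A k = ENNReal.ofReal I - C k := by
    intro k
    rw [← hAC k]
    refine (ENNReal.add_sub_cancel_right ?_).symm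
    refine ne_top_of_le_ne_top (b := ENNReal.ofReal I) ENNReal.ofReal_ne_top ?_
    rw [← hAC k]; exact le_add_self
  have hlim : Tendsto A atTop (𝓝 0) := by
    have := ENNReal.Tendsto.sub (tendsto_const_nhds (x := ENNReal.ofReal I)) hCI
      (Or.inl ENNReal.ofReal_ne_top)
    rw [tsub_self] at this
    exact this.congr fun k => (hAk k).symm
  refine hlim.congr fun k => lintegral_congr fun x => ?_
  rw [ha, ENNReal.ofReal_pow (norm_nonneg _), ofReal_norm]

/-- Mollification commutes with weak differentiation. -/
lemma fderiv_mollify {w : E s → E n} {Γ : E s → E s →L[ℝ] E n} (h : HasWeakDeriv univ w Γ) (k : ℕ) :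
    fderiv ℝ (mollify k w) = mollify k Γ := by
  have hwl : LocallyIntegrable w := locallyIntegrableOn_univ.1 h.1
  have hΓl : LocallyIntegrable Γ := locallyIntegrableOn_univ.1 h.2.1
  funext x
  have hρ : ContDiff ℝ ∞ ((stdBump s k).normed volume) := (stdBump s k).contDiff_normed
  have h1 := (stdBump s k).hasCompactSupport_normed (μ := volume).hasFDerivAt_convolution_left
    (ContinuousLinearMap.lsmul ℝ ℝ) (hρ.of_le (by simp)) hwl x
  rw [mollify, h1.fderiv]
  ext1 e
  -- The reflected kernel is the test function. The sign from the reflection cancels the sign of the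
  -- integration by parts.
  have hψ : IsTestFunction univ (fun t => (stdBump s k).normed volume (x - t)) := by
    refine ⟨hρ.comp (contDiff_const.sub contDiff_id), ?_, subset_univ _⟩
    exact (stdBump s k).hasCompactSupport_normed.comp_homeomorph (Homeomorph.subLeft x)
  have hfd : ∀ t, fderiv ℝ (fun t => (stdBump s k).normed volume (x - t)) t e =
      -fderiv ℝ ((stdBump s k).normed volume) (x - t) e := by
    intro t
    have := ((hρ.differentiable (by simp) (x - t)).hasFDerivAt).comp t
      ((hasFDerivAt_id t).const_sub x)
    have h2 := this.fderiv
    rw [Function.comp_def] at h2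
    simp only at h2
    rw [h2]
    simp
  have h3 := h.integral_eq hψ e
  simp only [hfd, neg_smul, integral_neg, neg_inj] at h3
  rw [convolution_eq_swap, mollify_apply_swap, ContinuousLinearMap.integral_apply,
    ContinuousLinearMap.integral_apply]
  · simpa [ContinuousLinearMap.precompL_apply] using h3
  · exact LocallyIntegrableOn.integrable_testFunction_smul (h.2.1) hψ
  · have h4 : ConvolutionExistsAt (fderiv ℝ ((stdBump s k).normed volume)) w x
      ((ContinuousLinearMap.lsmul ℝ ℝ : ℝ →L[ℝ] E n →L[ℝ] E n).precompL (E s)) volume :=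
      ((stdBump s k).hasCompactSupport_normed.fderiv ℝ).convolutionExists_left _
        (hρ.continuous_fderiv (by simp)) hwl x
    exact h4.integrable_swap

end Mollification

/-! ### Chain rule for Sobolev maps and a criterion for `H¹₀` -/

section ChainRule

variable {s n m : ℕ} {Ω : Set (E s)}

-- Equality to `1` on a neighbourhood of `K`, not only on `K`, makes the derivative of the cutoff
-- vanish on `K` as well.
open scoped Manifold in
lemma exists_testFunction_eq_one {K : Set (E s)} (hΩ : IsOpen Ω) (hK : IsCompact K)
    (hKΩ : K ⊆ Ω) :
    ∃ θ : E s → ℝ, IsTestFunction Ω θ ∧ (∀ᶠ x in 𝓝ˢ K, θ x = 1) ∧ ∀ x, θ x ∈ Icc (0 : ℝ) 1 := by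
  obtain ⟨L, hL, hKL, hLΩ⟩ := exists_compact_between hK hΩ hKΩ
  obtain ⟨f, h1, h2, h3⟩ := exists_contMDiffMap_one_nhds_of_subset_interior (n := (⊤ : ℕ∞))
    𝓘(ℝ, E s) hK.isClosed hKL
  have hsub : tsupport f ⊆ L := closure_minimal (fun x hx => by
    by_contra h; exact hx (h2 x h)) hL.isClosed
  exact ⟨f, ⟨f.contMDiff.contDiff, hL.of_isClosed_subset (isClosed_tsupport _) hsub,
    hsub.trans hLΩ⟩, h1, h3⟩

lemma memLp_of_norm_le {α V : Type*} [MeasurableSpace α] {μ : Measure α} [NormedAddCommGroup V]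
    {p : ℝ≥0∞} {f : α → V} {g : α → ℝ} (hg : MemLp g p μ) (hf : AEStronglyMeasurable f μ)
    (h : ∀ x, ‖f x‖ ≤ g x) : MemLp f p μ :=
  hg.mono hf (Eventually.of_forall fun x => (h x).trans (le_abs_self _))

lemma memLp_one_add_norm {α V : Type*} [MeasurableSpace α] {μ : Measure α} [IsFiniteMeasure μ]
    [NormedAddCommGroup V] {p : ℝ≥0∞} {f : α → V} (hf : MemLp f p μ) (C : ℝ) :
    MemLp (fun x => C * (1 + ‖f x‖)) p μ :=
  ((memLp_const (1 : ℝ)).add hf.norm).const_mul C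

/-- Cauchy–Schwarz: the integrands differ by at most a fixed `L²` function times a sequence tending
to zero in `L²`. -/
lemma tendsto_integral_sub_zero {α V W : Type*} [MeasurableSpace α] {μ : Measure α}
    [NormedAddCommGroup V] [NormedSpace ℝ V] [NormedAddCommGroup W] {f g : ℕ → α → V}
    {Δ : ℕ → α → W} {ψ : α → ℝ} {C : ℝ} (hC : 0 ≤ C) (hψ : MemLp ψ 2 μ)
    (hf : ∀ k, Integrable (f k) μ) (hg : ∀ k, Integrable (g k) μ)
    (hΔm : ∀ k, AEStronglyMeasurable (Δ k) μ)
    (hΔ : Tendsto (fun k => eLpNorm (Δ k) 2 μ) atTop (𝓝 0))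
    (h : ∀ k, ∀ᵐ x ∂μ, ‖f k x - g k x‖ ≤ C * (‖ψ x‖ * ‖Δ k x‖)) :
    Tendsto (fun k => (∫ x, f k x ∂μ) - ∫ x, g k x ∂μ) atTop (𝓝 0) := by
  have hbound : ∀ k, ‖(∫ x, f k x ∂μ) - ∫ x, g k x ∂μ‖ₑ ≤
      ENNReal.ofReal C * (eLpNorm ψ 2 μ * eLpNorm (Δ k) 2 μ) := by
    intro k
    rw [← integral_sub (hf k) (hg k)]
    refine (enorm_integral_le_lintegral_enorm _).trans ?_
    have h2 : eLpNorm (fun x => ψ x • ‖Δ k x‖) 1 μ ≤ eLpNorm ψ 2 μ * eLpNorm (Δ k) 2 μ := by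
      have h3 := eLpNorm_smul_le_mul_eLpNorm (μ := μ) (p := 2) (q := 2) (r := 1) (hΔm k).norm
        hψ.aestronglyMeasurable
      rw [eLpNorm_norm] at h3
      exact h3
    refine le_trans ?_ (mul_le_mul' le_rfl h2)
    rw [eLpNorm_one_eq_lintegral_enorm, ← lintegral_const_mul' _ _ ENNReal.ofReal_ne_top]
    refine lintegral_mono_ae ?_
    filter_upwards [h k] with x hx
    rw [← ofReal_norm, ← ofReal_norm, ← ENNReal.ofReal_mul hC]
    refine ENNReal.ofReal_le_ofReal ?_
    rwa [norm_smul, norm_norm]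
  rw [tendsto_zero_iff_enorm_tendsto_zero]
  refine tendsto_of_tendsto_of_tendsto_of_le_of_le tendsto_const_nhds ?_
    (fun k => zero_le) hbound
  have h4 := ENNReal.Tendsto.const_mul (a := eLpNorm ψ 2 μ) hΔ (Or.inr hψ.eLpNorm_ne_top)
  have h5 := ENNReal.Tendsto.const_mul (a := ENNReal.ofReal C) h4
    (Or.inr ENNReal.ofReal_ne_top)
  simpa using h5

lemma memLp_of_support_subset {V : Type*} [NormedAddCommGroup V] (hΩ : IsOpen Ω) {p : ℝ≥0∞}
    {f : E s → V} (hf : MemLp f p (volume.restrict Ω)) (h : ∀ x ∉ Ω, f x = 0) : MemLp f p := by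
  have h1 : Ω.indicator f = f := by
    funext x
    by_cases hx : x ∈ Ω
    · rw [indicator_of_mem hx]
    · rw [indicator_of_notMem hx, h x hx]
  rw [← h1]
  exact (memLp_indicator_iff_restrict hΩ.measurableSet).2 hf

lemma memLp_testFunction_smul {V : Type*} [NormedAddCommGroup V] [NormedSpace ℝ V]
    (hΩ : IsOpen Ω) {p : ℝ≥0∞} {f : E s → V} (hf : MemLp f p (volume.restrict Ω)) {θ : E s → ℝ}
    (hθ : IsTestFunction Ω θ) : MemLp (fun x => θ x • f x) p := by
  obtain ⟨C, hC⟩ := hθ.2.1.exists_bound_of_continuous hθ.1.continuous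
  refine memLp_of_support_subset hΩ ?_ fun x hx => by rw [hθ.eq_zero hx, zero_smul]
  refine hf.of_le_mul (c := C)
    (hθ.1.continuous.aestronglyMeasurable.smul hf.aestronglyMeasurable) ?_
  filter_upwards with x
  rw [norm_smul]
  gcongr
  exact hC x

lemma memLp_fderiv_smulRight (hΩ : IsOpen Ω) {p : ℝ≥0∞} {u : E s → E n}
    (hu : MemLp u p (volume.restrict Ω)) {θ : E s → ℝ} (hθ : IsTestFunction Ω θ) :
    MemLp (fun x => (fderiv ℝ θ x).smulRight (u x)) p := by
  obtain ⟨C, hC⟩ := (hθ.2.1.fderiv ℝ).exists_bound_of_continuous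
      (hθ.1.continuous_fderiv (by simp))
  refine memLp_of_support_subset hΩ ?_ fun x hx => by
    rw [hθ.fderiv_eq_zero hx]; ext; simp
  refine hu.of_le_mul (c := C) ?_ ?_
  · exact ((ContinuousLinearMap.smulRightL ℝ (E s) (E n)).continuous₂).comp_aestronglyMeasurable
      ((hθ.1.continuous_fderiv (by simp)).aestronglyMeasurable.prodMk hu.aestronglyMeasurable)
  · filter_upwards with x
    rw [ContinuousLinearMap.norm_smulRight_apply]
    gcongr
    exact hC x

/-- The derivative of `x ↦ F (x, u x)` when `du = G`. -/
def compDeriv (F : E s × E n → E m) (u : E s → E n) (G : E s → E s →L[ℝ] E n) (x : E s) :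
    E s →L[ℝ] E m :=
  (fderiv ℝ F (x, u x)).comp ((ContinuousLinearMap.id ℝ (E s)).prod (G x))

lemma compDeriv_apply (F : E s × E n → E m) (u : E s → E n) (G : E s → E s →L[ℝ] E n) (x e : E s) :
    compDeriv F u G x e = fderiv ℝ F (x, u x) (e, G x e) := rfl

lemma norm_compDeriv_le {F : E s × E n → E m} {u : E s → E n} {G : E s → E s →L[ℝ] E n} {C : ℝ}
    {x : E s} (hC : ‖fderiv ℝ F (x, u x)‖ ≤ C) : ‖compDeriv F u G x‖ ≤ C * (1 + ‖G x‖) := by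
  have hC0 : 0 ≤ C := (norm_nonneg _).trans hC
  refine ContinuousLinearMap.opNorm_le_bound _ (by positivity) fun e => ?_
  rw [compDeriv_apply]
  refine (ContinuousLinearMap.le_opNorm _ _).trans ?_
  rw [mul_assoc]
  gcongr
  rw [Prod.norm_mk]
  refine max_le ?_ ?_
  · nlinarith [norm_nonneg e, norm_nonneg (G x)]
  · refine ((G x).le_opNorm e).trans ?_
    nlinarith [norm_nonneg e, norm_nonneg (G x)]

lemma aestronglyMeasurable_compDeriv {F : E s × E n → E m} (hF : ContDiff ℝ 1 F) {u : E s → E n}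
    {G : E s → E s →L[ℝ] E n} {μ : Measure (E s)} (hu : AEStronglyMeasurable u μ)
    (hG : AEStronglyMeasurable G μ) : AEStronglyMeasurable (compDeriv F u G) μ := by
  have h1 : AEStronglyMeasurable (fun x => fderiv ℝ F (x, u x)) μ :=
    (hF.continuous_fderiv (by simp)).comp_aestronglyMeasurable
      (aestronglyMeasurable_id.prodMk hu)
  have h2 : AEStronglyMeasurable (fun x => (ContinuousLinearMap.id ℝ (E s)).prod (G x)) μ := by
    have : Continuous fun T : E s →L[ℝ] E n => (ContinuousLinearMap.id ℝ (E s)).prod T :=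
      (ContinuousLinearMap.prodₗᵢ (𝕜 := ℝ) (E := E s) (F := E s) (G := E n)
        ℝ).continuous.comp (continuous_const.prodMk continuous_id)
    exact this.comp_aestronglyMeasurable hG
  exact (isBoundedBilinearMap_comp.continuous).comp_aestronglyMeasurable (h1.prodMk h2)

lemma memLp_comp [IsFiniteMeasure (volume.restrict Ω)] {F : E s × E n → E m} (hF : ContDiff ℝ 1 F)
    (hFc : HasCompactSupport F) {u : E s → E n} {p : ℝ≥0∞} (hu : AEStronglyMeasurable u (volume.restrict Ω)) :
    MemLp (fun x => F (x, u x)) p (volume.restrict Ω) := by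
  obtain ⟨C, hC⟩ := hFc.exists_bound_of_continuous hF.continuous
  exact MemLp.of_bound (hF.continuous.comp_aestronglyMeasurable
    (aestronglyMeasurable_id.prodMk hu)) C (Eventually.of_forall fun x => hC _)

lemma memLp_compDeriv [IsFiniteMeasure (volume.restrict Ω)] {F : E s × E n → E m}
    (hF : ContDiff ℝ 1 F) (hFc : HasCompactSupport F) {u : E s → E n} {G : E s → E s →L[ℝ] E n}
    {p : ℝ≥0∞} (hu : AEStronglyMeasurable u (volume.restrict Ω))
    (hG : MemLp G p (volume.restrict Ω)) :
    MemLp (compDeriv F u G) p (volume.restrict Ω) := by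
  obtain ⟨C, hC⟩ := (hFc.fderiv ℝ).exists_bound_of_continuous (hF.continuous_fderiv (by simp))
  exact memLp_of_norm_le (memLp_one_add_norm hG C)
    (aestronglyMeasurable_compDeriv hF hu hG.aestronglyMeasurable)
    fun x => norm_compDeriv_le (hC _)

lemma MemLp.locallyIntegrableOn_of_restrict {V : Type*} [NormedAddCommGroup V]
    [IsFiniteMeasure (volume.restrict Ω)]
    {f : E s → V} (hf : MemLp f 2 (volume.restrict Ω)) : LocallyIntegrableOn f Ω :=
  IntegrableOn.locallyIntegrableOn (μ := volume) (hf.integrable (by norm_num))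

set_option maxHeartbeats 1000000 in
/-- The chain rule for the composition of a Sobolev function with a compactly supported
`C¹`-function. -/
lemma HasWeakDeriv.comp [IsFiniteMeasure (volume.restrict Ω)] (hΩ : IsOpen Ω)
    {F : E s × E n → E m} (hF : ContDiff ℝ 1 F)
    (hFc : HasCompactSupport F) {u : E s → E n} {G : E s → E s →L[ℝ] E n}
    (h : HasWeakDeriv Ω u G) (hu : MemLp u 2 (volume.restrict Ω))
    (hG : MemLp G 2 (volume.restrict Ω)) :
    HasWeakDeriv Ω (fun x => F (x, u x)) (compDeriv F u G) := by
  refine hasWeakDeriv_of_integral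
    (MemLp.locallyIntegrableOn_of_restrict (memLp_comp hF hFc hu.aestronglyMeasurable))
    (MemLp.locallyIntegrableOn_of_restrict (memLp_compDeriv hF hFc hu.aestronglyMeasurable hG))
    fun ψ hψ e => ?_
  obtain ⟨C, hC⟩ := (hFc.fderiv ℝ).exists_bound_of_continuous (hF.continuous_fderiv (by simp))
  obtain ⟨C', hC'⟩ := hFc.exists_bound_of_continuous hF.continuous
  have hC0 : 0 ≤ C := (norm_nonneg _).trans (hC (0, 0))
  -- Cutting off with `θ = 1` near the support of `ψ` makes `u` a Sobolev function on the whole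
  -- space, which can be mollified, and changes neither side of the identity tested with `ψ`.
  obtain ⟨θ, hθ, hθ1, -⟩ := exists_testFunction_eq_one hΩ hψ.2.1 hψ.2.2
  set w : E s → E n := fun x => θ x • u x with hw
  set Γ : E s → E s →L[ℝ] E n := fun x => θ x • G x + (fderiv ℝ θ x).smulRight (u x) with hΓ
  have hwΓ : HasWeakDeriv univ w Γ := h.testFunction_smul hθ
  have hw2 : MemLp w 2 := memLp_testFunction_smul hΩ hu hθ
  have hΓ2 : MemLp Γ 2 :=
    (memLp_testFunction_smul hΩ hG hθ).add (memLp_fderiv_smulRight hΩ hu hθ)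
  have hwl : LocallyIntegrable w := hw2.locallyIntegrable (by norm_num)
  have hΓl : LocallyIntegrable Γ := hΓ2.locallyIntegrable (by norm_num)
  have hwu : ∀ x ∈ tsupport ψ, w x = u x := fun x hx => by
    simp [hw, hθ1.self_of_nhdsSet x hx]
  have hΓG : ∀ x ∈ tsupport ψ, Γ x = G x := fun x hx => by
    have h1 : θ =ᶠ[𝓝 x] fun _ => (1 : ℝ) := hθ1.filter_mono (nhds_le_nhdsSet hx)
    have h2 : fderiv ℝ θ x = 0 := by rw [h1.fderiv_eq]; simp
    have h3 : θ x = 1 := h1.self_of_nhds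
    simp only [hΓ, h2, h3, one_smul]
    ext; simp
  set om : ℕ → E s → E n := fun k => mollify k w with hom
  have homs : ∀ k, ContDiff ℝ ∞ (om k) := fun k => contDiff_mollify hwl k
  have homd : ∀ k, fderiv ℝ (om k) = mollify k Γ := fun k => fderiv_mollify hwΓ k
  have hcomp : ∀ k, ContDiff ℝ 1 (fun x => F (x, om k x)) := fun k =>
    hF.comp (contDiff_id.prodMk ((homs k).of_le (by simp)))
  have hfd : ∀ k x, fderiv ℝ (fun x => F (x, om k x)) x e =
      fderiv ℝ F (x, om k x) (e, mollify k Γ x e) := by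
    intro k x
    have h1 := (hF.differentiable (by simp) (x, om k x)).hasFDerivAt.comp x
      ((hasFDerivAt_id x).prodMk ((homs k).differentiable (by simp) x).hasFDerivAt)
    rw [show (fun x => F (x, om k x)) = F ∘ fun x => (id x, om k x) from rfl, h1.fderiv, homd k]
    rfl
  have hψc : Continuous ψ := hψ.1.continuous
  have hψe : Continuous (fun x => fderiv ℝ ψ x e) := (hψ.fderiv_apply e).1.continuous
  have hψec : HasCompactSupport (fun x => fderiv ℝ ψ x e) := (hψ.fderiv_apply e).2.1
  have ibp : ∀ k, ∫ x, fderiv ℝ ψ x e • F (x, om k x) =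
      -∫ x, ψ x • fderiv ℝ F (x, om k x) (e, mollify k Γ x e) := by
    intro k
    have hcd : Continuous fun x => fderiv ℝ (fun x => F (x, om k x)) x e :=
      ((hcomp k).continuous_fderiv (by simp)).clm_apply continuous_const
    have := integral_smul_fderiv_eq_neg_fderiv_smul_of_integrable (μ := volume) (f := ψ)
      (g := fun x => F (x, om k x)) (v := e)
      ((hψe.smul (hcomp k).continuous).integrable_of_hasCompactSupport hψec.smul_right)
      ((hψc.smul hcd).integrable_of_hasCompactSupport hψ.2.1.smul_right)
      ((hψc.smul (hcomp k).continuous).integrable_of_hasCompactSupport hψ.2.1.smul_right)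
      (fun x _ => hψ.1.differentiable (by simp) x)
      (fun x _ => (hcomp k).differentiable (by simp) x)
    simp only [hfd] at this
    rw [this, neg_neg]
  have hae := ae_tendsto_mollify hwl
  have lim1 : Tendsto (fun k => ∫ x, fderiv ℝ ψ x e • F (x, om k x)) atTop
      (𝓝 (∫ x, fderiv ℝ ψ x e • F (x, w x))) := by
    refine tendsto_integral_of_dominated_convergence (fun x => ‖fderiv ℝ ψ x e‖ * C')
      (fun k => (hψe.smul (hcomp k).continuous).aestronglyMeasurable)
      ((hψe.integrable_of_hasCompactSupport hψec).norm.mul_const C') (fun k => ?_) ?_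
    · filter_upwards with x
      rw [norm_smul]
      gcongr
      exact hC' _
    · filter_upwards [hae] with x hx
      exact ((hF.continuous.tendsto _).comp (tendsto_const_nhds.prodMk_nhds hx)).const_smul _
  have hψ2 : MemLp ψ 2 := hψc.memLp_of_hasCompactSupport hψ.2.1
  have hdom : Integrable (fun x => ‖ψ x‖ * (C * ((1 + ‖Γ x‖) * ‖e‖))) := by
    have h1 : Integrable (fun x => ‖ψ x‖ * ‖Γ x‖) := hψ2.norm.integrable_mul hΓ2.norm
    have h2 : Integrable (fun x => ‖ψ x‖) := (hψc.integrable_of_hasCompactSupport hψ.2.1).norm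
    refine ((h2.add h1).mul_const (C * ‖e‖)).congr (Eventually.of_forall fun x => ?_)
    simp only [Pi.add_apply]; ring
  have hpair : ∀ x y, ‖fderiv ℝ F (x, y) (e, Γ x e)‖ ≤ C * ((1 + ‖Γ x‖) * ‖e‖) := by
    intro x y
    refine (ContinuousLinearMap.le_opNorm _ _).trans ?_
    gcongr
    · exact hC _
    · rw [Prod.norm_mk]
      refine max_le ?_ ?_
      · nlinarith [norm_nonneg e, norm_nonneg (Γ x)]
      · refine ((Γ x).le_opNorm e).trans ?_
        nlinarith [norm_nonneg e, norm_nonneg (Γ x)]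
  have hgm : ∀ k, AEStronglyMeasurable (fun x => ψ x • fderiv ℝ F (x, om k x) (e, Γ x e))
      volume := by
    intro k
    have := aestronglyMeasurable_compDeriv (μ := volume) hF
      (homs k).continuous.aestronglyMeasurable hΓ2.aestronglyMeasurable
    exact hψc.aestronglyMeasurable.smul (this.apply_continuousLinearMap e)
  have lim2 : Tendsto (fun k => ∫ x, ψ x • fderiv ℝ F (x, om k x) (e, Γ x e)) atTop
      (𝓝 (∫ x, ψ x • fderiv ℝ F (x, w x) (e, Γ x e))) := by
    refine tendsto_integral_of_dominated_convergence _ hgm hdom (fun k => ?_) ?_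
    · filter_upwards with x
      rw [norm_smul]
      gcongr
      exact hpair _ _
    · filter_upwards [hae] with x hx
      have h0 : Continuous fun y => ψ x • fderiv ℝ F (x, y) (e, Γ x e) := by
        have hh : Continuous fun y => fderiv ℝ F (x, y) :=
          (hF.continuous_fderiv (by simp)).comp (Continuous.prodMk_right x)
        have h9 : Continuous fun y => fderiv ℝ F (x, y) (e, Γ x e) :=
          hh.clm_apply continuous_const
        exact h9.const_smul (ψ x)
      exact (h0.tendsto _).comp hx
  -- The mollified integrand varies in two places. `lim2` treats the base point of `DF` with `Γ`
  -- frozen, by dominated convergence; here `Γ` is restored using its `L²` convergence and the bound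
  -- on `DF`.
  have lim3 : Tendsto (fun k => (∫ x, ψ x • fderiv ℝ F (x, om k x) (e, mollify k Γ x e)) -
      ∫ x, ψ x • fderiv ℝ F (x, om k x) (e, Γ x e)) atTop (𝓝 0) := by
    have hgi : ∀ k, Integrable (fun x => ψ x • fderiv ℝ F (x, om k x) (e, Γ x e)) := fun k =>
      hdom.mono' (hgm k) (Eventually.of_forall fun x => by
        rw [norm_smul]; gcongr; exact hpair _ _)
    have hfi : ∀ k, Integrable (fun x => ψ x • fderiv ℝ F (x, om k x) (e, mollify k Γ x e)) := by
      intro k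
      have hcd : Continuous fun x => fderiv ℝ (fun x => F (x, om k x)) x e :=
        ((hcomp k).continuous_fderiv (by simp)).clm_apply continuous_const
      simp only [hfd] at hcd
      exact (hψc.smul hcd).integrable_of_hasCompactSupport hψ.2.1.smul_right
    refine tendsto_integral_sub_zero (C := C * ‖e‖) (by positivity) hψ2 hfi hgi
      (fun k => hΓ2.aestronglyMeasurable.sub
        (contDiff_mollify hΓl k).continuous.aestronglyMeasurable)
      (tendsto_mollify_sub hΓ2) fun k => Eventually.of_forall fun x => ?_
    rw [← smul_sub, ← map_sub, norm_smul, Prod.mk_sub_mk, sub_self]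
    have h3 : ‖fderiv ℝ F (x, om k x) (0, mollify k Γ x e - Γ x e)‖ ≤
        C * (‖(Γ - mollify k Γ) x‖ * ‖e‖) := by
      refine (ContinuousLinearMap.le_opNorm _ _).trans ?_
      gcongr
      · exact hC _
      · rw [Prod.norm_mk, norm_zero, max_eq_right (norm_nonneg _), ← _root_.sub_apply,
          Pi.sub_apply, norm_sub_rev (Γ x)]
        exact ContinuousLinearMap.le_opNorm _ _
    calc _ ≤ ‖ψ x‖ * (C * (‖(Γ - mollify k Γ) x‖ * ‖e‖)) := by gcongr
      _ = _ := by ring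
  have lim4 := lim3.add lim2
  simp only [sub_add_cancel, zero_add] at lim4
  have lim5 := lim1
  simp only [ibp] at lim5
  have key := tendsto_nhds_unique lim5 lim4.neg
  have r1 : ∫ x, fderiv ℝ ψ x e • F (x, u x) = ∫ x, fderiv ℝ ψ x e • F (x, w x) := by
    refine integral_congr_ae (Eventually.of_forall fun x => ?_)
    by_cases hx : x ∈ tsupport ψ
    · simp only [hwu x hx]
    · have : fderiv ℝ ψ x = 0 :=
        image_eq_zero_of_notMem_tsupport fun h => hx (tsupport_fderiv_subset ℝ h)
      simp [this]
  have r2 : ∫ x, ψ x • compDeriv F u G x e = ∫ x, ψ x • fderiv ℝ F (x, w x) (e, Γ x e) := by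
    refine integral_congr_ae (Eventually.of_forall fun x => ?_)
    by_cases hx : x ∈ tsupport ψ
    · simp only [hwu x hx, hΓG x hx, compDeriv_apply]
    · simp [image_eq_zero_of_notMem_tsupport hx]
  rw [r1, r2, key]

/-- A Sobolev function that vanishes outside a compact subset of `Ω` belongs to `H¹₀(Ω)`. -/
lemma HasWeakDeriv.memH10 (hΩ : IsOpen Ω) {w : E s → E n} {G : E s → E s →L[ℝ] E n}
    (h : HasWeakDeriv Ω w G) (hw : MemLp w 2 (volume.restrict Ω))
    (hG : MemLp G 2 (volume.restrict Ω)) {K : Set (E s)} (hK : IsCompact K) (hKΩ : K ⊆ Ω)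
    (hwK : ∀ x ∉ K, w x = 0) : MemH10 Ω w := by
  refine ⟨h.memW1 hΩ hw hG, ?_⟩
  obtain ⟨θ, hθ, hθ1, -⟩ := exists_testFunction_eq_one hΩ hK hKΩ
  set Γ : E s → E s →L[ℝ] E n := fun x => θ x • G x + (fderiv ℝ θ x).smulRight (w x) with hΓ
  have hθw : (fun x => θ x • w x) = w := by
    funext x
    by_cases hx : x ∈ K
    · rw [hθ1.self_of_nhdsSet x hx, one_smul]
    · rw [hwK x hx, smul_zero]
  have hwΓ : HasWeakDeriv univ w Γ := by
    have := h.testFunction_smul hθ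
    rwa [hθw] at this
  have hw2 : MemLp w 2 := by
    have := memLp_testFunction_smul hΩ hw hθ
    rwa [hθw] at this
  have hΓ2 : MemLp Γ 2 :=
    (memLp_testFunction_smul hΩ hG hθ).add (memLp_fderiv_smulRight hΩ hw hθ)
  have hwl : LocallyIntegrable w := hw2.locallyIntegrable (by norm_num)
  have hts : tsupport w ⊆ K := closure_minimal (fun x hx => by
    by_contra h; exact hx (hwK x h)) hK.isClosed
  -- `Γ` is the weak derivative of `w` on the whole space, so its mollifications are derivatives of
  -- the approximants.
  have hwd : weakDeriv Ω w =ᵐ[volume.restrict Ω] Γ := by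
    refine HasWeakDeriv.weakDeriv_ae_eq hΩ (hasWeakDeriv_of_integral h.1
      (hwΓ.2.1.mono_set (subset_univ _)) fun φ hφ e =>
        hwΓ.integral_eq ⟨hφ.1, hφ.2.1, subset_univ _⟩ e)
  obtain ⟨ε, hε, hεΩ⟩ := hK.exists_cthickening_subset_open hΩ hKΩ
  -- Discarding the first `N` mollifications keeps all supports inside a compact thickening of `K`
  -- contained in `Ω`.
  obtain ⟨N, hN⟩ := (((Metric.tendsto_atTop.1 (tendsto_stdBump_rOut (s := s))) ε hε))
  have hsupp : ∀ k, tsupport (mollify (k + N) w) ⊆ Metric.cthickening ε K := by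
    intro k
    refine closure_minimal ((support_mollify_subset _).trans ?_) Metric.isClosed_cthickening
    refine (Metric.cthickening_mono ?_ _).trans (Metric.cthickening_subset_of_subset ε hts)
    have := hN (k + N) (Nat.le_add_left _ _)
    rw [Real.dist_eq, sub_zero] at this
    exact (le_abs_self _).trans this.le
  refine ⟨fun k => mollify (k + N) w, fun k => ⟨contDiff_mollify hwl _, ?_, (hsupp k).trans hεΩ⟩,
    ?_, ?_⟩
  · exact (hK.cthickening).of_isClosed_subset (isClosed_tsupport _) (hsupp k)
  · refine tendsto_of_tendsto_of_tendsto_of_le_of_le tendsto_const_nhds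
      ((tendsto_mollify_sub hw2).comp (tendsto_add_atTop_nat N)) (fun k => zero_le) fun k => ?_
    exact eLpNorm_mono_measure _ Measure.restrict_le_self
  · refine tendsto_of_tendsto_of_tendsto_of_le_of_le tendsto_const_nhds
      ((tendsto_mollify_sub hΓ2).comp (tendsto_add_atTop_nat N)) (fun k => zero_le) fun k => ?_
    rw [fderiv_mollify hwΓ]
    rw [eLpNorm_congr_ae (hwd.sub (EventuallyEq.refl _ (mollify (k + N) Γ)))]
    exact eLpNorm_mono_measure _ Measure.restrict_le_self

end ChainRule

/-! ### The Dirichlet energy as a squared Hilbert norm -/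

section Energy

variable {s n : ℕ} {Ω : Set (E s)}

/-- The columns of a linear map, as a vector whose Euclidean norm is the Frobenius norm. -/
def columns (s n : ℕ) : (E s →L[ℝ] E n) →L[ℝ] PiLp 2 (fun _ : Fin s => E n) :=
  (PiLp.continuousLinearEquiv 2 ℝ (fun _ : Fin s => E n)).symm.toContinuousLinearMap.comp
    (ContinuousLinearMap.pi fun i =>
      ContinuousLinearMap.apply ℝ (E n) (EuclideanSpace.single i (1 : ℝ)))

/-- The Frobenius inner product. -/
def frobInner (S T : E s →L[ℝ] E n) : ℝ :=
  ∑ i : Fin s, inner ℝ (S (EuclideanSpace.single i 1)) (T (EuclideanSpace.single i 1))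

lemma inner_columns (S T : E s →L[ℝ] E n) : inner ℝ (columns s n S) (columns s n T) =
    frobInner S T := by
  rw [PiLp.inner_apply]; rfl

lemma norm_columns (T : E s →L[ℝ] E n) : ‖columns s n T‖ = frobNorm T := by
  rw [PiLp.norm_eq_of_L2]; rfl

lemma frobNorm_nonneg (T : E s →L[ℝ] E n) : 0 ≤ frobNorm T := Real.sqrt_nonneg _

lemma frobNorm_sq (T : E s →L[ℝ] E n) :
    frobNorm T ^ 2 = ∑ i : Fin s, ‖T (EuclideanSpace.single i 1)‖ ^ 2 :=
  Real.sq_sqrt (Finset.sum_nonneg fun _ _ => sq_nonneg _)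

lemma abs_frobInner_le (S T : E s →L[ℝ] E n) : |frobInner S T| ≤ frobNorm S * frobNorm T := by
  rw [← inner_columns, ← norm_columns, ← norm_columns]
  exact abs_real_inner_le_norm _ _

lemma eq_sum_single (x : E s) : x = ∑ i, x i • EuclideanSpace.single i (1 : ℝ) := by
  simpa using ((EuclideanSpace.basisFun (Fin s) ℝ).sum_repr x).symm

lemma memLp_columns {α : Type*} [MeasurableSpace α] {μ : Measure α} {p : ℝ≥0∞}
    {G : α → E s →L[ℝ] E n} (hG : MemLp G p μ) : MemLp (fun x => columns s n (G x)) p μ :=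
  (columns s n).comp_memLp' hG

lemma memLp_frobNorm {α : Type*} [MeasurableSpace α] {μ : Measure α} {p : ℝ≥0∞}
    {G : α → E s →L[ℝ] E n} (hG : MemLp G p μ) : MemLp (fun x => frobNorm (G x)) p μ := by
  refine (memLp_columns hG).norm.ae_eq (Eventually.of_forall fun x => ?_)
  exact norm_columns _

lemma integrable_frobInner {α : Type*} [MeasurableSpace α] {μ : Measure α}
    {G H : α → E s →L[ℝ] E n} (hG : MemLp G 2 μ) (hH : MemLp H 2 μ) :
    Integrable (fun x => frobInner (G x) (H x)) μ := by
  have h := (memLp_frobNorm hG).integrable_mul (memLp_frobNorm hH)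
  refine h.mono' ?_ (Eventually.of_forall fun x => abs_frobInner_le _ _)
  refine AEStronglyMeasurable.congr ((memLp_columns hG).aestronglyMeasurable.inner (𝕜 := ℝ)
    (memLp_columns hH).aestronglyMeasurable) (Eventually.of_forall fun x => inner_columns _ _)

/-- The class of a matrix field in the Hilbert space of square integrable matrix fields. -/
def toL2 {α : Type*} [MeasurableSpace α] {μ : Measure α} {G : α → E s →L[ℝ] E n}
    (hG : MemLp G 2 μ) : Lp (PiLp 2 (fun _ : Fin s => E n)) 2 μ :=
  (memLp_columns hG).toLp

lemma inner_toL2 {α : Type*} [MeasurableSpace α] {μ : Measure α}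
    {G H : α → E s →L[ℝ] E n} (hG : MemLp G 2 μ) (hH : MemLp H 2 μ) :
    inner ℝ (toL2 hG) (toL2 hH) = ∫ x, frobInner (G x) (H x) ∂μ := by
  rw [L2.inner_def]
  refine integral_congr_ae ?_
  filter_upwards [(memLp_columns hG).coeFn_toLp, (memLp_columns hH).coeFn_toLp] with x h1 h2
  rw [toL2, toL2, h1, h2, inner_columns]

lemma norm_toL2_sq {α : Type*} [MeasurableSpace α] {μ : Measure α}
    {G : α → E s →L[ℝ] E n} (hG : MemLp G 2 μ) :
    ‖toL2 hG‖ ^ 2 = ∫ x, frobNorm (G x) ^ 2 ∂μ := by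
  rw [← real_inner_self_eq_norm_sq, inner_toL2]
  refine integral_congr_ae (Eventually.of_forall fun x => ?_)
  simp only [← inner_columns, ← norm_columns, real_inner_self_eq_norm_sq]

lemma enorm_toL2_le {α : Type*} [MeasurableSpace α] {μ : Measure α}
    {G : α → E s →L[ℝ] E n} (hG : MemLp G 2 μ) :
    ‖toL2 hG‖ₑ ≤ ENNReal.ofReal ‖columns s n‖ * eLpNorm G 2 μ := by
  rw [toL2, Lp.enorm_toLp]
  exact eLpNorm_le_mul_eLpNorm_of_ae_le_mul
    (Eventually.of_forall fun x => (columns s n).le_opNorm (G x)) 2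

lemma toL2_congr {α : Type*} [MeasurableSpace α] {μ : Measure α}
    {G H : α → E s →L[ℝ] E n} (hG : MemLp G 2 μ) (hH : MemLp H 2 μ) (h : G =ᵐ[μ] H) :
    toL2 hG = toL2 hH :=
  MemLp.toLp_congr _ _ (h.mono fun x hx => by simp only [hx])

lemma toL2_sub {α : Type*} [MeasurableSpace α] {μ : Measure α}
    {G H : α → E s →L[ℝ] E n} (hG : MemLp G 2 μ) (hH : MemLp H 2 μ) :
    toL2 (hG.sub hH) = toL2 hG - toL2 hH := by
  rw [toL2, toL2, toL2, ← MemLp.toLp_sub]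
  exact MemLp.toLp_congr _ _ (Eventually.of_forall fun x => map_sub _ _ _)

lemma toL2_const_smul {α : Type*} [MeasurableSpace α] {μ : Measure α}
    {G : α → E s →L[ℝ] E n} (hG : MemLp G 2 μ) (c : ℝ) :
    toL2 (hG.const_smul c) = c • toL2 hG := by
  rw [toL2, toL2, ← MemLp.toLp_const_smul]
  exact MemLp.toLp_congr _ _ (Eventually.of_forall fun x => map_smul (columns s n) c (G x))

lemma MemW1.sub (hΩ : IsOpen Ω) {p : ℝ≥0∞} {v w : E s → E n} (hv : MemW1 p Ω v)
    (hw : MemW1 p Ω w) : MemW1 p Ω (v - w) :=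
  (hv.hasWeakDeriv.sub hw.hasWeakDeriv).memW1 hΩ (hv.2.1.sub hw.2.1) (hv.2.2.sub hw.2.2)

lemma memLp_add {α V : Type*} [MeasurableSpace α] {μ : Measure α} [NormedAddCommGroup V]
    {p : ℝ≥0∞} {f g : α → V} (hf : MemLp f p μ) (hg : MemLp g p μ) : MemLp (f + g) p μ :=
  hf.add hg

lemma MemW1.add (hΩ : IsOpen Ω) {p : ℝ≥0∞} {v w : E s → E n} (hv : MemW1 p Ω v)
    (hw : MemW1 p Ω w) : MemW1 p Ω (v + w) :=
  (hv.hasWeakDeriv.add hw.hasWeakDeriv).memW1 hΩ (memLp_add hv.2.1 hw.2.1) (memLp_add hv.2.2 hw.2.2)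

lemma MemW1.const_smul (hΩ : IsOpen Ω) {p : ℝ≥0∞} {v : E s → E n} (hv : MemW1 p Ω v) (c : ℝ) :
    MemW1 p Ω (c • v) :=
  (hv.hasWeakDeriv.const_smul c).memW1 hΩ (hv.2.1.const_smul c) (hv.2.2.const_smul c)

/-- The class of the weak derivative in `L²`. -/
def gradL2 {w : E s → E n} (hw : MemW1 2 Ω w) :
    Lp (PiLp 2 (fun _ : Fin s => E n)) 2 (volume.restrict Ω) := toL2 hw.2.2

lemma gradL2_sub (hΩ : IsOpen Ω) {v w : E s → E n} (hv : MemW1 2 Ω v)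
    (hw : MemW1 2 Ω w) : gradL2 (hv.sub hΩ hw) = gradL2 hv - gradL2 hw := by
  rw [gradL2, gradL2, gradL2, ← toL2_sub]
  exact toL2_congr _ _ ((hv.hasWeakDeriv.sub hw.hasWeakDeriv).weakDeriv_ae_eq hΩ)

lemma gradL2_const_smul (hΩ : IsOpen Ω) {v : E s → E n} (hv : MemW1 2 Ω v) (c : ℝ) :
    gradL2 (hv.const_smul hΩ c) = c • gradL2 hv := by
  rw [gradL2, gradL2, ← toL2_const_smul]
  exact toL2_congr _ _ ((hv.hasWeakDeriv.const_smul c).weakDeriv_ae_eq hΩ)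

lemma h1SeminormSq_eq {w : E s → E n} (hw : MemW1 2 Ω w) :
    h1SeminormSq Ω w = ‖gradL2 hw‖ ^ 2 := (norm_toL2_sq _).symm

/-- The first variation of the harmonic energy. -/
lemma IsVariation.hasDerivAt_harmonicEnergy (hΩ : IsOpen Ω) {H : Set (E s → E n)}
    (hH : ∀ v ∈ H, MemW1 2 Ω v) {u : E s → E n} (hu : MemW1 2 Ω u) {c : ℝ → E s → E n}
    (hc0 : c 0 = u) (hcH : ∀ t, c t ∈ H) {ξ : E s → E n} (hξ : MemW1 2 Ω ξ)
    (hlim : Tendsto (fun t : ℝ => eLpNorm (weakDeriv Ω (t⁻¹ • (c t - u) - ξ)) 2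
      (volume.restrict Ω)) (𝓝[≠] 0) (𝓝 0)) :
    HasDerivAt (fun t => harmonicEnergy Ω (c t))
      (∫ x in Ω, frobInner (weakDeriv Ω u x) (weakDeriv Ω ξ x)) 0 := by
  subst hc0
  set γ := fun t => gradL2 (hH _ (hcH t)) with hγ
  have hd : HasDerivAt γ (gradL2 hξ) 0 := by
    rw [hasDerivAt_iff_tendsto_slope, tendsto_iff_norm_sub_tendsto_zero]
    -- By linearity of the weak derivative, the `H¹` difference quotient of the family becomes that
    -- of a curve in `L²`; the energy is then differentiated as a squared norm.
    have key : ∀ t : ℝ, slope γ 0 t - gradL2 hξ =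
        gradL2 ((((hH _ (hcH t)).sub hΩ (hH _ (hcH 0))).const_smul hΩ t⁻¹).sub hΩ hξ) := by
      intro t
      rw [gradL2_sub hΩ (((hH _ (hcH t)).sub hΩ (hH _ (hcH 0))).const_smul hΩ t⁻¹) hξ,
        gradL2_const_smul hΩ ((hH _ (hcH t)).sub hΩ (hH _ (hcH 0))),
        gradL2_sub hΩ (hH _ (hcH t)) (hH _ (hcH 0)), slope_def_module, sub_zero]
    simp only [key]
    have hb : ∀ t : ℝ, ‖gradL2
        ((((hH _ (hcH t)).sub hΩ (hH _ (hcH 0))).const_smul hΩ t⁻¹).sub hΩ hξ)‖ₑ ≤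
        ENNReal.ofReal ‖columns s n‖ * eLpNorm (weakDeriv Ω (t⁻¹ • (c t - c 0) - ξ)) 2
          (volume.restrict Ω) := fun t => enorm_toL2_le _
    rw [← tendsto_zero_iff_norm_tendsto_zero, tendsto_zero_iff_enorm_tendsto_zero]
    have h5 := ENNReal.Tendsto.const_mul (a := ENNReal.ofReal ‖columns s n‖) hlim
      (Or.inr ENNReal.ofReal_ne_top)
    rw [mul_zero] at h5
    exact tendsto_of_tendsto_of_tendsto_of_le_of_le tendsto_const_nhds h5
      (fun k => zero_le) hb
  have h2 := (hd.norm_sq).const_mul (1 / 2 : ℝ)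
  have h3 : (fun t => harmonicEnergy Ω (c t)) = fun t => (1 / 2) * ‖γ t‖ ^ 2 := by
    funext t
    rw [harmonicEnergy, h1SeminormSq_eq (hH _ (hcH t))]
  rw [h3]
  refine h2.congr_deriv ?_
  rw [hγ]
  simp only
  rw [gradL2, gradL2, inner_toL2]
  ring

end Energy

/-! ### Expansions uniform in the spatial variable -/

section Variation

variable {s n : ℕ} {Ω : Set (E s)}

/-- Mean value inequality for `τ ↦ H (τ, z) - τ • ∂ₜH (0, z)`. Compact support makes `DH` uniformly
continuous, hence `δ` is independent of `z`. -/
lemma exists_forall_norm_sub_smul_le {Z V : Type*} [NormedAddCommGroup Z] [NormedSpace ℝ Z]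
    [NormedAddCommGroup V] [NormedSpace ℝ V] {H : ℝ × Z → V} (hH : ContDiff ℝ 1 H)
    (hc : HasCompactSupport H) (h0 : ∀ z, H (0, z) = 0) {ε : ℝ} (hε : 0 < ε) :
    ∃ δ > 0, ∀ t : ℝ, |t| < δ → ∀ z, ‖H (t, z) - t • fderiv ℝ H (0, z) (1, 0)‖ ≤ ε * |t| := by
  have huc : UniformContinuous (fderiv ℝ H) :=
    (hc.fderiv ℝ).uniformContinuous_of_continuous (hH.continuous_fderiv (by simp))
  obtain ⟨δ, hδ, hu⟩ := Metric.uniformContinuous_iff.1 huc ε hε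
  refine ⟨δ, hδ, fun t ht z => ?_⟩
  have hd : ∀ τ : ℝ, HasDerivAt (fun τ : ℝ => H (τ, z) - τ • fderiv ℝ H (0, z) (1, 0))
      (fderiv ℝ H (τ, z) (1, 0) - fderiv ℝ H (0, z) (1, 0)) τ := by
    intro τ
    have h1 := (hH.differentiable (by simp) (τ, z)).hasFDerivAt.comp_hasDerivAt τ
      ((hasDerivAt_id τ).prodMk (hasDerivAt_const τ z))
    have h2 := (hasDerivAt_id τ).smul_const (fderiv ℝ H (0, z) (1, 0))
    rw [one_smul] at h2
    exact h1.sub h2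
  have hb : ∀ τ ∈ Metric.ball (0 : ℝ) δ,
      ‖fderiv ℝ H (τ, z) (1, 0) - fderiv ℝ H (0, z) (1, 0)‖ ≤ ε := by
    intro τ hτ
    rw [← _root_.sub_apply]
    refine (ContinuousLinearMap.le_opNorm _ _).trans ?_
    have h1 : ‖((1 : ℝ), (0 : Z))‖ = 1 := by simp [Prod.norm_mk]
    rw [h1, mul_one, ← dist_eq_norm]
    refine (hu ?_).le
    rw [Prod.dist_eq, dist_self, max_eq_left dist_nonneg]
    exact hτ
  have := (convex_ball (0 : ℝ) δ).norm_image_sub_le_of_norm_hasDerivWithin_le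
    (fun τ _ => (hd τ).hasDerivWithinAt) hb (Metric.mem_ball_self hδ)
    (by rwa [mem_ball_zero_iff, Real.norm_eq_abs] : t ∈ Metric.ball (0 : ℝ) δ)
  simpa [h0] using this

/-- Uniform differentiability in the parameter, for the map and for its spatial derivative. -/
lemma exists_forall_variation_remainder_le {Z V : Type*} [NormedAddCommGroup Z] [NormedSpace ℝ Z]
    [NormedAddCommGroup V] [NormedSpace ℝ V] {F : ℝ × Z → V} (hF : ContDiff ℝ 2 F)
    (hc : HasCompactSupport F) (h0 : ∀ z, F (0, z) = 0) {ε : ℝ} (hε : 0 < ε) :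
    ∃ δ > 0, ∀ t : ℝ, t ≠ 0 → |t| < δ → ∀ z,
      ‖t⁻¹ • F (t, z) - fderiv ℝ F (0, z) (1, 0)‖ ≤ ε ∧
      ‖fderiv ℝ (fun z => t⁻¹ • F (t, z) - fderiv ℝ F (0, z) (1, 0)) z‖ ≤ ε := by
  have hF1 : ContDiff ℝ 1 F := hF.of_le (by norm_num)
  have hdF : ContDiff ℝ 1 (fderiv ℝ F) := hF.fderiv_right (by norm_num)
  -- `H` is the spatial derivative of `F`. It is again `C¹` and vanishes at time zero, so the same
  -- expansion applies to it.
  set H : ℝ × Z → Z →L[ℝ] V := fun p => (fderiv ℝ F p).comp (ContinuousLinearMap.inr ℝ ℝ Z)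
    with hH
  have hHc1 : ContDiff ℝ 1 H := hdF.clm_comp contDiff_const
  have hHc : HasCompactSupport H := (hc.fderiv ℝ).mono fun p hp hp' => hp (by
    simp only [hH, hp', ContinuousLinearMap.zero_comp])
  have hslice : ∀ t z, HasFDerivAt (fun z => F (t, z)) (H (t, z)) z := fun t z =>
    (hF1.differentiable (by simp) (t, z)).hasFDerivAt.comp z (hasFDerivAt_prodMk_right t z)
  have hH0 : ∀ z, H (0, z) = 0 := by
    intro z
    have h1 := hslice 0 z
    simp only [h0] at h1
    exact h1.unique (hasFDerivAt_const 0 z)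
  obtain ⟨δ1, hδ1, h1⟩ := exists_forall_norm_sub_smul_le hF1 hc h0 hε
  obtain ⟨δ2, hδ2, h2⟩ := exists_forall_norm_sub_smul_le hHc1 hHc hH0 hε
  refine ⟨min δ1 δ2, lt_min hδ1 hδ2, fun t ht0 ht z => ⟨?_, ?_⟩⟩
  · have h3 := h1 t (ht.trans_le (min_le_left _ _)) z
    have h4 : t⁻¹ • F (t, z) - fderiv ℝ F (0, z) (1, 0) =
        t⁻¹ • (F (t, z) - t • fderiv ℝ F (0, z) (1, 0)) := by
      rw [smul_sub, inv_smul_smul₀ ht0]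
    rw [h4, norm_smul, norm_inv, Real.norm_eq_abs, inv_mul_le_iff₀ (abs_pos.2 ht0), mul_comm]
    exact h3
  · have h3 := h2 t (ht.trans_le (min_le_right _ _)) z
    have hG : HasFDerivAt (fun z => fderiv ℝ F (0, z) (1, 0)) (fderiv ℝ H (0, z) (1, 0)) z := by
      have h5 := ((hdF.differentiable (by simp) (0, z)).hasFDerivAt.comp z
        (hasFDerivAt_prodMk_right (0 : ℝ) z)).clm_apply (hasFDerivAt_const ((1 : ℝ), (0 : Z)) z)
      refine h5.congr_fderiv ?_
      have h6 : HasFDerivAt H _ (0, z) :=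
        (hdF.differentiable (by simp) (0, z)).hasFDerivAt.clm_comp
          (hasFDerivAt_const (ContinuousLinearMap.inr ℝ ℝ Z) ((0 : ℝ), z))
      rw [h6.fderiv]
      ext1 v
      -- Symmetry of the mixed derivatives identifies the velocity of `H` with the spatial
      -- derivative of the velocity of `F`.
      have hsym := (hF.contDiffAt (x := ((0 : ℝ), z))).isSymmSndFDerivAt (by simp)
        ((0 : ℝ), v) ((1 : ℝ), (0 : Z))
      simpa using hsym
    have hR : HasFDerivAt (fun z => t⁻¹ • F (t, z) - fderiv ℝ F (0, z) (1, 0))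
        (t⁻¹ • H (t, z) - fderiv ℝ H (0, z) (1, 0)) z :=
      ((hslice t z).const_smul t⁻¹).sub hG
    rw [hR.fderiv]
    have h4 : t⁻¹ • H (t, z) - fderiv ℝ H (0, z) (1, 0) =
        t⁻¹ • (H (t, z) - t • fderiv ℝ H (0, z) (1, 0)) := by
      rw [smul_sub, inv_smul_smul₀ ht0]
    rw [h4, norm_smul, norm_inv, Real.norm_eq_abs, inv_mul_le_iff₀ (abs_pos.2 ht0), mul_comm]
    exact h3

lemma hasCompactSupport_slice {Z V : Type*} [NormedAddCommGroup Z]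
    [NormedAddCommGroup V] {F : ℝ × Z → V}
    (hc : HasCompactSupport F) (t : ℝ) : HasCompactSupport (fun z => F (t, z)) :=
  HasCompactSupport.intro (hc.isCompact.image continuous_snd) fun z hz => by
    by_contra h
    exact hz ⟨(t, z), subset_tsupport _ h, rfl⟩

end Variation

/-! ### Criticality tested with smooth deformations -/

section CriticalPoint

variable {s n : ℕ} {Ω : Set (E s)}

lemma tendsto_zero_of_eventually_le_ofReal_mul {ι : Type*} {l : Filter ι} {f : ι → ℝ≥0∞}
    {A : ℝ≥0∞} (hA : A ≠ ⊤) (h : ∀ ε : ℝ, 0 < ε → ∀ᶠ t in l, f t ≤ ENNReal.ofReal ε * A) :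
    Tendsto f l (𝓝 0) := by
  rw [ENNReal.tendsto_nhds_zero]
  intro e he
  have h1 : Tendsto (fun ε : ℝ => ENNReal.ofReal ε * A) (𝓝[>] 0) (𝓝 0) := by
    have h2 : Tendsto (fun ε : ℝ => ENNReal.ofReal ε * A) (𝓝 0) (𝓝 (ENNReal.ofReal 0 * A)) :=
      ENNReal.Tendsto.mul_const (ENNReal.continuous_ofReal.tendsto 0) (Or.inr hA)
    rw [ENNReal.ofReal_zero, zero_mul] at h2
    exact h2.mono_left nhdsWithin_le_nhds
  obtain ⟨ε, h3, h4⟩ := ((ENNReal.tendsto_nhds_zero.1 h1 e he).and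
    self_mem_nhdsWithin).exists
  filter_upwards [h ε h4] with t ht using ht.trans h3

lemma eLpNorm_le_ofReal_mul {α V : Type*} [MeasurableSpace α] {μ : Measure α}
    [NormedAddCommGroup V] {p : ℝ≥0∞} {f : α → V} {g : α → ℝ} {ε : ℝ}
    (h : ∀ᵐ x ∂μ, ‖f x‖ ≤ ε * ‖g x‖) :
    eLpNorm f p μ ≤ ENNReal.ofReal ε * eLpNorm g p μ :=
  eLpNorm_le_mul_eLpNorm_of_ae_le_mul h p

lemma memLp_zero_fun {α V : Type*} [MeasurableSpace α] {μ : Measure α} [NormedAddCommGroup V]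
    {p : ℝ≥0∞} : MemLp (0 : α → V) p μ :=
  MemLp.zero

lemma memH10_zero (hΩ : IsOpen Ω) : MemH10 Ω (0 : E s → E n) :=
  hasWeakDeriv_zero.memH10 hΩ memLp_zero_fun memLp_zero_fun isCompact_empty (empty_subset _)
    fun _ _ => rfl

/-- The Euler–Lagrange equation of a critical point, tested with the velocity of a smooth family
of deformations of the graph. -/
lemma integral_frobInner_compDeriv_eq_zero [IsFiniteMeasure (volume.restrict Ω)] (hΩ : IsOpen Ω)
    {M : Set (E n)} {u : E s → E n} (hu : MemW1Into 2 Ω M u)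
    (hcrit : IsCriticalPoint Ω (H1Boundary Ω M u) (harmonicEnergy Ω) u)
    {F : ℝ × (E s × E n) → E n} (hF : ContDiff ℝ 2 F) (hFc : HasCompactSupport F)
    (h0 : ∀ z, F (0, z) = 0) {K : Set (E s)} (hK : IsCompact K) (hKΩ : K ⊆ Ω)
    (hFK : ∀ t x y, x ∉ K → F (t, (x, y)) = 0)
    (hM : ∀ᵐ x ∂volume.restrict Ω, ∀ t, u x + F (t, (x, u x)) ∈ M) :
    ∫ x in Ω, frobInner (weakDeriv Ω u x)
      (compDeriv (fun z => fderiv ℝ F (0, z) (1, 0)) u (weakDeriv Ω u) x) = 0 := by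
  have hu1 := hu.1
  have hum := hu1.2.1.aestronglyMeasurable
  have hdu := hu1.hasWeakDeriv
  set G : E s × E n → E n := fun z => fderiv ℝ F (0, z) (1, 0) with hG
  have hG1 : ContDiff ℝ 1 G :=
    ((hF.fderiv_right (m := 1) (by norm_num)).comp
      (contDiff_prodMk_right (0 : ℝ))).clm_apply contDiff_const
  have hGc : HasCompactSupport G :=
    (hasCompactSupport_slice (hFc.fderiv ℝ) 0).mono fun z hz hz' => hz (by
      simp only [hG]; rw [show fderiv ℝ F (0, z) = 0 from hz']; rfl)
  have hFt1 : ∀ t, ContDiff ℝ 1 (fun z => F (t, z)) := fun t =>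
    (hF.of_le (by norm_num)).comp (contDiff_prodMk_right t)
  have hFtc : ∀ t, HasCompactSupport (fun z => F (t, z)) := hasCompactSupport_slice hFc
  set f : ℝ → E s → E n := fun t x => F (t, (x, u x)) with hf
  have hfd : ∀ t, HasWeakDeriv Ω (f t) (compDeriv (fun z => F (t, z)) u (weakDeriv Ω u)) :=
    fun t => hdu.comp hΩ (hFt1 t) (hFtc t) hu1.2.1 hu1.2.2
  have hfL : ∀ t, MemLp (f t) 2 (volume.restrict Ω) := fun t => memLp_comp (hFt1 t) (hFtc t) hum
  have hfdL : ∀ t, MemLp (compDeriv (fun z => F (t, z)) u (weakDeriv Ω u)) 2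
      (volume.restrict Ω) := fun t => memLp_compDeriv (hFt1 t) (hFtc t) hum hu1.2.2
  have hf1 : ∀ t, MemW1 2 Ω (f t) := fun t => (hfd t).memW1 hΩ (hfL t) (hfdL t)
  set c : ℝ → E s → E n := fun t => u + f t with hc
  have hcsub : ∀ t, c t - u = f t := fun t => add_sub_cancel_left u (f t)
  have hcH : ∀ t, c t ∈ H1Boundary Ω M u := by
    intro t
    refine ⟨⟨hu1.add hΩ (hf1 t), ?_⟩, ?_⟩
    · filter_upwards [hM] with x hx using hx t
    · rw [hcsub]
      exact (hfd t).memH10 hΩ (hfL t) (hfdL t) hK hKΩ fun x hx => hFK t x _ hx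
  have hc0 : c 0 = u := by
    funext x; simp [hc, hf, h0]
  set ξ : E s → E n := fun x => G (x, u x) with hξ
  have hξd : HasWeakDeriv Ω ξ (compDeriv G u (weakDeriv Ω u)) :=
    hdu.comp hΩ hG1 hGc hu1.2.1 hu1.2.2
  have hξL : MemLp ξ 2 (volume.restrict Ω) := memLp_comp hG1 hGc hum
  have hξdL : MemLp (compDeriv G u (weakDeriv Ω u)) 2 (volume.restrict Ω) :=
    memLp_compDeriv hG1 hGc hum hu1.2.2
  have hξ1 : MemW1 2 Ω ξ := hξd.memW1 hΩ hξL hξdL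
  -- One majorant serves both limits: a remainder that is uniformly `ε`-small in `C¹`, composed with
  -- `x ↦ (x, u x)`, has value and weak derivative bounded by `ε (1 + ‖du‖)`.
  have hA : MemLp (fun x => 1 * (1 + ‖weakDeriv Ω u x‖)) 2 (volume.restrict Ω) :=
    memLp_one_add_norm hu1.2.2 1
  have hrem : ∀ ε : ℝ, 0 < ε → ∀ᶠ t in 𝓝[≠] (0 : ℝ), ∀ z,
      ‖t⁻¹ • F (t, z) - G z‖ ≤ ε ∧ ‖fderiv ℝ (fun z => t⁻¹ • F (t, z) - G z) z‖ ≤ ε := by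
    intro ε hε
    obtain ⟨δ, hδ, h⟩ := exists_forall_variation_remainder_le hF hFc h0 hε
    filter_upwards [self_mem_nhdsWithin, nhdsWithin_le_nhds (Metric.ball_mem_nhds (0 : ℝ) hδ)]
      with t ht0 ht
    exact h t ht0 (by simpa using ht)
  have hlim1 : Tendsto (fun t : ℝ => eLpNorm (t⁻¹ • (c t - u) - ξ) 2 (volume.restrict Ω))
      (𝓝[≠] 0) (𝓝 0) := by
    refine tendsto_zero_of_eventually_le_ofReal_mul hA.eLpNorm_ne_top fun ε hε => ?_
    filter_upwards [hrem ε hε] with t ht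
    refine eLpNorm_le_ofReal_mul (Eventually.of_forall fun x => ?_)
    rw [hcsub, one_mul, Real.norm_of_nonneg (by positivity)]
    refine (ht (x, u x)).1.trans ?_
    nlinarith [norm_nonneg (weakDeriv Ω u x)]
  have hlim2 : Tendsto (fun t : ℝ => eLpNorm (weakDeriv Ω (t⁻¹ • (c t - u) - ξ)) 2
      (volume.restrict Ω)) (𝓝[≠] 0) (𝓝 0) := by
    refine tendsto_zero_of_eventually_le_ofReal_mul hA.eLpNorm_ne_top fun ε hε => ?_
    filter_upwards [hrem ε hε] with t ht
    have hR1 : ContDiff ℝ 1 (fun z => t⁻¹ • F (t, z) - G z) := ((hFt1 t).const_smul t⁻¹).sub hG1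
    have hRc : HasCompactSupport (fun z => t⁻¹ • F (t, z) - G z) :=
      HasCompactSupport.sub ((hFtc t).smul_left (f := fun _ => t⁻¹)) hGc
    have hd : HasWeakDeriv Ω (t⁻¹ • (c t - u) - ξ)
        (compDeriv (fun z => t⁻¹ • F (t, z) - G z) u (weakDeriv Ω u)) := by
      rw [hcsub]
      exact hdu.comp hΩ hR1 hRc hu1.2.1 hu1.2.2
    refine eLpNorm_le_ofReal_mul ?_
    filter_upwards [hd.weakDeriv_ae_eq hΩ] with x hx
    rw [hx, one_mul, Real.norm_of_nonneg (by positivity)]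
    exact norm_compDeriv_le (ht (x, u x)).2
  have hvar : IsVariation Ω (H1Boundary Ω M u) u c := by
    refine ⟨hc0, hcH, ξ, hξ1, ?_⟩
    simpa using hlim1.add hlim2
  have hd1 := hcrit c hvar
  have hd2 := IsVariation.hasDerivAt_harmonicEnergy hΩ (H := H1Boundary Ω M u)
    (fun v hv => hv.1.1) hu1 hc0 hcH hξ1 hlim2
  rw [hd1.unique hd2]
  refine integral_congr_ae ?_
  filter_upwards [hξd.weakDeriv_ae_eq hΩ] with x hx
  rw [hx]

end CriticalPoint

/-! ### Cutoffs in the target space -/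

section Cutoff

variable {n : ℕ}

/-- Cutoff functions for a closed set inside an open set. -/
lemma exists_cutoff_seq {U C : Set (E n)} (hU : IsOpen U) (hC : IsClosed C) (hCU : C ⊆ U) :
    ∃ η : ℕ → E n → ℝ, (∀ k, IsTestFunction U (η k)) ∧ ∃ C₀ : ℝ, ∀ y ∈ C,
      (∀ k, |η k y| ≤ 1) ∧ (∀ k, ‖fderiv ℝ (η k) y‖ ≤ C₀) ∧
      Tendsto (fun k => η k y) atTop (𝓝 1) ∧ Tendsto (fun k => fderiv ℝ (η k) y) atTop (𝓝 0) := by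
  let b : ContDiffBump (0 : E n) := ⟨1, 2, one_pos, one_lt_two⟩
  obtain ⟨C₁, hC₁⟩ := (b.hasCompactSupport.fderiv ℝ).exists_bound_of_continuous
    ((b.contDiff (n := 1)).continuous_fderiv (by simp))
  have hex : ∀ k : ℕ, ∃ χ : E n → ℝ, IsTestFunction U χ ∧
      (∀ᶠ y in 𝓝ˢ (C ∩ Metric.closedBall 0 (2 * ((k : ℝ) + 1))), χ y = 1) ∧
      ∀ y, χ y ∈ Icc (0 : ℝ) 1 := fun k =>
    exists_testFunction_eq_one hU ((isCompact_closedBall _ _).inter_left hC)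
      (inter_subset_left.trans hCU)
  choose χ hχ hχ1 hχI using hex
  -- `χ k` provides compact support in `U` but has uncontrolled gradient. It equals `1` near the
  -- part of `C` where the dilated bump `β k` can be nonzero, so near each point of `C` the product
  -- is `β k`, whose gradient is `O(1/k)`.
  set β : ℕ → E n → ℝ := fun k y => b (((k : ℝ) + 1)⁻¹ • y) with hβ
  have hβs : ∀ k, ContDiff ℝ ∞ (β k) := fun k => b.contDiff.comp (contDiff_const_smul _)
  have hpos : ∀ k : ℕ, (0 : ℝ) < (k : ℝ) + 1 := fun k => by positivity
  have heq : ∀ k, ∀ y ∈ C, (fun y => χ k y * β k y) =ᶠ[𝓝 y] β k := by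
    intro k y hy
    by_cases h : ‖y‖ ≤ 2 * ((k : ℝ) + 1)
    · have : ∀ᶠ z in 𝓝 y, χ k z = 1 :=
        (hχ1 k).filter_mono (nhds_le_nhdsSet (show y ∈ C ∩ Metric.closedBall 0 _ from
          ⟨hy, mem_closedBall_zero_iff.2 h⟩))
      filter_upwards [this] with z hz
      rw [hz, one_mul]
    · have : ∀ᶠ z in 𝓝 y, 2 * ((k : ℝ) + 1) < ‖z‖ :=
        continuous_norm.continuousAt.eventually_const_lt (not_le.1 h)
      filter_upwards [this] with z hz
      have : β k z = 0 := b.zero_of_le_dist (by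
        rw [dist_zero_right, norm_smul, norm_inv, Real.norm_of_nonneg (hpos k).le,
          le_inv_mul_iff₀ (hpos k), mul_comm]
        exact hz.le)
      rw [this, mul_zero]
  have hfd : ∀ k y, fderiv ℝ (β k) y = ((k : ℝ) + 1)⁻¹ • fderiv ℝ b (((k : ℝ) + 1)⁻¹ • y) := by
    intro k y
    exact fderiv_comp_smul _
  have hC₁0 : 0 ≤ C₁ := (norm_nonneg _).trans (hC₁ 0)
  have hfdb : ∀ k y, ‖fderiv ℝ (β k) y‖ ≤ (1 / ((k : ℝ) + 1)) * C₁ := by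
    intro k y
    rw [hfd, norm_smul, norm_inv, Real.norm_of_nonneg (hpos k).le, one_div]
    gcongr
    exact hC₁ _
  refine ⟨fun k y => χ k y * β k y, fun k => ⟨(hχ k).1.mul (hβs k), (hχ k).2.1.mul_right,
    tsupport_mul_subset_left.trans (hχ k).2.2⟩, C₁, fun y hy => ⟨fun k => ?_, fun k => ?_, ?_, ?_⟩⟩
  · have h1 : χ k y * β k y = β k y := (heq k y hy).self_of_nhds
    simp only [h1]
    rw [abs_of_nonneg b.nonneg]
    exact b.le_one
  · rw [(heq k y hy).fderiv_eq]
    refine (hfdb k y).trans ?_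
    have : 1 / ((k : ℝ) + 1) ≤ 1 := by
      rw [div_le_one (hpos k)]
      linarith [(Nat.cast_nonneg k : (0 : ℝ) ≤ k)]
    nlinarith
  · have h1 : Tendsto (fun k : ℕ => ((k : ℝ) + 1)⁻¹ • y) atTop (𝓝 ((0 : ℝ) • y)) := by
      have := (tendsto_one_div_add_atTop_nhds_zero_nat (𝕜 := ℝ)).smul_const y
      simpa using this
    have h2 := ((b.continuous.tendsto _).comp h1)
    rw [zero_smul, b.one_of_mem_closedBall (Metric.mem_closedBall_self b.rIn_pos.le)] at h2
    exact h2.congr fun k => ((heq k y hy).self_of_nhds).symm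
  · refine Tendsto.congr (fun k => ((heq k y hy).fderiv_eq).symm) ?_
    have h1 : Tendsto (fun k : ℕ => (1 / ((k : ℝ) + 1)) * C₁) atTop (𝓝 (0 * C₁)) :=
      tendsto_one_div_add_atTop_nhds_zero_nat.mul_const C₁
    rw [zero_mul] at h1
    exact squeeze_zero_norm (fun k => hfdb k y) h1

/-- The `δ`-hypothesis places almost all values of `u` in this closed subset of `U`; the cutoffs are
built for it, so no compactness of `M` is needed. -/
lemma isClosed_ball_subset {U : Set (E n)} {δ : ℝ} :
    IsClosed {y : E n | Metric.ball y δ ⊆ U} := by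
  have : {y : E n | Metric.ball y δ ⊆ U} = ⋂ z ∈ Uᶜ, {y | δ ≤ dist z y} := by
    ext y
    simp only [mem_ofPred_eq, mem_iInter, mem_compl_iff, subset_def, Metric.mem_ball]
    constructor
    · intro h z hz
      by_contra h'
      exact hz (h z (not_le.1 h'))
    · intro h z hz
      by_contra h'
      exact absurd hz (not_lt.2 (h z h'))
  rw [this]
  exact isClosed_biInter fun z _ => isClosed_le continuous_const (by fun_prop)

end Cutoff

/-! ### Tangency of the derivative and the harmonic map equation -/

section HarmonicMapEquation

variable {s n : ℕ} {Ω : Set (E s)} {M U : Set (E n)} {P : E n → E n}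

/-- The deformation of the identity in the direction of a localized vector field, followed by the
projection. -/
def projDeformation (P : E n → E n) (χ : ℝ → ℝ) (η : E n → ℝ) (φ : E s → E n)
    (p : ℝ × (E s × E n)) : E n :=
  P (p.2.2 + (χ p.1 * η p.2.2) • φ p.2.1) - P p.2.2

/-- A substitute `t * b t` for the time parameter: compactly supported and small, yet equal to `t`
near zero, so the velocity of a deformation is unchanged. -/
lemma exists_time_cutoff {τ : ℝ} (hτ : 0 < τ) :
    ∃ χ : ℝ → ℝ, ContDiff ℝ ∞ χ ∧ HasCompactSupport χ ∧ χ 0 = 0 ∧ HasDerivAt χ 1 0 ∧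
      ∀ t, |χ t| ≤ τ := by
  let b : ContDiffBump (0 : ℝ) := ⟨τ / 2, τ, by positivity, by linarith⟩
  refine ⟨fun t => t * b t, contDiff_id.mul b.contDiff, b.hasCompactSupport.mul_left, by simp,
    ?_, fun t => ?_⟩
  · have h1 : b =ᶠ[𝓝 (0 : ℝ)] fun _ => (1 : ℝ) := b.eventuallyEq_one
    have h2 : (fun t => t * b t) =ᶠ[𝓝 (0 : ℝ)] fun t => t := by
      filter_upwards [h1] with t ht
      rw [ht, mul_one]
    exact (hasDerivAt_id (0 : ℝ)).congr_of_eventuallyEq h2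
  · by_cases h : |t| < τ
    · rw [abs_mul, abs_of_nonneg b.nonneg]
      exact (mul_le_of_le_one_right (abs_nonneg t) b.le_one).trans h.le
    · have hb : b t = 0 := b.zero_of_le_dist (by simpa using not_lt.1 h)
      simpa [hb] using hτ.le

/-- For a small time cutoff the deformation stays in the domain of the projection. -/
lemma exists_time_cutoff_of_testFunction {η : E n → ℝ} (hη : IsTestFunction U η) (hU : IsOpen U)
    {φ : E s → E n} (hφ : IsTestFunction Ω φ) :
    ∃ χ : ℝ → ℝ, ContDiff ℝ ∞ χ ∧ HasCompactSupport χ ∧ χ 0 = 0 ∧ HasDerivAt χ 1 0 ∧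
      ∀ t x y, y ∈ tsupport η → y + (χ t * η y) • φ x ∈ U := by
  obtain ⟨C1, hC1⟩ := hη.2.1.exists_bound_of_continuous hη.1.continuous
  obtain ⟨C2, hC2⟩ := hφ.2.1.exists_bound_of_continuous hφ.1.continuous
  have hC10 : 0 ≤ C1 := (norm_nonneg _).trans (hC1 0)
  have hC20 : 0 ≤ C2 := (norm_nonneg _).trans (hC2 0)
  obtain ⟨ρ, hρ, hρU⟩ := hη.2.1.isCompact.exists_cthickening_subset_open hU hη.2.2
  -- The displacement is at most `τ * C1 * C2`, which this `τ` keeps below `ρ`; the `+ 1` avoids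
  -- division by zero.
  obtain ⟨χ, h1, h2, h3, h4, h5⟩ := exists_time_cutoff (τ := ρ / (C1 * C2 + 1)) (by positivity)
  refine ⟨χ, h1, h2, h3, h4, fun t x y hy => hρU (Metric.mem_cthickening_of_dist_le _ y _ _ hy ?_)⟩
  rw [dist_eq_norm, add_sub_cancel_left, norm_smul, norm_mul, Real.norm_eq_abs]
  calc |χ t| * ‖η y‖ * ‖φ x‖ ≤ ρ / (C1 * C2 + 1) * C1 * C2 := by
        gcongr
        · exact h5 t
        · exact hC1 y
        · exact hC2 x
    _ = ρ * ((C1 * C2) / (C1 * C2 + 1)) := by ring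
    _ ≤ ρ * 1 := by
        gcongr
        rw [div_le_one (by positivity)]
        linarith
    _ = ρ := mul_one ρ

lemma projDeformation_eq_zero {χ : ℝ → ℝ} {η : E n → ℝ} {φ : E s → E n} {p : ℝ × (E s × E n)}
    (h : χ p.1 * η p.2.2 = 0 ∨ φ p.2.1 = 0) : projDeformation P χ η φ p = 0 := by
  rcases h with h | h <;> simp [projDeformation, h]

/-- Off the support of `η` the deformation vanishes locally, so the behaviour of `P` outside `U`
plays no role. -/
lemma contDiff_projDeformation (hU : IsOpen U) (hPC2 : ContDiffOn ℝ 2 P U) {χ : ℝ → ℝ}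
    (hχ : ContDiff ℝ ∞ χ) {η : E n → ℝ} (hη : IsTestFunction U η) {φ : E s → E n}
    (hφ : ContDiff ℝ ∞ φ)
    (h : ∀ t x y, y ∈ tsupport η → y + (χ t * η y) • φ x ∈ U) :
    ContDiff ℝ 2 (projDeformation P χ η φ) := by
  have h2 : (2 : WithTop ℕ∞) ≤ ((⊤ : ℕ∞) : WithTop ℕ∞) :=
    WithTop.coe_le_coe.2 le_top
  rw [contDiff_iff_contDiffAt]
  rintro ⟨t, x, y⟩
  by_cases hy : y ∈ tsupport η
  · have hsm : ContDiff ℝ 2 (fun p : ℝ × (E s × E n) => p.2.2 + (χ p.1 * η p.2.2) • φ p.2.1) := by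
      have e1 : ContDiff ℝ 2 χ := hχ.of_le h2
      have e2 : ContDiff ℝ 2 η := hη.1.of_le h2
      have e3 : ContDiff ℝ 2 φ := hφ.of_le h2
      fun_prop
    have hy2 : ContDiff ℝ 2 (fun p : ℝ × (E s × E n) => p.2.2) := by fun_prop
    exact (ContDiffAt.comp (t, x, y) (contDiffAt_proj hU hPC2 (h t x y hy)) hsm.contDiffAt).sub
      (ContDiffAt.comp (t, x, y) (contDiffAt_proj hU hPC2 (hη.2.2 hy)) hy2.contDiffAt)
  · have : ∀ᶠ p : ℝ × (E s × E n) in 𝓝 (t, x, y), projDeformation P χ η φ p = 0 := by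
      have h3 : ∀ᶠ p : ℝ × (E s × E n) in 𝓝 (t, x, y), p.2.2 ∈ (tsupport η)ᶜ :=
        (show ContinuousAt (fun p : ℝ × (E s × E n) => p.2.2) (t, x, y) by
          fun_prop).eventually_mem ((isClosed_tsupport η).isOpen_compl.mem_nhds hy)
      filter_upwards [h3] with p hp
      exact projDeformation_eq_zero (Or.inl (by
        rw [image_eq_zero_of_notMem_tsupport hp, mul_zero]))
    exact contDiffAt_const.congr_of_eventuallyEq this

lemma hasCompactSupport_projDeformation {χ : ℝ → ℝ}
    (hχ : HasCompactSupport χ) {η : E n → ℝ} (hη : HasCompactSupport η) {φ : E s → E n}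
    (hφ : HasCompactSupport φ) : HasCompactSupport (projDeformation P χ η φ) := by
  refine HasCompactSupport.intro (hχ.isCompact.prod (hφ.isCompact.prod hη.isCompact))
    fun p hp => ?_
  by_cases h1 : p.1 ∈ tsupport χ
  · by_cases h2 : p.2.1 ∈ tsupport φ
    · have h3 : p.2.2 ∉ tsupport η := fun h3 => hp ⟨h1, h2, h3⟩
      exact projDeformation_eq_zero (Or.inl (by
        rw [image_eq_zero_of_notMem_tsupport h3, mul_zero]))
    · exact projDeformation_eq_zero (Or.inr (image_eq_zero_of_notMem_tsupport h2))
  · exact projDeformation_eq_zero (Or.inl (by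
      rw [image_eq_zero_of_notMem_tsupport h1, zero_mul]))

lemma velocity_projDeformation (hU : IsOpen U) (hPC2 : ContDiffOn ℝ 2 P U) {χ : ℝ → ℝ}
    (hχ : HasDerivAt χ 1 0) (hχ0 : χ 0 = 0) {η : E n → ℝ} {φ : E s → E n} {x : E s} {y : E n}
    (hy : y ∈ U) (hd : DifferentiableAt ℝ (projDeformation P χ η φ) (0, (x, y))) :
    fderiv ℝ (projDeformation P χ η φ) (0, (x, y)) (1, 0) = fderiv ℝ P y (η y • φ x) := by
  have h1 : HasDerivAt (fun t : ℝ => projDeformation P χ η φ (t, (x, y)))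
      (fderiv ℝ (projDeformation P χ η φ) (0, (x, y)) (1, 0)) 0 :=
    HasFDerivAt.comp_hasDerivAt (f := fun t : ℝ => (t, (x, y))) (0 : ℝ) hd.hasFDerivAt
      ((hasDerivAt_id' (0 : ℝ)).prodMk (hasDerivAt_const (0 : ℝ) (x, y)))
  have h2 : HasDerivAt (fun t : ℝ => y + (χ t * η y) • φ x) (η y • φ x) 0 := by
    have := ((hχ.mul_const (η y)).smul_const (φ x)).const_add y
    rwa [one_mul] at this
  have hy' : HasFDerivAt P (fderiv ℝ P y) (y + (χ 0 * η y) • φ x) := by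
    rw [hχ0, zero_mul, zero_smul, add_zero]
    exact hasFDerivAt_proj hU hPC2 hy
  have h3 := (hy'.comp_hasDerivAt (0 : ℝ) h2).sub_const (P y)
  exact h1.unique h3

lemma fderiv_velocity (hU : IsOpen U) (hPC2 : ContDiffOn ℝ 2 P U) {η : E n → ℝ}
    (hη : ContDiff ℝ ∞ η) {φ : E s → E n} (hφ : ContDiff ℝ ∞ φ) {G : E s × E n → E n}
    (hG : ∀ x, ∀ y ∈ U, G (x, y) = fderiv ℝ P y (η y • φ x)) {x : E s} {y : E n} (hy : y ∈ U)
    (e : E s) (Z : E n) :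
    fderiv ℝ G (x, y) (e, Z) = fderiv ℝ (fderiv ℝ P) y Z (η y • φ x) +
      fderiv ℝ P y (fderiv ℝ η y Z • φ x + η y • fderiv ℝ φ x e) := by
  have h1 : G =ᶠ[𝓝 (x, y)] fun z => fderiv ℝ P z.2 (η z.2 • φ z.1) := by
    have : ∀ᶠ z : E s × E n in 𝓝 (x, y), z.2 ∈ U :=
      continuousAt_snd.eventually_mem (hU.mem_nhds hy)
    filter_upwards [this] with z hz using hG z.1 z.2 hz
  rw [h1.fderiv_eq]
  have hsnd : HasFDerivAt (fun z : E s × E n => z.2) (ContinuousLinearMap.snd ℝ (E s) (E n))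
      (x, y) := hasFDerivAt_snd
  have hfst : HasFDerivAt (fun z : E s × E n => z.1) (ContinuousLinearMap.fst ℝ (E s) (E n))
      (x, y) := hasFDerivAt_fst
  have d1 := HasFDerivAt.comp (x, y) (hasFDerivAt_fderiv_proj hU hPC2 hy) hsnd
  have d2 := HasFDerivAt.comp (x, y) (hη.differentiable (by simp) y).hasFDerivAt hsnd
  have d3 := HasFDerivAt.comp (x, y) (hφ.differentiable (by simp) x).hasFDerivAt hfst
  have h2 := (d1.clm_apply (d2.smul d3)).fderiv
  have h3 : (fun z : E s × E n => fderiv ℝ P z.2 (η z.2 • φ z.1)) =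
      fun z => (fderiv ℝ P ∘ fun z : E s × E n => z.2) z
        (((η ∘ fun z : E s × E n => z.2) • (φ ∘ fun z : E s × E n => z.1)) z) := rfl
  rw [h3, h2]
  simp [add_comm]

/-- The weak derivative of a Sobolev map into `M` is tangent to `M`. -/
lemma ae_fderiv_proj_weakDeriv [IsFiniteMeasure (volume.restrict Ω)] (hΩ : IsOpen Ω)
    (hΩb : Bornology.IsBounded Ω) (hU : IsOpen U) (hMU : M ⊆ U)
    (hP : IsClosestPointProjection M U P) (hPC2 : ContDiffOn ℝ 2 P U)
    {u : E s → E n} (hu : MemW1Into 2 Ω M u) {δ : ℝ} (hδ : 0 < δ)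
    (huU : ∀ᵐ x ∂volume.restrict Ω, Metric.ball (u x) δ ⊆ U) :
    ∀ᵐ x ∂volume.restrict Ω, ∀ e, fderiv ℝ P (u x) (weakDeriv Ω u x e) = weakDeriv Ω u x e := by
  have h2 : (1 : WithTop ℕ∞) ≤ ((⊤ : ℕ∞) : WithTop ℕ∞) :=
    WithTop.coe_le_coe.2 le_top
  obtain ⟨η, hη, C₀, hηC⟩ := exists_cutoff_seq hU (isClosed_ball_subset (U := U) (δ := δ))
    fun y hy => hy (Metric.mem_ball_self hδ)
  obtain ⟨θ, hθ, hθ1, -⟩ := exists_testFunction_eq_one (isOpen_univ (X := E s))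
    hΩb.isCompact_closure (subset_univ _)
  have key : ∀ k, ∀ᵐ x ∂volume.restrict Ω, ∀ e,
      η k (u x) • (fderiv ℝ P (u x) (weakDeriv Ω u x e) - weakDeriv Ω u x e) = 0 := by
    intro k
    -- `F` vanishes on the graph of `u` because `P` fixes `M`; the chain rule then makes its
    -- derivative along the graph vanish. The factor `θ` equals `1` on `Ω` and only supplies compact
    -- support in `x`.
    set F : E s × E n → E n := fun z => θ z.1 • (η k z.2 • (P z.2 - z.2)) with hF
    have hF1 : ContDiff ℝ 1 F := by
      have hθ' : ContDiff ℝ 1 (fun z : E s × E n => θ z.1) := (hθ.1.of_le h2).comp contDiff_fst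
      have hη' : ContDiff ℝ 1 (fun y : E n => η k y • (P y - y)) := by
        rw [contDiff_iff_contDiffAt]
        intro y
        by_cases hy : y ∈ tsupport (η k)
        · exact ((hη k).1.of_le h2).contDiffAt.smul
            (((contDiffAt_proj hU hPC2 ((hη k).2.2 hy)).of_le (by norm_num)).sub contDiffAt_id)
        · have : ∀ᶠ z in 𝓝 y, η k z • (P z - z) = 0 := by
            filter_upwards [(isClosed_tsupport (η k)).isOpen_compl.mem_nhds hy] with z hz
            rw [image_eq_zero_of_notMem_tsupport hz, zero_smul]
          exact contDiffAt_const.congr_of_eventuallyEq this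
      exact hθ'.smul (hη'.comp contDiff_snd)
    have hFc : HasCompactSupport F := by
      refine HasCompactSupport.intro (hθ.2.1.isCompact.prod (hη k).2.1.isCompact) fun z hz => ?_
      by_cases h1 : z.1 ∈ tsupport θ
      · have h3 : z.2 ∉ tsupport (η k) := fun h3 => hz ⟨h1, h3⟩
        simp [hF, image_eq_zero_of_notMem_tsupport h3]
      · simp [hF, image_eq_zero_of_notMem_tsupport h1]
    have hd := hu.1.hasWeakDeriv.comp hΩ hF1 hFc hu.1.2.1 hu.1.2.2
    have hz : (fun x => F (x, u x)) =ᵐ[volume.restrict Ω] 0 := by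
      filter_upwards [hu.2] with x hx
      simp [hF, hP.eq_self hMU hx]
    have hd0 : HasWeakDeriv Ω (fun x => F (x, u x)) 0 := by
      refine ⟨hd.1, locallyIntegrableOn_fun_zero, fun φ hφ e => ?_⟩
      have : ∀ᵐ x ∂volume.restrict Ω, (fderiv ℝ φ x e) • F (x, u x) = 0 := by
        filter_upwards [hz] with x hx
        rw [hx]; simp
      rw [integral_congr_ae this]
      simp
    filter_upwards [hd.ae_unique hΩ hd0, hu.2, ae_restrict_mem hΩ.measurableSet]
      with x hx hxM hxΩ e
    have h3 : compDeriv F u (weakDeriv Ω u) x e = 0 := by rw [hx]; rfl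
    rw [compDeriv_apply] at h3
    have hsnd : HasFDerivAt (fun z : E s × E n => z.2) (ContinuousLinearMap.snd ℝ (E s) (E n))
      (x, u x) := hasFDerivAt_snd
    have hfst : HasFDerivAt (fun z : E s × E n => z.1) (ContinuousLinearMap.fst ℝ (E s) (E n))
      (x, u x) := hasFDerivAt_fst
    have d1 := HasFDerivAt.comp (x, u x) (hθ.1.differentiable (by simp) x).hasFDerivAt hfst
    have d2 := HasFDerivAt.comp (x, u x)
      ((hη k).1.differentiable (by simp) (u x)).hasFDerivAt hsnd
    have d3 := (HasFDerivAt.comp (x, u x) (hasFDerivAt_proj hU hPC2 (hMU hxM)) hsnd).sub hsnd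
    have h4 := (d1.smul (d2.smul d3)).fderiv
    have h5 : F = (θ ∘ fun z : E s × E n => z.1) •
      ((η k ∘ fun z : E s × E n => z.2) • ((P ∘ fun z : E s × E n => z.2) - fun z => z.2)) := rfl
    rw [h5, h4] at h3
    have hθx : θ x = 1 := hθ1.self_of_nhdsSet x (subset_closure hxΩ)
    simpa [hθx, hP.eq_self hMU hxM] using h3
  rw [← ae_all_iff] at key
  filter_upwards [key, huU] with x hx hxU e
  have h1 := (hηC (u x) hxU).2.2.1
  obtain ⟨k, hk⟩ := (h1.eventually_ne one_ne_zero).exists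
  exact sub_eq_zero.1 ((smul_eq_zero.1 (hx k e)).resolve_left hk)

/-- The tension term `∑ᵢ D²P(u)(∂ᵢu, ∂ᵢu)`. -/
def secondFormTrace (P : E n → E n) (y : E n) (T : E s →L[ℝ] E n) : E n :=
  ∑ i : Fin s, fderiv ℝ (fderiv ℝ P) y (T (EuclideanSpace.single i 1))
    (T (EuclideanSpace.single i 1))

/-- Each summand `D²P(p)(X, X)` with `X` tangent is normal to `M`, so it sees only the normal part
of `w`. This is the source of the gain from first to second order in `w`. -/
lemma norm_inner_secondFormTrace_le (hU : IsOpen U) (hMU : M ⊆ U)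
    (hP : IsClosestPointProjection M U P) (hPC2 : ContDiffOn ℝ 2 P U) {k : ℝ} (hk0 : 0 ≤ k)
    (hk : maxPrincipalCurvature M ≤ ENNReal.ofReal k) {p : E n} (hp : p ∈ M) {T : E s →L[ℝ] E n}
    (hT : ∀ e, fderiv ℝ P p (T e) = T e) (w : E n) :
    |inner ℝ (secondFormTrace P p T) w| ≤ k * frobNorm T ^ 2 * ‖w - fderiv ℝ P p w‖ := by
  rw [secondFormTrace, sum_inner, frobNorm_sq, Finset.mul_sum, Finset.sum_mul]
  refine (Finset.abs_sum_le_sum_abs _ _).trans (Finset.sum_le_sum fun i _ => ?_)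
  set X := T (EuclideanSpace.single i 1)
  have h1 := inner_second_tangent hU hMU hP hPC2 hp
    (hT (EuclideanSpace.single i 1)) (hT (EuclideanSpace.single i 1))
    (fderiv_proj_idem hU hMU hP hPC2 w hp)
  have h2 : inner ℝ (fderiv ℝ (fderiv ℝ P) p X X) w =
      inner ℝ (fderiv ℝ (fderiv ℝ P) p X X) (w - fderiv ℝ P p w) := by
    rw [inner_sub_right, h1, sub_zero]
  rw [h2]
  refine (abs_real_inner_le_norm _ _).trans ?_
  gcongr
  have := norm_second_le hU hMU hP hPC2 hk0 hk hp (hT (EuclideanSpace.single i 1)) X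
  calc _ ≤ _ := this
    _ = _ := by ring

lemma norm_normal_le (hU : IsOpen U) (hMU : M ⊆ U)
    (hP : IsClosestPointProjection M U P) (hPC2 : ContDiffOn ℝ 2 P U) {p : E n} (hp : p ∈ M)
    (w : E n) : ‖w - fderiv ℝ P p w‖ ≤ ‖w‖ := by
  have := norm_sq_eq_add hU hMU hP hPC2 hp w
  exact abs_le_of_sq_le_sq' (by nlinarith [sq_nonneg ‖fderiv ℝ P p w‖]) (norm_nonneg _) |>.2

lemma aestronglyMeasurable_secondFormTrace {μ : Measure (E s)} {u : E s → E n}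
    (hu : AEStronglyMeasurable u μ) {G : E s → E s →L[ℝ] E n} (hG : AEStronglyMeasurable G μ) :
    AEStronglyMeasurable (fun x => secondFormTrace P (u x) (G x)) μ := by
  have h1 : AEStronglyMeasurable (fun x => fderiv ℝ (fderiv ℝ P) (u x)) μ :=
    ((measurable_fderiv ℝ (fderiv ℝ P)).comp_aemeasurable hu.aemeasurable).aestronglyMeasurable
  have h2 : ∀ i : Fin s, AEStronglyMeasurable (fun x => G x (EuclideanSpace.single i 1)) μ :=
    fun i => hG.apply_continuousLinearMap _
  refine Finset.aestronglyMeasurable_fun_sum _ fun i _ => ?_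
  have h3 := (isBoundedBilinearMap_apply (𝕜 := ℝ) (E := E n)
    (F := E n →L[ℝ] E n)).continuous.comp_aestronglyMeasurable (h1.prodMk (h2 i))
  exact (isBoundedBilinearMap_apply (𝕜 := ℝ) (E := E n)
    (F := E n)).continuous.comp_aestronglyMeasurable (h3.prodMk (h2 i))

lemma integrable_frobNorm_sq {α : Type*} [MeasurableSpace α] {μ : Measure α}
    {G : α → E s →L[ℝ] E n} (hG : MemLp G 2 μ) : Integrable (fun x => frobNorm (G x) ^ 2) μ :=
  (memLp_frobNorm hG).integrable_sq

lemma abs_sum_mul_inner_le (T : E s →L[ℝ] E n) (l : E n →L[ℝ] ℝ) (w : E n) :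
    |∑ i : Fin s, l (T (EuclideanSpace.single i 1)) *
      inner ℝ (T (EuclideanSpace.single i 1)) w| ≤ ‖l‖ * ‖w‖ * frobNorm T ^ 2 := by
  rw [frobNorm_sq, Finset.mul_sum]
  refine (Finset.abs_sum_le_sum_abs _ _).trans (Finset.sum_le_sum fun i _ => ?_)
  rw [abs_mul]
  calc _ ≤ (‖l‖ * ‖T (EuclideanSpace.single i 1)‖) * (‖T (EuclideanSpace.single i 1)‖ * ‖w‖) := by
        gcongr
        · exact l.le_opNorm _
        · exact abs_real_inner_le_norm _ _
    _ = _ := by ring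

lemma integrable_inner_secondFormTrace (hU : IsOpen U) (hMU : M ⊆ U)
    (hP : IsClosestPointProjection M U P) (hPC2 : ContDiffOn ℝ 2 P U) {k : ℝ} (hk0 : 0 ≤ k)
    (hk : maxPrincipalCurvature M ≤ ENNReal.ofReal k) {u : E s → E n} (hu : MemW1Into 2 Ω M u)
    (htan : ∀ᵐ x ∂volume.restrict Ω, ∀ e,
      fderiv ℝ P (u x) (weakDeriv Ω u x e) = weakDeriv Ω u x e)
    {φ : E s → E n} (hφm : AEStronglyMeasurable φ (volume.restrict Ω))
    (hφi : Integrable (fun x => k * frobNorm (weakDeriv Ω u x) ^ 2 * ‖φ x‖)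
      (volume.restrict Ω)) :
    Integrable (fun x => inner ℝ (secondFormTrace P (u x) (weakDeriv Ω u x)) (φ x))
      (volume.restrict Ω) := by
  refine hφi.mono' ((aestronglyMeasurable_secondFormTrace
    hu.1.2.1.aestronglyMeasurable hu.1.2.2.aestronglyMeasurable).inner (𝕜 := ℝ) hφm) ?_
  filter_upwards [htan, hu.2] with x hx hxM
  refine (norm_inner_secondFormTrace_le hU hMU hP hPC2 hk0 hk hxM hx (φ x)).trans ?_
  gcongr
  exact norm_normal_le hU hMU hP hPC2 hxM _

/-- The weak harmonic map equation of a critical point. -/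
lemma integral_frobInner_fderiv_eq [IsFiniteMeasure (volume.restrict Ω)] (hΩ : IsOpen Ω)
    (hΩb : Bornology.IsBounded Ω) (hU : IsOpen U) (hMU : M ⊆ U)
    (hP : IsClosestPointProjection M U P) (hPC2 : ContDiffOn ℝ 2 P U) {k : ℝ} (hk0 : 0 ≤ k)
    (hk : maxPrincipalCurvature M ≤ ENNReal.ofReal k)
    {u : E s → E n} (hu : MemW1Into 2 Ω M u) {δ : ℝ} (hδ : 0 < δ)
    (huU : ∀ᵐ x ∂volume.restrict Ω, Metric.ball (u x) δ ⊆ U)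
    (hcrit : IsCriticalPoint Ω (H1Boundary Ω M u) (harmonicEnergy Ω) u)
    {φ : E s → E n} (hφ : IsTestFunction Ω φ) :
    ∫ x in Ω, frobInner (weakDeriv Ω u x) (fderiv ℝ φ x) =
      -∫ x in Ω, inner ℝ (secondFormTrace P (u x) (weakDeriv Ω u x)) (φ x) := by
  obtain ⟨η, hη, C₀, hηC⟩ := exists_cutoff_seq hU (isClosed_ball_subset (U := U) (δ := δ))
    fun y hy => hy (Metric.mem_ball_self hδ)
  have htan := ae_fderiv_proj_weakDeriv hΩ hΩb hU hMU hP hPC2 hu hδ huU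
  obtain ⟨Cφ, hCφ⟩ := hφ.2.1.exists_bound_of_continuous hφ.1.continuous
  set T := weakDeriv Ω u with hT
  set A : E s → E n := fun x => secondFormTrace P (u x) (T x) with hA
  -- The product rule for `⟨du, d(DP(u)(η φ))⟩`: the desired integrand times `η`, plus an error
  -- carrying the gradient of the cutoff.
  set D : ℕ → E s → ℝ := fun j x =>
    η j (u x) * (inner ℝ (A x) (φ x) + frobInner (T x) (fderiv ℝ φ x)) +
      ∑ i : Fin s, fderiv ℝ (η j) (u x) (T x (EuclideanSpace.single i 1)) *
        inner ℝ (T x (EuclideanSpace.single i 1)) (φ x) with hD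
  have hdφ : MemLp (fderiv ℝ φ) 2 (volume.restrict Ω) :=
    ((hφ.1.continuous_fderiv (by simp)).memLp_of_hasCompactSupport (hφ.2.1.fderiv ℝ)).restrict Ω
  have hT2 : MemLp T 2 (volume.restrict Ω) := hu.1.2.2
  have hstep : ∀ j, ∃ I : E s → ℝ, Integrable I (volume.restrict Ω) ∧ ∫ x in Ω, I x = 0 ∧
      I =ᵐ[volume.restrict Ω] D j := by
    intro j
    obtain ⟨χ, hχ1, hχ2, hχ3, hχ4, hχ5⟩ := exists_time_cutoff_of_testFunction (hη j) hU hφ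
    have hF := contDiff_projDeformation hU hPC2 hχ1 (hη j) hφ.1 hχ5
    have hFc := hasCompactSupport_projDeformation (P := P) hχ2 (hη j).2.1 hφ.2.1
    set F := projDeformation P χ (η j) φ with hFdef
    set G : E s × E n → E n := fun z => fderiv ℝ F (0, z) (1, 0) with hG
    have hGU : ∀ x, ∀ y ∈ U, G (x, y) = fderiv ℝ P y (η j y • φ x) := fun x y hy =>
      velocity_projDeformation hU hPC2 hχ4 hχ3 hy (hF.differentiable (by norm_num) _)
    have hG1 : ContDiff ℝ 1 G :=
      ((hF.fderiv_right (m := 1) (by norm_num)).comp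
        (contDiff_prodMk_right (0 : ℝ))).clm_apply contDiff_const
    have hGc : HasCompactSupport G :=
      (hasCompactSupport_slice (hFc.fderiv ℝ) 0).mono fun z hz hz' => hz (by
        simp only [hG]; rw [show fderiv ℝ F (0, z) = 0 from hz']; rfl)
    refine ⟨fun x => frobInner (T x) (compDeriv G u T x), integrable_frobInner hT2
      (memLp_compDeriv hG1 hGc hu.1.2.1.aestronglyMeasurable hT2), ?_, ?_⟩
    · refine integral_frobInner_compDeriv_eq_zero hΩ hu hcrit hF hFc
        (fun z => projDeformation_eq_zero (Or.inl (by simp [hχ3]))) hφ.2.1 hφ.2.2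
        (fun t x y hx => projDeformation_eq_zero (Or.inr (image_eq_zero_of_notMem_tsupport hx))) ?_
      filter_upwards [hu.2] with x hxM t
      have h1 : u x + F (t, (x, u x)) = P (u x + (χ t * η j (u x)) • φ x) := by
        simp [hFdef, projDeformation, hP.eq_self hMU hxM]
      rw [h1]
      refine (hP _ ?_).1
      by_cases hux : u x ∈ tsupport (η j)
      · exact hχ5 t x (u x) hux
      · rw [image_eq_zero_of_notMem_tsupport hux, mul_zero, zero_smul, add_zero]
        exact hMU hxM
    · filter_upwards [htan, hu.2] with x hx hxM
      simp only [hD, hA, frobInner, secondFormTrace]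
      rw [sum_inner, ← Finset.sum_add_distrib, Finset.mul_sum, ← Finset.sum_add_distrib]
      refine Finset.sum_congr rfl fun i _ => ?_
      rw [compDeriv_apply, fderiv_velocity hU hPC2 (hη j).1 hφ.1 hGU (hMU hxM)]
      set X := T x (EuclideanSpace.single i 1) with hX
      have hXt : fderiv ℝ P (u x) X = X := hx _
      -- Self-adjointness moves `DP(u)` and `D²P(u)(X, ·)` onto `X = ∂ᵢu`, which `DP(u)` fixes by
      -- tangency.
      rw [inner_add_right, ← inner_fderiv_symm hU hMU hP hPC2 _ _ hxM, hXt, map_smul,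
        inner_smul_right, ← inner_second_comm hU hMU hP hPC2 hxM hXt, inner_add_right,
        inner_smul_right, inner_smul_right]
      ring
  choose I hIi hI0 hID using hstep
  have hφT : Integrable (fun x => frobNorm (T x) ^ 2 * ‖φ x‖) (volume.restrict Ω) := by
    refine ((integrable_frobNorm_sq hT2).mul_const Cφ).mono'
      ((integrable_frobNorm_sq hT2).aestronglyMeasurable.mul
        hφ.1.continuous.norm.aestronglyMeasurable) (Eventually.of_forall fun x => ?_)
    rw [Real.norm_of_nonneg (by positivity)]
    gcongr
    exact hCφ x
  have hAφ : Integrable (fun x => inner ℝ (A x) (φ x)) (volume.restrict Ω) :=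
    integrable_inner_secondFormTrace hU hMU hP hPC2 hk0 hk hu htan
      hφ.1.continuous.aestronglyMeasurable (by simpa only [mul_assoc] using hφT.const_mul k)
  have hTφ := integrable_frobInner hT2 hdφ
  -- Removal of the cutoff: on the values of `u` it tends to `1`, its gradient tends to `0`, and
  -- both are uniformly bounded.
  have hlim : Tendsto (fun j => ∫ x in Ω, I j x) atTop
      (𝓝 (∫ x in Ω, (inner ℝ (A x) (φ x) + frobInner (T x) (fderiv ℝ φ x)))) := by
    refine tendsto_integral_of_dominated_convergence
      (fun x => (|inner ℝ (A x) (φ x)| + |frobInner (T x) (fderiv ℝ φ x)|) +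
        C₀ * (frobNorm (T x) ^ 2 * ‖φ x‖)) (fun j => (hIi j).aestronglyMeasurable)
      ((hAφ.norm.add hTφ.norm).add (hφT.const_mul C₀)) (fun j => ?_) ?_
    · filter_upwards [hID j, huU] with x hx hxU
      rw [hx, Real.norm_eq_abs]
      obtain ⟨h1, h2, -, -⟩ := hηC (u x) hxU
      refine (abs_add_le _ _).trans (add_le_add ?_ ?_)
      · rw [abs_mul]
        refine le_trans ?_ (abs_add_le _ _)
        exact mul_le_of_le_one_left (abs_nonneg _) (h1 j)
      · refine (abs_sum_mul_inner_le _ _ _).trans ?_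
        calc _ = ‖fderiv ℝ (η j) (u x)‖ * (frobNorm (T x) ^ 2 * ‖φ x‖) := by ring
          _ ≤ _ := by gcongr; exact h2 j
    · filter_upwards [ae_all_iff.2 hID, huU] with x hx hxU
      obtain ⟨-, -, h3, h4⟩ := hηC (u x) hxU
      simp only [hx, hD]
      have e1 := h3.mul_const (inner ℝ (A x) (φ x) + frobInner (T x) (fderiv ℝ φ x))
      have e2 : Tendsto (fun j => ∑ i : Fin s,
          fderiv ℝ (η j) (u x) (T x (EuclideanSpace.single i 1)) *
          inner ℝ (T x (EuclideanSpace.single i 1)) (φ x)) atTop (𝓝 0) := by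
        rw [show (0 : ℝ) = ∑ i : Fin s, (0 : E n →L[ℝ] ℝ) (T x (EuclideanSpace.single i 1)) *
          inner ℝ (T x (EuclideanSpace.single i 1)) (φ x) by simp]
        refine tendsto_finsetSum _ fun i _ => Tendsto.mul_const _ ?_
        exact ((ContinuousLinearMap.apply ℝ ℝ
          (T x (EuclideanSpace.single i 1))).continuous.tendsto _).comp h4
      simpa using e1.add e2
  simp only [hI0] at hlim
  have hfin := tendsto_nhds_unique hlim tendsto_const_nhds
  rw [integral_add hAφ hTφ] at hfin
  linarith

end HarmonicMapEquation

/-! ### Vector-valued Poincaré and Hölder estimates -/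

section Poincare

variable {s n : ℕ} {Ω : Set (E s)}

/-- The Poincaré constant is defined with the operator norm, the energy with the Frobenius norm.
Cauchy–Schwarz gives the one direction of comparison needed for scalar functions. -/
lemma sq_norm_le_sum_sq (l : E s →L[ℝ] ℝ) :
    ‖l‖ ^ 2 ≤ ∑ i : Fin s, ‖l (EuclideanSpace.single i 1)‖ ^ 2 := by
  have h : ‖l‖ ≤ √(∑ i : Fin s, ‖l (EuclideanSpace.single i 1)‖ ^ 2) := by
    refine l.opNorm_le_bound (Real.sqrt_nonneg _) fun x => ?_
    have h1 : ‖l x‖ ≤ ∑ i, ‖l (EuclideanSpace.single i 1)‖ * ‖x i‖ := by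
      conv_lhs => rw [eq_sum_single x]
      rw [map_sum]
      refine (norm_sum_le _ _).trans_eq (Finset.sum_congr rfl fun i _ => ?_)
      rw [map_smul, norm_smul, mul_comm]
    refine h1.trans ?_
    rw [EuclideanSpace.norm_eq]
    exact Real.sum_mul_le_sqrt_mul_sqrt _ _ _
  calc ‖l‖ ^ 2 ≤ √(∑ i : Fin s, ‖l (EuclideanSpace.single i 1)‖ ^ 2) ^ 2 := by gcongr
    _ = _ := Real.sq_sqrt (Finset.sum_nonneg fun _ _ => sq_nonneg _)

lemma IsTestFunction.coord {φ : E s → E n} (hφ : IsTestFunction Ω φ) (j : Fin n) :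
    IsTestFunction Ω (fun x => φ x j) := by
  have h0 : (fun x => φ x j) = (EuclideanSpace.proj (𝕜 := ℝ) j) ∘ φ := rfl
  refine ⟨?_, ?_, ?_⟩
  · rw [h0]; exact (EuclideanSpace.proj (𝕜 := ℝ) j).contDiff.comp hφ.1
  · exact hφ.2.1.comp_left (g := fun y : E n => y j) rfl
  · have h1 : Function.support (fun x => φ x j) ⊆ Function.support φ := fun x hx hx' =>
      hx (by simp [hx'])
    exact (closure_mono h1).trans hφ.2.2

lemma IsTestFunction.fderiv_coord {φ : E s → E n} (hφ : IsTestFunction Ω φ) (j : Fin n) (x e : E s) :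
    fderiv ℝ (fun x => φ x j) x e = fderiv ℝ φ x e j := by
  have h := (EuclideanSpace.proj (𝕜 := ℝ) j : E n →L[ℝ] ℝ).hasFDerivAt.comp x
    (hφ.1.differentiable (by simp) x).hasFDerivAt
  have h2 : fderiv ℝ (fun x => φ x j) x = _ := h.fderiv
  rw [h2]; rfl

lemma sum_sq_norm_fderiv_coord_le {φ : E s → E n} (hφ : IsTestFunction Ω φ) (x : E s) :
    ∑ j : Fin n, ‖fderiv ℝ (fun x => φ x j) x‖ ^ 2 ≤ frobNorm (fderiv ℝ φ x) ^ 2 := by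
  rw [frobNorm_sq]
  calc _ ≤ ∑ j : Fin n, ∑ i : Fin s, ‖fderiv ℝ φ x (EuclideanSpace.single i 1) j‖ ^ 2 := by
        refine Finset.sum_le_sum fun j _ => (sq_norm_le_sum_sq _).trans_eq ?_
        simp only [hφ.fderiv_coord]
    _ = _ := by
        rw [Finset.sum_comm]
        simp only [EuclideanSpace.norm_sq_eq]

lemma eLpNorm_sq_eq {α V : Type*} [MeasurableSpace α] {μ : Measure α} [NormedAddCommGroup V]
    (f : α → V) (r : ℝ) :
    eLpNorm (fun x => ‖f x‖ ^ 2) (ENNReal.ofReal (r / 2)) μ =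
      eLpNorm f (ENNReal.ofReal r) μ ^ 2 := by
  have h := eLpNorm_norm_rpow (p := ENNReal.ofReal (r / 2)) (μ := μ) f (q := 2) two_pos
  rw [← ENNReal.ofReal_mul' (by norm_num), div_mul_cancel₀ _ two_ne_zero] at h
  simpa using h

/-- The Poincaré inequality for vector-valued test functions with the scalar constant. -/
lemma eLpNorm_le_of_poincare {r : ℝ} (hr : 2 ≤ r) {C : ℝ≥0∞}
    (hC : ∀ φ : E s → ℝ, IsTestFunction Ω φ → eLpNorm φ (ENNReal.ofReal r) (volume.restrict Ω) ≤
      C * eLpNorm (fderiv ℝ φ) 2 (volume.restrict Ω))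
    {φ : E s → E n} (hφ : IsTestFunction Ω φ) :
    eLpNorm φ (ENNReal.ofReal r) (volume.restrict Ω) ≤
      C * eLpNorm (fun x => frobNorm (fderiv ℝ φ x)) 2 (volume.restrict Ω) := by
  have h1 : eLpNorm φ (ENNReal.ofReal r) (volume.restrict Ω) ^ 2 ≤
      (C * eLpNorm (fun x => frobNorm (fderiv ℝ φ x)) 2 (volume.restrict Ω)) ^ 2 := by
    rw [← eLpNorm_sq_eq]
    have e1 : (fun x => ‖φ x‖ ^ 2) = ∑ j : Fin n, fun x => ‖φ x j‖ ^ 2 := by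
      funext x
      rw [EuclideanSpace.norm_sq_eq, Finset.sum_apply]
    rw [e1]
    -- Minkowski's inequality in `L^{r/2}` is applied to `‖φ‖² = ∑ⱼ |φⱼ|²`, so passing to vector
    -- values costs no dimensional factor.
    have hp : 1 ≤ ENNReal.ofReal (r / 2) := by
      rw [ENNReal.one_le_ofReal]; linarith
    refine (eLpNorm_sum_le (f := fun j x => ‖φ x j‖ ^ 2) (fun j _ =>
      ((hφ.coord j).1.continuous.norm.pow 2).aestronglyMeasurable) hp).trans ?_
    calc _ ≤ ∑ j : Fin n, C ^ 2 * ∫⁻ x in Ω, ‖fderiv ℝ (fun x => φ x j) x‖ₑ ^ 2 := by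
          refine Finset.sum_le_sum fun j _ => ?_
          rw [eLpNorm_sq_eq, ← eLpNorm_two_sq, ← mul_pow]
          exact pow_le_pow_left' (hC _ (hφ.coord j)) 2
      _ = C ^ 2 * ∫⁻ x in Ω, ∑ j : Fin n, ‖fderiv ℝ (fun x => φ x j) x‖ₑ ^ 2 := by
          rw [← Finset.mul_sum, lintegral_finsetSum _ fun j _ =>
            (((hφ.coord j).1.continuous_fderiv (by simp)).enorm.measurable.pow_const 2)]
      _ ≤ C ^ 2 * ∫⁻ x in Ω, ‖frobNorm (fderiv ℝ φ x)‖ₑ ^ 2 := by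
          gcongr with x
          simp only [← ofReal_norm, ← ENNReal.ofReal_pow (norm_nonneg _)]
          rw [← ENNReal.ofReal_sum_of_nonneg fun _ _ => sq_nonneg _,
            Real.norm_of_nonneg (frobNorm_nonneg _)]
          exact ENNReal.ofReal_le_ofReal (sum_sq_norm_fderiv_coord_le hφ x)
      _ = _ := by rw [mul_pow, eLpNorm_two_sq]
  exact (ENNReal.pow_le_pow_left_iff two_ne_zero).1 h1

/-- The exponent is dictated by `1/q + (q - 2)/(2q) = 1/2`. -/
lemma holderTriple_of_two_lt {q : ℝ} (hq : 2 < q) :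
    ENNReal.HolderTriple (ENNReal.ofReal q) (ENNReal.ofReal (2 * q / (q - 2))) 2 where
  inv_add_inv_eq_inv := by
    have h1 : 0 < q := by linarith
    have h2 : 0 < q - 2 := by linarith
    rw [← ENNReal.ofReal_inv_of_pos h1, ← ENNReal.ofReal_inv_of_pos (by positivity),
      ← ENNReal.ofReal_add (by positivity) (by positivity),
      show (2 : ℝ≥0∞) = ENNReal.ofReal 2 by simp, ← ENNReal.ofReal_inv_of_pos two_pos]
    congr 1
    field_simp
    ring

/-- Hölder's inequality combined with the Poincaré inequality. -/
lemma eLpNorm_weight_smul_le {q : ℝ} (hq : 2 < q) {C : ℝ≥0∞}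
    (hC : ∀ φ : E s → ℝ, IsTestFunction Ω φ →
      eLpNorm φ (ENNReal.ofReal (2 * q / (q - 2))) (volume.restrict Ω) ≤
      C * eLpNorm (fderiv ℝ φ) 2 (volume.restrict Ω))
    {a : E s → ℝ} (ha : AEStronglyMeasurable a (volume.restrict Ω)) {k : ℝ} (hk : 0 ≤ k)
    {φ : E s → E n} (hφ : IsTestFunction Ω φ) :
    eLpNorm (fun x => (k * a x) • φ x) 2 (volume.restrict Ω) ≤
      (ENNReal.ofReal k * C * eLpNorm a (ENNReal.ofReal q) (volume.restrict Ω)) *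
      eLpNorm (fun x => frobNorm (fderiv ℝ φ x)) 2 (volume.restrict Ω) := by
  have hr : 2 ≤ 2 * q / (q - 2) := by
    rw [le_div_iff₀ (by linarith)]; linarith
  have h1 : eLpNorm (fun x => (k * a x) • φ x) 2 (volume.restrict Ω) =
      ENNReal.ofReal k * eLpNorm (a • φ) 2 (volume.restrict Ω) := by
    have : (fun x => (k * a x) • φ x) = k • (a • φ) := by
      funext x; simp [mul_smul]
    rw [this, eLpNorm_const_smul, ← ofReal_norm, Real.norm_of_nonneg hk]
  have hH := holderTriple_of_two_lt hq
  have h2 := eLpNorm_smul_le_mul_eLpNorm (p := ENNReal.ofReal q)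
    (q := ENNReal.ofReal (2 * q / (q - 2))) (r := 2) (μ := volume.restrict Ω)
    hφ.1.continuous.aestronglyMeasurable ha
  have h3 := eLpNorm_le_of_poincare hr hC hφ
  rw [h1]
  calc _ ≤ ENNReal.ofReal k * (eLpNorm a (ENNReal.ofReal q) (volume.restrict Ω) *
        (C * eLpNorm (fun x => frobNorm (fderiv ℝ φ x)) 2 (volume.restrict Ω))) :=
        mul_le_mul' le_rfl (h2.trans (mul_le_mul' le_rfl h3))
    _ = _ := by ring

lemma eLpNorm_frobNorm {α : Type*} [MeasurableSpace α] {μ : Measure α} {p : ℝ≥0∞}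
    (G : α → E s →L[ℝ] E n) :
    eLpNorm (fun x => frobNorm (G x)) p μ = eLpNorm (fun x => columns s n (G x)) p μ := by
  rw [← eLpNorm_norm (fun x => columns s n (G x))]
  simp only [norm_columns]

lemma IsTestFunction.sub {φ ψ : E s → E n} (hφ : IsTestFunction Ω φ) (hψ : IsTestFunction Ω ψ) :
    IsTestFunction Ω (φ - ψ) :=
  ⟨hφ.1.sub hψ.1, hφ.2.1.sub hψ.2.1, (tsupport_sub φ ψ).trans (union_subset hφ.2.2 hψ.2.2)⟩

lemma isTestFunction_zero : IsTestFunction Ω (0 : E s → E n) :=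
  ⟨contDiff_const, HasCompactSupport.zero, by simp [tsupport]⟩

/-- A weighted inequality for test functions extends to `H¹₀`. -/
lemma eLpNorm_weight_smul_sub_le {a : E s → ℝ} (ha : AEStronglyMeasurable a (volume.restrict Ω))
    {Θ : ℝ≥0∞} (hΘ : Θ ≠ ⊤)
    (h : ∀ φ : E s → E n, IsTestFunction Ω φ →
      eLpNorm (fun x => a x • φ x) 2 (volume.restrict Ω) ≤
      Θ * eLpNorm (fun x => frobNorm (fderiv ℝ φ x)) 2 (volume.restrict Ω))
    {w : E s → E n} (hw1 : MemW1 2 Ω w) {φ : ℕ → E s → E n} (hφ : ∀ k, IsTestFunction Ω (φ k))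
    (hφw : Tendsto (fun k => eLpNorm (w - φ k) 2 (volume.restrict Ω)) atTop (𝓝 0))
    (hdφw : Tendsto (fun k => eLpNorm (weakDeriv Ω w - fderiv ℝ (φ k)) 2 (volume.restrict Ω))
      atTop (𝓝 0)) {ψ : E s → E n} (hψ : IsTestFunction Ω ψ) :
    eLpNorm (fun x => a x • (ψ x - w x)) 2 (volume.restrict Ω) ≤
      Θ * eLpNorm (fun x => frobNorm (fderiv ℝ ψ x - weakDeriv Ω w x)) 2 (volume.restrict Ω) := by
  set μ := volume.restrict Ω with hμ
  -- The weight `a` need not be bounded, so weighted `L²` convergence is not available in advance. A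
  -- subsequence converging almost everywhere and Fatou's lemma give the bound on the left-hand
  -- side.
  have hmeas : TendstoInMeasure μ φ atTop w := by
    refine tendstoInMeasure_of_tendsto_eLpNorm two_ne_zero
      (fun k => (hφ k).1.continuous.aestronglyMeasurable) hw1.2.1.aestronglyMeasurable ?_
    refine hφw.congr fun k => ?_
    rw [← eLpNorm_neg, neg_sub]
  obtain ⟨ns, hns, hae⟩ := hmeas.exists_seq_tendsto_ae
  have hlsc : eLpNorm (fun x => a x • (ψ x - w x)) 2 μ ≤
      liminf (fun k => eLpNorm (fun x => a x • (ψ x - φ (ns k) x)) 2 μ) atTop := by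
    refine Lp.eLpNorm_lim_le_liminf_eLpNorm (fun k => ha.smul
      (hψ.1.continuous.aestronglyMeasurable.sub
        (hφ (ns k)).1.continuous.aestronglyMeasurable)) _ ?_
    filter_upwards [hae] with x hx
    exact (tendsto_const_nhds.sub hx).const_smul (a x)
  have hdm : AEStronglyMeasurable (weakDeriv Ω w) μ := hw1.2.2.aestronglyMeasurable
  have hcm : ∀ G : E s → E s →L[ℝ] E n, AEStronglyMeasurable G μ →
      AEStronglyMeasurable (fun x => columns s n (G x)) μ := fun G hG =>
    (columns s n).continuous.comp_aestronglyMeasurable hG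
  have hfd : ∀ {φ : E s → E n}, IsTestFunction Ω φ → AEStronglyMeasurable (fderiv ℝ φ) μ :=
    fun hφ => (hφ.1.continuous_fderiv (by simp)).aestronglyMeasurable
  set X := eLpNorm (fun x => frobNorm (fderiv ℝ ψ x - weakDeriv Ω w x)) 2 μ with hX
  have hb : ∀ k, eLpNorm (fun x => a x • (ψ x - φ (ns k) x)) 2 μ ≤
      Θ * (X + ENNReal.ofReal ‖columns s n‖ *
        eLpNorm (weakDeriv Ω w - fderiv ℝ (φ (ns k))) 2 μ) := by
    intro k
    refine (h _ (hψ.sub (hφ (ns k)))).trans (mul_le_mul' le_rfl ?_)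
    have e1 : ∀ x, fderiv ℝ (ψ - φ (ns k)) x = (fderiv ℝ ψ x - weakDeriv Ω w x) +
        (weakDeriv Ω w - fderiv ℝ (φ (ns k))) x := by
      intro x
      rw [fderiv_sub (hψ.1.differentiable (by simp) x) ((hφ (ns k)).1.differentiable (by simp) x),
        Pi.sub_apply]
      abel
    rw [hX, eLpNorm_frobNorm, eLpNorm_frobNorm]
    simp only [e1, map_add]
    refine (eLpNorm_add_le (hcm _ ((hfd hψ).sub hdm)) (hcm _ (hdm.sub (hfd (hφ _))))
      one_le_two).trans (add_le_add le_rfl ?_)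
    exact eLpNorm_le_mul_eLpNorm_of_ae_le_mul
      (Eventually.of_forall fun x => (columns s n).le_opNorm _) 2
  have hlim : Tendsto (fun k => Θ * (X + ENNReal.ofReal ‖columns s n‖ *
        eLpNorm (weakDeriv Ω w - fderiv ℝ (φ (ns k))) 2 μ)) atTop (𝓝 (Θ * X)) := by
    have h1 := ENNReal.Tendsto.const_mul (a := ENNReal.ofReal ‖columns s n‖)
      (hdφw.comp hns.tendsto_atTop) (Or.inr ENNReal.ofReal_ne_top)
    have h2 := ENNReal.Tendsto.const_mul (a := Θ) (h1.const_add X) (Or.inr hΘ)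
    simpa using h2
  calc _ ≤ _ := hlsc
    _ ≤ liminf (fun k => Θ * (X + ENNReal.ofReal ‖columns s n‖ *
        eLpNorm (weakDeriv Ω w - fderiv ℝ (φ (ns k))) 2 μ)) atTop :=
      liminf_le_liminf (Eventually.of_forall hb)
    _ = Θ * X := hlim.liminf_eq

lemma integral_norm_sq_eq {α V : Type*} [MeasurableSpace α] {μ : Measure α}
    [NormedAddCommGroup V] {f : α → V} (hf : MemLp f 2 μ) :
    ∫ x, ‖f x‖ ^ 2 ∂μ = (eLpNorm f 2 μ).toReal ^ 2 := by
  rw [← ENNReal.toReal_pow, eLpNorm_two_sq,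
    integral_eq_lintegral_of_nonneg_ae (Eventually.of_forall fun x => sq_nonneg _)
      (hf.aestronglyMeasurable.norm.pow 2)]
  congr 1
  refine lintegral_congr fun x => ?_
  rw [ENNReal.ofReal_pow (norm_nonneg _), ofReal_norm]

end Poincare

/-! ### Smallness, the tested equation and the energy expansion -/

section Ellipticity

variable {s n : ℕ} {Ω : Set (E s)} {M U : Set (E n)} {P : E n → E n}

/-- Any cutoff that is `1` near a point of `Ω` bounds the constant below. Positivity excludes the
convention `∞ * 0 = 0`, under which infinite curvature could satisfy the smallness condition. -/
lemma poincareConstant_ne_zero (hΩ : IsOpen Ω) (hne : Ω.Nonempty) {r : ℝ} (hr : 0 < r) :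
    poincareConstant r Ω ≠ 0 := by
  obtain ⟨x, hx⟩ := hne
  obtain ⟨θ, hθ, hθ1, -⟩ := exists_testFunction_eq_one hΩ (isCompact_singleton (x := x))
    (singleton_subset_iff.2 hx)
  rw [nhdsSet_singleton] at hθ1
  have hA : eLpNorm θ (ENNReal.ofReal r) (volume.restrict Ω) ≠ 0 := by
    intro h
    rw [eLpNorm_eq_zero_iff hθ.1.continuous.aestronglyMeasurable
      (by simpa using hr)] at h
    have h0 : volume.restrict Ω {y | θ y = 1 ∧ y ∈ Ω} = 0 :=
      measure_mono_null (fun y hy => by simp [hy.1]) h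
    rw [Measure.restrict_eq_self _ (fun y hy => hy.2)] at h0
    exact (Measure.measure_pos_of_mem_nhds volume (hθ1.and (hΩ.mem_nhds hx))).ne' h0
  have hX : eLpNorm (fderiv ℝ θ) 2 (volume.restrict Ω) ≠ ⊤ :=
    (((hθ.1.continuous_fderiv (by simp)).memLp_of_hasCompactSupport
      (hθ.2.1.fderiv ℝ)).restrict Ω).eLpNorm_ne_top
  have h : eLpNorm θ (ENNReal.ofReal r) (volume.restrict Ω) /
      eLpNorm (fderiv ℝ θ) 2 (volume.restrict Ω) ≤ poincareConstant r Ω :=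
    le_sInf fun C hC => ENNReal.div_le_of_le_mul (hC θ hθ)
  intro h0
  rw [h0, nonpos_iff_eq_zero, ENNReal.div_eq_zero_iff] at h
  exact h.elim hA hX

/-- The smallness condition bounds the multiplication operator by `κ |du|` on `H¹₀`. -/
lemma exists_contraction_of_small (hΩ : IsOpen Ω) (hne : Ω.Nonempty) {q : ℝ} (hq : 2 < q)
    {u : E s → E n} (hu : AEStronglyMeasurable (weakDeriv Ω u) (volume.restrict Ω))
    (hsmall : derivLpNorm q Ω u <
      (maxPrincipalCurvature M * poincareConstant (2 * q / (q - 2)) Ω)⁻¹) :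
    ∃ k Θ : ℝ, 0 ≤ k ∧ maxPrincipalCurvature M ≤ ENNReal.ofReal k ∧ 0 ≤ Θ ∧ Θ < 1 ∧
      ∀ φ : E s → E n, IsTestFunction Ω φ →
        eLpNorm (fun x => (k * frobNorm (weakDeriv Ω u x)) • φ x) 2 (volume.restrict Ω) ≤
          ENNReal.ofReal Θ * eLpNorm (fun x => frobNorm (fderiv ℝ φ x)) 2 (volume.restrict Ω) := by
  set κ := maxPrincipalCurvature M
  set D := derivLpNorm q Ω u with hD
  have hr : 0 < 2 * q / (q - 2) := div_pos (by linarith) (by linarith)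
  have hCp := poincareConstant_ne_zero hΩ hne hr
  set Cp := poincareConstant (2 * q / (q - 2)) Ω with hCpdef
  have hκ : κ ≠ ⊤ := by
    intro h
    rw [h, ENNReal.top_mul hCp, ENNReal.inv_top] at hsmall
    exact not_lt_zero hsmall
  -- For zero curvature the smallness condition places no numerical bound on `du`, but with `k = 0`
  -- the weight vanishes.
  rcases eq_or_ne κ 0 with h0 | h0
  · exact ⟨0, 0, le_rfl, by simp [h0], le_rfl, one_pos, fun φ _ => by simp⟩
  have hlt : Cp < D⁻¹ / κ := by
    rw [ENNReal.lt_div_iff_mul_lt (Or.inl h0) (Or.inl hκ), mul_comm]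
    exact ENNReal.lt_inv_iff_lt_inv.1 hsmall
  -- The strict inequality leaves room for an admissible `C` slightly above the infimum, so
  -- attainment is not needed.
  obtain ⟨C, hC, hClt⟩ := sInf_lt_iff.1 hlt
  have hΘ : κ * C * D < 1 := by
    rcases eq_or_ne D 0 with hD0 | hD0
    · simp [hD0]
    have hDt : D ≠ ⊤ := hsmall.ne_top
    rw [ENNReal.lt_div_iff_mul_lt (Or.inl h0) (Or.inl hκ), mul_comm] at hClt
    rw [← one_div, ENNReal.lt_div_iff_mul_lt (Or.inl hD0) (Or.inl hDt)] at hClt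
    exact hClt
  refine ⟨κ.toReal, (κ * C * D).toReal, ENNReal.toReal_nonneg, (ENNReal.ofReal_toReal hκ).ge,
    ENNReal.toReal_nonneg, ?_, fun φ hφ => ?_⟩
  · rw [← ENNReal.toReal_one]
    exact ENNReal.toReal_strict_mono ENNReal.one_ne_top hΘ
  · have ha : AEStronglyMeasurable (fun x => frobNorm (weakDeriv Ω u x)) (volume.restrict Ω) := by
      simp only [← norm_columns]
      exact ((columns s n).continuous.comp_aestronglyMeasurable hu).norm
    have h := eLpNorm_weight_smul_le hq hC ha ENNReal.toReal_nonneg (k := κ.toReal) hφ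
    rw [ENNReal.ofReal_toReal hκ] at h
    rwa [ENNReal.ofReal_toReal hΘ.ne_top]

/-- The Euler–Lagrange equation tested with functions in `H¹₀`. -/
lemma integral_frobInner_weakDeriv_eq [IsFiniteMeasure (volume.restrict Ω)] (hΩ : IsOpen Ω)
    (hΩb : Bornology.IsBounded Ω) (hU : IsOpen U) (hMU : M ⊆ U)
    (hP : IsClosestPointProjection M U P) (hPC2 : ContDiffOn ℝ 2 P U) {k : ℝ} (hk0 : 0 ≤ k)
    (hk : maxPrincipalCurvature M ≤ ENNReal.ofReal k)
    {u : E s → E n} (hu : MemW1Into 2 Ω M u) {δ : ℝ} (hδ : 0 < δ)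
    (huU : ∀ᵐ x ∂volume.restrict Ω, Metric.ball (u x) δ ⊆ U)
    (hcrit : IsCriticalPoint Ω (H1Boundary Ω M u) (harmonicEnergy Ω) u) {Θ : ℝ≥0∞} (hΘ : Θ ≠ ⊤)
    (h : ∀ φ : E s → E n, IsTestFunction Ω φ →
      eLpNorm (fun x => (k * frobNorm (weakDeriv Ω u x)) • φ x) 2 (volume.restrict Ω) ≤
      Θ * eLpNorm (fun x => frobNorm (fderiv ℝ φ x)) 2 (volume.restrict Ω))
    {w : E s → E n} (hw : MemH10 Ω w) :
    MemLp (fun x => (k * frobNorm (weakDeriv Ω u x)) • w x) 2 (volume.restrict Ω) ∧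
    eLpNorm (fun x => (k * frobNorm (weakDeriv Ω u x)) • w x) 2 (volume.restrict Ω) ≤
      Θ * eLpNorm (fun x => frobNorm (weakDeriv Ω w x)) 2 (volume.restrict Ω) ∧
    ∫ x in Ω, frobInner (weakDeriv Ω u x) (weakDeriv Ω w x) =
      -∫ x in Ω, inner ℝ (secondFormTrace P (u x) (weakDeriv Ω u x)) (w x) := by
  obtain ⟨hw1, φ, hφ, hφw, hdφw⟩ := hw
  have htan := ae_fderiv_proj_weakDeriv hΩ hΩb hU hMU hP hPC2 hu hδ huU
  have haL : MemLp (fun x => frobNorm (weakDeriv Ω u x)) 2 (volume.restrict Ω) :=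
    memLp_frobNorm hu.1.2.2
  set a := fun x => frobNorm (weakDeriv Ω u x) with ha
  have ha0 : ∀ x, 0 ≤ a x := fun x => frobNorm_nonneg _
  have hkm : AEStronglyMeasurable (fun x => k * a x) (volume.restrict Ω) :=
    haL.aestronglyMeasurable.const_mul k
  -- Used twice: `ψ = 0` gives the weighted inequality for `w`, and `ψ = φ j` gives weighted `L²`
  -- convergence of the approximants.
  have hext : ∀ {ψ : E s → E n}, IsTestFunction Ω ψ → _ := fun {ψ} hψ =>
    eLpNorm_weight_smul_sub_le hkm hΘ h hw1 hφ hφw hdφw hψ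
  have hle : eLpNorm (fun x => (k * a x) • w x) 2 (volume.restrict Ω) ≤
      Θ * eLpNorm (fun x => frobNorm (weakDeriv Ω w x)) 2 (volume.restrict Ω) := by
    have h0 := hext isTestFunction_zero
    have e1 : (fun x => (k * a x) • ((0 : E s → E n) x - w x)) =
        -(fun x => (k * a x) • w x) := by funext x; simp
    have e2 : (fun x => frobNorm (fderiv ℝ (0 : E s → E n) x - weakDeriv Ω w x)) =
        fun x => frobNorm (weakDeriv Ω w x) := by
      funext x
      rw [← norm_columns, ← norm_columns]
      simp
    rwa [e1, e2, eLpNorm_neg] at h0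
  have hLw : MemLp (fun x => (k * a x) • w x) 2 (volume.restrict Ω) :=
    ⟨hkm.smul hw1.2.1.aestronglyMeasurable, hle.trans_lt
      (ENNReal.mul_lt_top hΘ.lt_top (memLp_frobNorm hw1.2.2).eLpNorm_lt_top)⟩
  refine ⟨hLw, hle, ?_⟩
  -- The pairing is at most `k|du|²|ψ| = |du| · (k|du||ψ|)`, a product of two `L²` functions, hence
  -- integrable without boundedness of `ψ`.
  have hint : ∀ {ψ : E s → E n}, AEStronglyMeasurable ψ (volume.restrict Ω) →
      MemLp (fun x => (k * a x) • ψ x) 2 (volume.restrict Ω) →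
      Integrable (fun x => inner ℝ (secondFormTrace P (u x) (weakDeriv Ω u x)) (ψ x))
        (volume.restrict Ω) := by
    intro ψ hψm hψ
    refine integrable_inner_secondFormTrace hU hMU hP hPC2 hk0 hk hu htan hψm ?_
    refine (haL.integrable_mul hψ.norm).congr (Eventually.of_forall fun x => ?_)
    simp only [Pi.mul_apply, norm_smul, norm_mul, Real.norm_of_nonneg hk0,
      Real.norm_of_nonneg (frobNorm_nonneg _), ha]
    ring
  have hdφ : ∀ j, MemLp (fderiv ℝ (φ j)) 2 (volume.restrict Ω) := fun j =>
    (((hφ j).1.continuous_fderiv (by simp)).memLp_of_hasCompactSupport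
      ((hφ j).2.1.fderiv ℝ)).restrict Ω
  have hLφ : ∀ j, MemLp (fun x => (k * a x) • φ j x) 2 (volume.restrict Ω) := fun j =>
    ⟨hkm.smul (hφ j).1.continuous.aestronglyMeasurable, (h _ (hφ j)).trans_lt
      (ENNReal.mul_lt_top hΘ.lt_top (memLp_frobNorm (hdφ j)).eLpNorm_lt_top)⟩
  have hdφw' : Tendsto (fun j => eLpNorm (fderiv ℝ (φ j) - weakDeriv Ω w) 2 (volume.restrict Ω))
      atTop (𝓝 0) := by
    refine hdφw.congr fun j => ?_
    rw [← eLpNorm_neg, neg_sub]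
  have hcol : Tendsto (fun j => eLpNorm (fun x => frobNorm (fderiv ℝ (φ j) x - weakDeriv Ω w x)) 2
      (volume.restrict Ω)) atTop (𝓝 0) := by
    have h2 := ENNReal.Tendsto.const_mul (a := ENNReal.ofReal ‖columns s n‖)
      hdφw' (Or.inr ENNReal.ofReal_ne_top)
    rw [mul_zero] at h2
    refine tendsto_of_tendsto_of_tendsto_of_le_of_le tendsto_const_nhds h2
      (fun _ => zero_le) fun j => ?_
    rw [eLpNorm_frobNorm]
    exact eLpNorm_le_mul_eLpNorm_of_ae_le_mul
      (Eventually.of_forall fun x => (columns s n).le_opNorm _) 2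
  have hL : Tendsto (fun j => (∫ x in Ω, frobInner (weakDeriv Ω u x) (fderiv ℝ (φ j) x)) -
      ∫ x in Ω, frobInner (weakDeriv Ω u x) (weakDeriv Ω w x)) atTop (𝓝 0) := by
    refine tendsto_integral_sub_zero (C := 1) zero_le_one haL
      (Δ := fun j x => columns s n (fderiv ℝ (φ j) x - weakDeriv Ω w x))
      (fun j => integrable_frobInner hu.1.2.2 (hdφ j))
      (fun _ => integrable_frobInner hu.1.2.2 hw1.2.2)
      (fun j => (columns s n).continuous.comp_aestronglyMeasurable
        ((hdφ j).aestronglyMeasurable.sub hw1.2.2.aestronglyMeasurable)) ?_ fun j => ?_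
    · simpa only [eLpNorm_frobNorm] using hcol
    · refine Eventually.of_forall fun x => ?_
      rw [← inner_columns, ← inner_columns, ← inner_sub_right, ← map_sub, one_mul, ha,
        Real.norm_of_nonneg (frobNorm_nonneg _), ← norm_columns]
      exact norm_inner_le_norm _ _
  have hR : Tendsto (fun j =>
      (∫ x in Ω, inner ℝ (secondFormTrace P (u x) (weakDeriv Ω u x)) (φ j x)) -
      ∫ x in Ω, inner ℝ (secondFormTrace P (u x) (weakDeriv Ω u x)) (w x)) atTop (𝓝 0) := by
    refine tendsto_integral_sub_zero (C := 1) zero_le_one haL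
      (Δ := fun j x => (k * a x) • (φ j x - w x))
      (fun j => hint (hφ j).1.continuous.aestronglyMeasurable (hLφ j))
      (fun _ => hint hw1.2.1.aestronglyMeasurable hLw)
      (fun j => hkm.smul ((hφ j).1.continuous.aestronglyMeasurable.sub
        hw1.2.1.aestronglyMeasurable)) ?_ fun j => ?_
    · have h2 := ENNReal.Tendsto.const_mul (a := Θ) hcol (Or.inr hΘ)
      rw [mul_zero] at h2
      exact tendsto_of_tendsto_of_tendsto_of_le_of_le tendsto_const_nhds h2
        (fun _ => zero_le) fun j => hext (hφ j)
    · filter_upwards [htan, hu.2] with x hx hxM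
      rw [← inner_sub_right, one_mul, norm_smul, norm_mul, Real.norm_of_nonneg hk0,
        Real.norm_of_nonneg (ha0 x)]
      refine (norm_inner_secondFormTrace_le hU hMU hP hPC2 hk0 hk hxM hx _).trans ?_
      calc _ ≤ k * frobNorm (weakDeriv Ω u x) ^ 2 * ‖φ j x - w x‖ := by
            gcongr
            exact norm_normal_le hU hMU hP hPC2 hxM _
        _ = _ := by simp only [ha]; ring
  have hEL := fun j =>
    integral_frobInner_fderiv_eq hΩ hΩb hU hMU hP hPC2 hk0 hk hu hδ huU hcrit (hφ j)
  have hsum := hL.add hR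
  simp only [hEL, add_zero] at hsum
  have hconst : (fun j : ℕ => -(∫ x in Ω, inner ℝ (secondFormTrace P (u x) (weakDeriv Ω u x)) (φ j x)) -
      (∫ x in Ω, frobInner (weakDeriv Ω u x) (weakDeriv Ω w x)) +
      ((∫ x in Ω, inner ℝ (secondFormTrace P (u x) (weakDeriv Ω u x)) (φ j x)) -
      ∫ x in Ω, inner ℝ (secondFormTrace P (u x) (weakDeriv Ω u x)) (w x))) =
      fun _ => -(∫ x in Ω, frobInner (weakDeriv Ω u x) (weakDeriv Ω w x)) -
      ∫ x in Ω, inner ℝ (secondFormTrace P (u x) (weakDeriv Ω u x)) (w x) := by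
    funext j; ring
  rw [hconst] at hsum
  have := tendsto_nhds_unique tendsto_const_nhds hsum
  linarith

/-- The first-order term in the energy is controlled by the second-order one. -/
lemma abs_integral_frobInner_le [IsFiniteMeasure (volume.restrict Ω)] (hΩ : IsOpen Ω)
    (hΩb : Bornology.IsBounded Ω) (hU : IsOpen U) (hMU : M ⊆ U)
    (hP : IsClosestPointProjection M U P) (hPC2 : ContDiffOn ℝ 2 P U) {k : ℝ} (hk0 : 0 ≤ k)
    (hk : maxPrincipalCurvature M ≤ ENNReal.ofReal k)
    {u : E s → E n} (hu : MemW1Into 2 Ω M u) {δ : ℝ} (hδ : 0 < δ)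
    (huU : ∀ᵐ x ∂volume.restrict Ω, Metric.ball (u x) δ ⊆ U)
    (hcrit : IsCriticalPoint Ω (H1Boundary Ω M u) (harmonicEnergy Ω) u) {Θ : ℝ} (hΘ : 0 ≤ Θ)
    (h : ∀ φ : E s → E n, IsTestFunction Ω φ →
      eLpNorm (fun x => (k * frobNorm (weakDeriv Ω u x)) • φ x) 2 (volume.restrict Ω) ≤
      ENNReal.ofReal Θ * eLpNorm (fun x => frobNorm (fderiv ℝ φ x)) 2 (volume.restrict Ω))
    {w : E s → E n} (hw : MemH10 Ω w) (hwM : ∀ᵐ x ∂volume.restrict Ω, u x + w x ∈ M)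
    {ε : ℝ} (hε : ε < δ) (hkε : k * ε < 1) (hwε : ∀ᵐ x ∂volume.restrict Ω, ‖w x‖ ≤ ε) :
    |∫ x in Ω, frobInner (weakDeriv Ω u x) (weakDeriv Ω w x)| ≤
      1 / 2 * (Θ / (1 - k * ε)) ^ 2 * h1SeminormSq Ω w := by
  have htan := ae_fderiv_proj_weakDeriv hΩ hΩb hU hMU hP hPC2 hu hδ huU
  obtain ⟨hLw, hle, heq⟩ := integral_frobInner_weakDeriv_eq hΩ hΩb hU hMU hP hPC2 hk0 hk hu hδ huU
    hcrit ENNReal.ofReal_ne_top h hw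
  set β := 1 - k * ε
  have hβ : 0 < β := by simp only [β]; linarith
  have hdw := memLp_frobNorm hw.1.2.2
  have hS : ∫ x in Ω, ‖(k * frobNorm (weakDeriv Ω u x)) • w x‖ ^ 2 ≤
      Θ ^ 2 * h1SeminormSq Ω w := by
    have e : h1SeminormSq Ω w =
        (eLpNorm (fun x => frobNorm (weakDeriv Ω w x)) 2 (volume.restrict Ω)).toReal ^ 2 := by
      rw [← integral_norm_sq_eq hdw]
      simp only [h1SeminormSq, Real.norm_of_nonneg (frobNorm_nonneg _)]
    rw [integral_norm_sq_eq hLw, e, ← mul_pow]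
    refine pow_le_pow_left₀ ENNReal.toReal_nonneg ?_ 2
    have := ENNReal.toReal_mono (ENNReal.mul_ne_top ENNReal.ofReal_ne_top hdw.eLpNorm_ne_top) hle
    rwa [ENNReal.toReal_mul, ENNReal.toReal_ofReal hΘ] at this
  rw [heq, abs_neg]
  -- Pointwise, the curvature enters twice: `k|du|²` from the tension term and `(k/2)|w|²/β²` from
  -- the secant estimate. Their product is `(k|du||w|)²/(2β²)`.
  calc _ ≤ ∫ x in Ω, 1 / (2 * β ^ 2) * ‖(k * frobNorm (weakDeriv Ω u x)) • w x‖ ^ 2 := by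
        rw [← Real.norm_eq_abs]
        refine norm_integral_le_of_norm_le (hLw.norm.integrable_sq.const_mul _) ?_
        filter_upwards [htan, hu.2, hwM, huU, hwε] with x hx hxM hxw hxU hxε
        refine (norm_inner_secondFormTrace_le hU hMU hP hPC2 hk0 hk hxM hx _).trans ?_
        calc _ ≤ k * frobNorm (weakDeriv Ω u x) ^ 2 * (k / 2 * (‖w x‖ / β) ^ 2) := by
              gcongr
              exact norm_normal_part_le hU hMU hP hPC2 hk0 hk hxM hxw hxU hxε hε hkε
          _ = _ := by
              rw [norm_smul, norm_mul, Real.norm_of_nonneg hk0,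
                Real.norm_of_nonneg (frobNorm_nonneg _)]
              field_simp
    _ ≤ 1 / (2 * β ^ 2) * (Θ ^ 2 * h1SeminormSq Ω w) := by
        rw [integral_const_mul]
        gcongr
    _ = _ := by field_simp

lemma mem_H1Boundary_self (hΩ : IsOpen Ω) {u : E s → E n} (hu : MemW1Into 2 Ω M u) :
    u ∈ H1Boundary Ω M u :=
  ⟨hu, by rw [sub_self]; exact memH10_zero hΩ⟩

lemma MemW1.mono_exponent [IsFiniteMeasure (volume.restrict Ω)] {p r : ℝ≥0∞} (hpr : p ≤ r)
    {u : E s → E n} (hu : MemW1 r Ω u) : MemW1 p Ω u :=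
  ⟨hu.1, hu.2.1.mono_exponent hpr, hu.2.2.mono_exponent hpr⟩

lemma harmonicEnergy_sub_eq (hΩ : IsOpen Ω) {u v : E s → E n} (hu : MemW1 2 Ω u)
    (hv : MemW1 2 Ω v) : harmonicEnergy Ω v - harmonicEnergy Ω u =
      1 / 2 * h1SeminormSq Ω (v - u) +
        ∫ x in Ω, frobInner (weakDeriv Ω u x) (weakDeriv Ω (v - u) x) := by
  rw [harmonicEnergy, harmonicEnergy, h1SeminormSq_eq hv, h1SeminormSq_eq hu,
    h1SeminormSq_eq (hv.sub hΩ hu), ← inner_toL2 hu.2.2 (hv.sub hΩ hu).2.2]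
  change _ = _ + inner ℝ (gradL2 hu) (gradL2 (hv.sub hΩ hu))
  have h1 : gradL2 hv = gradL2 hu + gradL2 (hv.sub hΩ hu) := by
    rw [gradL2_sub hΩ hv hu]; abel
  rw [h1, norm_add_sq_real]
  ring

end Ellipticity

end HarmonicMaps

end

/-! ### Conclusion: choice of the constants -/

theorem proposition3p3 {s n d : ℕ}
    -- the Riemannian submanifold and its closest-point projection
    (M U : Set (HarmonicMaps.E n)) (hM : HarmonicMaps.IsC2Submanifold d M)
    (hU : IsOpen U) (hMU : M ⊆ U) (P : HarmonicMaps.E n → HarmonicMaps.E n)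
    (hP : HarmonicMaps.IsClosestPointProjection M U P) (hPC2 : ContDiffOn ℝ 2 P U)
    -- the domain
    (Ω : Set (HarmonicMaps.E s)) (hΩ : IsOpen Ω) (hΩb : Bornology.IsBounded Ω)
    -- the critical point
    (q : ℝ) (hq : max 2 (s : ℝ) < q) (u : HarmonicMaps.E s → HarmonicMaps.E n)
    (hu : HarmonicMaps.MemW1Into (ENNReal.ofReal q) Ω M u)
    (huU : ∃ δ > 0, ∀ᵐ x ∂volume.restrict Ω, Metric.ball (u x) δ ⊆ U)
    (hcrit : HarmonicMaps.IsCriticalPoint Ω (HarmonicMaps.H1Boundary Ω M u)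
      (HarmonicMaps.harmonicEnergy Ω) u)
    -- the smallness condition
    (hsmall : HarmonicMaps.derivLpNorm q Ω u <
      (HarmonicMaps.maxPrincipalCurvature M *
        HarmonicMaps.poincareConstant (2 * q / (q - 2)) Ω)⁻¹) :
    HarmonicMaps.IsH1Elliptic Ω (HarmonicMaps.H1Boundary Ω M u)
      (HarmonicMaps.harmonicEnergy Ω) u := by
  have hfin : IsFiniteMeasure (volume.restrict Ω) :=
    isFiniteMeasure_restrict.2 hΩb.measure_lt_top.ne
  have hq2 : 2 < q := (le_max_left _ _).trans_lt hq
  have hu2 : HarmonicMaps.MemW1Into 2 Ω M u := by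
    refine ⟨hu.1.mono_exponent ?_, hu.2⟩
    rw [show (2 : ℝ≥0∞) = ENNReal.ofReal 2 by simp]
    exact ENNReal.ofReal_le_ofReal hq2.le
  refine ⟨HarmonicMaps.mem_H1Boundary_self hΩ hu2, ?_⟩
  -- The empty domain is separate because positivity of the Poincaré constant needs a point of `Ω`.
  rcases Ω.eq_empty_or_nonempty with rfl | hne
  · exact ⟨1, 1, 1, one_pos, one_pos, one_pos, fun v _ _ => by
      simp [HarmonicMaps.harmonicEnergy, HarmonicMaps.h1SeminormSq]⟩
  obtain ⟨δ, hδ, huU⟩ := huU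
  obtain ⟨k, Θ, hk0, hk, hΘ0, hΘ1, h⟩ := HarmonicMaps.exists_contraction_of_small hΩ hne hq2
    hu2.1.2.2.aestronglyMeasurable hsmall
  -- The first entry keeps the segments from `u` to `v` inside `U`; the second gives `k ε ≤ (1 -
  -- Θ)/2`, hence `Θ < 1 - k ε`. The `k + 1` covers `k = 0`.
  set ε := min (δ / 2) ((1 - Θ) / (2 * (k + 1))) with hε
  have hε0 : 0 < ε := lt_min (by positivity) (div_pos (by linarith) (by positivity))
  have hεδ : ε < δ := (min_le_left _ _).trans_lt (by linarith)
  have hkε : k * ε ≤ (1 - Θ) / 2 := by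
    have h1 : (k + 1) * ε ≤ (k + 1) * ((1 - Θ) / (2 * (k + 1))) := by
      gcongr; exact min_le_right _ _
    have h2 : (k + 1) * ((1 - Θ) / (2 * (k + 1))) = (1 - Θ) / 2 := by field_simp
    linarith
  have hβ : Θ < 1 - k * ε := by linarith
  set τ := Θ / (1 - k * ε) with hτ
  have hτ0 : 0 ≤ τ := div_nonneg hΘ0 (by linarith)
  have hτ1 : τ < 1 := (div_lt_one (by linarith)).2 hβ
  have hτ2 : τ ^ 2 < 1 := pow_lt_one₀ hτ0 hτ1 two_ne_zero
  -- The cross term lies within `½τ²|w|²` of zero, so the energy gap lies between `½(1 - τ²)|w|²`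
  -- and `½(1 + τ²)|w|² ≤ |w|²`.
  refine ⟨1 / 2 * (1 - τ ^ 2), 1, ε, by linarith, one_pos, hε0, fun v hv hvε => ?_⟩
  have hwM : ∀ᵐ x ∂volume.restrict Ω, u x + (v - u) x ∈ M := by
    filter_upwards [hv.1.2] with x hx
    simpa using hx
  have hb := HarmonicMaps.abs_integral_frobInner_le hΩ hΩb hU hMU hP hPC2 hk0 hk hu2 hδ huU hcrit
    hΘ0 h hv.2 hwM hεδ (by linarith) hvε
  rw [HarmonicMaps.harmonicEnergy_sub_eq hΩ hu2.1 hv.1.1]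
  have hS : 0 ≤ HarmonicMaps.h1SeminormSq Ω (v - u) :=
    integral_nonneg fun _ => sq_nonneg _
  have h1 := abs_le.1 hb
  have h2 : τ ^ 2 * HarmonicMaps.h1SeminormSq Ω (v - u) ≤ HarmonicMaps.h1SeminormSq Ω (v - u) :=
    mul_le_of_le_one_left hS hτ2.le
  constructor <;> nlinarith
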